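/- Let $h,k,s\ge 1$ be integers, $N=h+k$, and write $z=(x,y)\in\mathbb{R}^h\times\mathbb{R}^k=\mathbb{R}^N$. Let $\nabla_G u=(\nabla_x u,|x|^s\nabla_y u)$ be the (weak) Grushin gradient. For an open set $\Omega\subseteq\mathbb{R}^N$ let $W^{1,2}_{G,0}(\Omega)$ be the closure of $C_c^\infty(\Omega)$ in the space $W^{1,2}_G(\Omega)=\{u\in L^2(\Omega):\nabla_G u\in L^2(\Omega)^N\}$ with norm $(\|u\|_{L^2}^2+\|\nabla_G u\|_{L^2}^2)^{1/2}$. (Rellich–Pohozaev identity.) Let $\Omega\subset\mathbb{R}^N$ be a bounded open set of class $C^1$ with outer unit normal $\mathbf{n}=(\mathbf{n}_x,\mathbf{n}_y)$ and surface measure $\sigma$ on $\partial\Omega$, and set $\mathbf{n}_G(z)=(\mathbf{n}_x,|x|^s\mathbf{n}_y)$. Let $\lambda\in\mathbb{R}$ be an eigenvalue of the Dirichlet Grushin Laplacian $-\Delta_G=-\Delta_x-|x|^{2s}\Delta_y$ on $\Omega$ with eigenfunction $u$, i.e. $0\ne u\in W^{1,2}_{G,0}(\Omega)$ and $$\int_\Omega\nabla_G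 u\cdot\nabla_G\varphi\,dz=\lambda\int_\Omega u\varphi\,dz\qquad\text{for all }\varphi\in W^{1,2}_{G,0}(\Omega),$$ normalized by $\|u\|_{L^2(\Omega)}=1$. Suppose that $u\in W^{1,2}_0(\Omega)\cap W^{2,2}(\Omega)$. Then the normal derivative $\frac{\partial u}{\partial\mathbf{n}}=\nabla u\cdot\mathbf{n}$ exists on $\partial\Omega$ in the sense of $L^2(\partial\Omega)$-traces of $\nabla u$, the function $\left(\frac{\partial u}{\partial\mathbf{n}}\right)^2|\mathbf{n}_G|^2\,\big((x,(1+s)y)\cdot\mathbf{n}\big)$ is $\sigma$-integrable on $\partial\Omega$, and $$\lambda=\frac12\int_{\partial\Omega}\left(\frac{\partial u}{\partial\mathbf{n}}\right)^2|\mathbf{n}_G|^2\,\big((x,(1+s)y)\cdot\mathbf{n}\big)\,d\sigma.$$ -/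

import Mathlib

open MeasureTheory Filter Topology
open scoped ContDiff ENNReal

noncomputable section

namespace Grushin

/-! ### Sobolev spaces on open subsets of Euclidean space -/

section Sobolev

variable {ι : Type*} [Fintype ι] [DecidableEq ι]

/-- The classical partial derivative `∂φ/∂zᵢ`. -/
def partialDeriv (i : ι) (φ : EuclideanSpace ℝ ι → ℝ) (z : EuclideanSpace ℝ ι) : ℝ :=
  fderiv ℝ φ z (EuclideanSpace.single i 1)

/-- `φ ∈ C_c^∞(Ω)`. -/
def IsTestFunction (Ω : Set (EuclideanSpace ℝ ι)) (φ : EuclideanSpace ℝ ι → ℝ) : Prop :=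
  ContDiff ℝ ∞ φ ∧ HasCompactSupport φ ∧ tsupport φ ⊆ Ω

/-- `u ∈ L²(Ω)`; the values of `u` outside `Ω` are irrelevant. -/
def MemL2 (Ω : Set (EuclideanSpace ℝ ι)) (u : EuclideanSpace ℝ ι → ℝ) : Prop :=
  MemLp u 2 (volume.restrict Ω)

/-- `f n → u` in `L²(Ω)`. -/
def TendstoL2 (Ω : Set (EuclideanSpace ℝ ι)) (f : ℕ → EuclideanSpace ℝ ι → ℝ)
    (u : EuclideanSpace ℝ ι → ℝ) : Prop :=
  Tendsto (fun n => eLpNorm (f n - u) 2 (volume.restrict Ω)) atTop (𝓝 0)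

/-- The functions `u` and `D i` lie in `L²(Ω)` and `D i` is the weak derivative `∂u/∂zᵢ` in `Ω`,
for every `i`. -/
def IsWeakGrad (Ω : Set (EuclideanSpace ℝ ι)) (u : EuclideanSpace ℝ ι → ℝ)
    (D : ι → EuclideanSpace ℝ ι → ℝ) : Prop :=
  MemL2 Ω u ∧ (∀ i, MemL2 Ω (D i)) ∧
    ∀ i, ∀ φ, IsTestFunction Ω φ →
      ∫ z in Ω, u z * partialDeriv i φ z = -∫ z in Ω, D i z * φ z

/-- The Sobolev space `W^{1,2}(Ω)`. -/
def MemW12 (Ω : Set (EuclideanSpace ℝ ι)) (u : EuclideanSpace ℝ ι → ℝ) : Prop :=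
  ∃ D, IsWeakGrad Ω u D

/-- The Sobolev space `W^{2,2}(Ω)`. -/
def MemW22 (Ω : Set (EuclideanSpace ℝ ι)) (u : EuclideanSpace ℝ ι → ℝ) : Prop :=
  ∃ D, IsWeakGrad Ω u D ∧ ∀ i, MemW12 Ω (D i)

/-- The Sobolev space `W_0^{1,2}(Ω)`: the closure of `C_c^∞(Ω)` in `W^{1,2}(Ω)`. -/
def MemW120 (Ω : Set (EuclideanSpace ℝ ι)) (u : EuclideanSpace ℝ ι → ℝ) : Prop :=
  ∃ D, IsWeakGrad Ω u D ∧ ∃ φ : ℕ → EuclideanSpace ℝ ι → ℝ,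
    (∀ n, IsTestFunction Ω (φ n)) ∧ TendstoL2 Ω φ u ∧
      ∀ i, TendstoL2 Ω (fun n => partialDeriv i (φ n)) (D i)

end Sobolev

/-! ### Open sets of class `C¹`, outer normal, surface measure, traces -/

section Boundary

variable {ι : Type*} [Fintype ι]

/-- In the ball of radius `r` about `p`, the set `Ω` is the part lying below the graph of the `C¹`
function `γ` defined on the hyperplane orthogonal to the unit vector `e`, where `e` is the
"upward" direction. -/
def IsC1Chart (Ω : Set (EuclideanSpace ℝ ι)) (p e : EuclideanSpace ℝ ι)
    (γ : (Submodule.span ℝ {e})ᗮ → ℝ) (r : ℝ) : Prop :=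
  ‖e‖ = 1 ∧ ContDiff ℝ 1 γ ∧ 0 < r ∧
    ∀ z ∈ Metric.ball p r,
      (z ∈ Ω ↔ inner ℝ e z < γ ((Submodule.span ℝ {e})ᗮ.orthogonalProjectionOnto z))

/-- `Ω` is of class `C¹`: near each boundary point it is, in suitable orthonormal coordinates, the
region below the graph of a `C¹` function. -/
def IsOfClassC1 (Ω : Set (EuclideanSpace ℝ ι)) : Prop :=
  ∀ p ∈ frontier Ω, ∃ e γ r, IsC1Chart Ω p e γ r

/-- The vector `e - ∇γ` normal to the graph of `γ` and pointing upwards. -/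
def graphNormal (p e : EuclideanSpace ℝ ι) (γ : (Submodule.span ℝ {e})ᗮ → ℝ) :
    EuclideanSpace ℝ ι :=
  e - ((gradient γ ((Submodule.span ℝ {e})ᗮ.orthogonalProjectionOnto p) :
    (Submodule.span ℝ {e})ᗮ) : EuclideanSpace ℝ ι)

/-- `ν` is the outer unit normal to `Ω` at `p`, computed in some chart. -/
def IsOuterUnitNormal (Ω : Set (EuclideanSpace ℝ ι)) (p ν : EuclideanSpace ℝ ι) : Prop :=
  ∃ e γ r, IsC1Chart Ω p e γ r ∧ ν = ‖graphNormal p e γ‖⁻¹ • graphNormal p e γ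

/-- The function `z ↦ ⟨e, z⟩ - γ(z')` is negative exactly in `Ω` near `p`, and its gradient at
`p` is `graphNormal p e γ`; hence `p + t v` lies in `Ω` for small `t > 0` if `v` points strictly
to the negative side, and outside `Ω` if `v` points strictly to the positive side. -/
theorem IsC1Chart.eventually_mem {Ω : Set (EuclideanSpace ℝ ι)} {p e : EuclideanSpace ℝ ι}
    {γ : (Submodule.span ℝ {e})ᗮ → ℝ} {r : ℝ} (hc : IsC1Chart Ω p e γ r)
    (hΩ : IsOpen Ω) (hp : p ∈ frontier Ω) (v : EuclideanSpace ℝ ι) :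
    (inner ℝ (graphNormal p e γ) v < 0 → ∀ᶠ t : ℝ in 𝓝[>] 0, p + t • v ∈ Ω) ∧
      (0 < inner ℝ (graphNormal p e γ) v → ∀ᶠ t : ℝ in 𝓝[>] 0, p + t • v ∉ Ω) := by
  obtain ⟨he, hγ, hr, hb⟩ := hc
  set P := (Submodule.span ℝ {e})ᗮ.orthogonalProjectionOnto with hP
  let f : EuclideanSpace ℝ ι → ℝ := fun z => inner ℝ e z - γ (P z)
  have hcont : Continuous f := by
    have := hγ.continuous
    fun_prop
  have hmem : ∀ z ∈ Metric.ball p r, (z ∈ Ω ↔ f z < 0) := fun z hz => by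
    rw [hb z hz]; simp [f]
  have hpb : p ∈ Metric.ball p r := Metric.mem_ball_self hr
  have hf0 : f p = 0 := by
    apply le_antisymm
    · by_contra! hlt
      have h1 : ∀ᶠ z in 𝓝 p, z ∉ Ω := by
        filter_upwards [hcont.continuousAt.eventually (lt_mem_nhds hlt),
          Metric.ball_mem_nhds p hr] with z hz hz' hzΩ
        exact absurd ((hmem z hz').1 hzΩ) (not_lt.2 hz.le)
      have h2 := mem_closure_iff_frequently.1 (frontier_subset_closure hp)
      exact h2 h1
    · by_contra! hlt
      have : p ∈ Ω := (hmem p hpb).2 hlt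
      rw [hΩ.frontier_eq] at hp
      exact hp.2 this
  have hgrad : HasGradientAt γ (gradient γ (P p)) (P p) :=
    (hγ.differentiable one_ne_zero _).hasGradientAt
  have hline : HasDerivAt (fun t : ℝ => p + t • v) v 0 := by
    simpa using ((hasDerivAt_id (0 : ℝ)).smul_const v).const_add p
  have hder : HasDerivAt (fun t : ℝ => f (p + t • v)) (inner ℝ (graphNormal p e γ) v) 0 := by
    have h1 : HasDerivAt (fun t : ℝ => inner ℝ e (p + t • v)) (inner ℝ e v) 0 := by
      exact (innerSL ℝ e).hasFDerivAt.comp_hasDerivAt (0 : ℝ) hline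
    have h2 : HasDerivAt (fun t : ℝ => P (p + t • v)) (P v) 0 :=
      P.hasFDerivAt.comp_hasDerivAt (0 : ℝ) hline
    have hg := hgrad.hasFDerivAt
    have h3 : HasDerivAt (fun t : ℝ => γ (P (p + t • v)))
        (inner ℝ (gradient γ (P p)) (P v)) 0 := by
      have hg' : HasFDerivAt γ (InnerProductSpace.toDual ℝ _ (gradient γ (P p)))
        (P (p + (0 : ℝ) • v)) := by simpa using hg
      exact hg'.comp_hasDerivAt (0 : ℝ) h2
    have h4 : inner ℝ (gradient γ (P p)) (P v) =
        inner ℝ ((gradient γ (P p) : (Submodule.span ℝ {e})ᗮ) : EuclideanSpace ℝ ι) v := by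
      rw [hP, Submodule.inner_orthogonalProjectionOnto_eq_of_mem_left]
    have h5 := h1.sub h3
    rw [h4, ← inner_sub_left] at h5
    exact h5
  have hball : ∀ᶠ t : ℝ in 𝓝[>] 0, p + t • v ∈ Metric.ball p r := by
    apply mem_nhdsWithin_of_mem_nhds
    have : Tendsto (fun t : ℝ => p + t • v) (𝓝 0) (𝓝 p) := by
      simpa using hline.continuousAt.tendsto
    exact this (Metric.ball_mem_nhds p hr)
  have hslope := (hasDerivAt_iff_tendsto_slope_zero.1 hder).mono_left
    (nhdsWithin_mono (0 : ℝ) (fun t (ht : 0 < t) => ht.ne'))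
  simp only [zero_add, zero_smul, add_zero, hf0, sub_zero, smul_eq_mul] at hslope
  constructor
  · intro hneg
    filter_upwards [hslope.eventually (gt_mem_nhds hneg), hball, self_mem_nhdsWithin]
      with t ht htb ht0
    rw [hmem _ htb]
    have ht0' : 0 < t⁻¹ := inv_pos.2 ht0
    by_contra! hge
    exact absurd ht (not_lt.2 (mul_nonneg ht0'.le hge))
  · intro hpos
    filter_upwards [hslope.eventually (lt_mem_nhds hpos), hball, self_mem_nhdsWithin]
      with t ht htb ht0
    rw [hmem _ htb]
    have ht0' : 0 < t⁻¹ := inv_pos.2 ht0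
    intro hge
    exact absurd ht (not_lt.2 (mul_nonpos_of_nonneg_of_nonpos ht0'.le hge.le))

/-- The outer unit normal at a boundary point does not depend on the chart. -/
theorem IsOuterUnitNormal.unique {Ω : Set (EuclideanSpace ℝ ι)} {p ν ν' : EuclideanSpace ℝ ι}
    (hΩ : IsOpen Ω) (hp : p ∈ frontier Ω) (hν : IsOuterUnitNormal Ω p ν)
    (hν' : IsOuterUnitNormal Ω p ν') : ν = ν' := by
  obtain ⟨e, γ, r, hc, rfl⟩ := hν
  obtain ⟨e', γ', r', hc', rfl⟩ := hν'
  have hne : ∀ {e : EuclideanSpace ℝ ι} {γ : (Submodule.span ℝ {e})ᗮ → ℝ} {r : ℝ},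
      IsC1Chart Ω p e γ r → graphNormal p e γ ≠ 0 := by
    intro e γ r hc h0
    have h1 : inner ℝ (graphNormal p e γ) e = (1 : ℝ) := by
      have : inner ℝ ((gradient γ ((Submodule.span ℝ {e})ᗮ.orthogonalProjectionOnto p) :
          (Submodule.span ℝ {e})ᗮ) : EuclideanSpace ℝ ι) e = (0 : ℝ) :=
        Submodule.inner_left_of_mem_orthogonal (Submodule.mem_span_singleton_self e)
          (Subtype.property _)
      rw [graphNormal, inner_sub_left, this, real_inner_self_eq_norm_sq, hc.1]
      norm_num
    rw [h0, inner_zero_left] at h1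
    exact zero_ne_one h1
  have hn := norm_pos_iff.2 (hne hc)
  have hn' := norm_pos_iff.2 (hne hc')
  set a := graphNormal p e γ with ha
  set a' := graphNormal p e' γ' with ha'
  have hu : ‖‖a‖⁻¹ • a‖ = 1 := by
    rw [norm_smul, norm_inv, norm_norm, inv_mul_cancel₀ hn.ne']
  have hu' : ‖‖a'‖⁻¹ • a'‖ = 1 := by
    rw [norm_smul, norm_inv, norm_norm, inv_mul_cancel₀ hn'.ne']
  by_contra hdiff
  have hlt : inner ℝ (‖a‖⁻¹ • a) (‖a'‖⁻¹ • a') < (1 : ℝ) :=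
    inner_lt_one_iff_real_of_norm_eq_one hu hu' |>.2 hdiff
  let v := ‖a'‖⁻¹ • a' - ‖a‖⁻¹ • a
  have hv : inner ℝ a v < 0 := by
    have : inner ℝ (‖a‖⁻¹ • a) v < (0 : ℝ) := by
      simp only [v]
      rw [inner_sub_right, real_inner_self_eq_norm_sq, hu]; linarith
    rw [real_inner_smul_left] at this
    by_contra! hge
    exact absurd this (not_lt.2 (mul_nonneg (inv_pos.2 hn).le hge))
  have hv' : 0 < inner ℝ a' v := by
    have : (0 : ℝ) < inner ℝ (‖a'‖⁻¹ • a') v := by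
      simp only [v]
      rw [inner_sub_right, real_inner_self_eq_norm_sq, hu', real_inner_comm]; linarith
    rw [real_inner_smul_left] at this
    exact pos_of_mul_pos_right this (inv_pos.2 hn').le
  obtain ⟨t, h1, h2⟩ :=
    (((hc.eventually_mem hΩ hp v).1 hv).and ((hc'.eventually_mem hΩ hp v).2 hv')).exists
  exact h2 h1

open Classical in
/-- The outer unit normal to `Ω` at `p` (zero if there is none). -/
def outerNormal (Ω : Set (EuclideanSpace ℝ ι)) (p : EuclideanSpace ℝ ι) : EuclideanSpace ℝ ι :=
  if hp : ∃ ν, IsOuterUnitNormal Ω p ν then hp.choose else 0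

/-- The surface measure `σ` on `∂Ω`: the Hausdorff measure of dimension `N - 1`, normalized as in
Euclidean geometry. -/
def surfaceMeasure (Ω : Set (EuclideanSpace ℝ ι)) : Measure (EuclideanSpace ℝ ι) :=
  (Measure.euclideanHausdorffMeasure (Fintype.card ι - 1)).restrict (frontier Ω)

variable [DecidableEq ι]

/-- `g ∈ L²(∂Ω)` is the trace on `∂Ω` of `f ∈ W^{1,2}(Ω)`: there are smooth functions `ψ n` with
`ψ n → f` in `W^{1,2}(Ω)` and `ψ n → g` in `L²(∂Ω)`. -/
def IsTrace (Ω : Set (EuclideanSpace ℝ ι)) (f g : EuclideanSpace ℝ ι → ℝ) : Prop :=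
  MemLp g 2 (surfaceMeasure Ω) ∧
    ∃ D, IsWeakGrad Ω f D ∧ ∃ ψ : ℕ → EuclideanSpace ℝ ι → ℝ,
      (∀ n, ContDiff ℝ ∞ (ψ n)) ∧ TendstoL2 Ω ψ f ∧
        (∀ i, TendstoL2 Ω (fun n => partialDeriv i (ψ n)) (D i)) ∧
          Tendsto (fun n => eLpNorm (ψ n - g) 2 (surfaceMeasure Ω)) atTop (𝓝 0)

/-- `g` is the normal derivative `∂u/∂n = ∇u · n` on `∂Ω` of `u ∈ W^{2,2}(Ω)`, where `∇u` on `∂Ω`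
is understood in the sense of traces. -/
def IsNormalDerivative (Ω : Set (EuclideanSpace ℝ ι)) (u g : EuclideanSpace ℝ ι → ℝ) : Prop :=
  ∃ D T : ι → EuclideanSpace ℝ ι → ℝ, IsWeakGrad Ω u D ∧ (∀ i, IsTrace Ω (D i) (T i)) ∧
    g =ᵐ[surfaceMeasure Ω] fun z => ∑ i, T i z * outerNormal Ω z i

end Boundary

/-! ### The Grushin operator on `ℝ^h × ℝ^k` -/

section Operator

variable {h k : ℕ}

/-- The component `x ∈ ℝ^h` of `z = (x, y)`; the coordinates of `y` are the `z (Sum.inr j)`. -/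
def xPart (z : EuclideanSpace ℝ (Fin h ⊕ Fin k)) : EuclideanSpace ℝ (Fin h) :=
  WithLp.toLp 2 fun i => z (Sum.inl i)

/-- The diagonal of the matrix `I_G(z)`: `1` in the `x`-directions, `|x|^s` in the
`y`-directions. -/
def weight (s : ℕ) (i : Fin h ⊕ Fin k) (z : EuclideanSpace ℝ (Fin h ⊕ Fin k)) : ℝ :=
  Sum.elim (fun _ => 1) (fun _ => ‖xPart z‖ ^ s) i

/-- The functions `u` and `G i` lie in `L²(Ω)` and `G` is the Grushin gradient
`∇_G u = (∂ₓu, |x|^s ∂_y u)` in the weak sense. Since `weight s i` does not depend on the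
coordinate `zᵢ`, the formal adjoint of `weight s i * ∂ᵢ` is `- weight s i * ∂ᵢ`. -/
def IsWeakGrushinGrad (s : ℕ) (Ω : Set (EuclideanSpace ℝ (Fin h ⊕ Fin k)))
    (u : EuclideanSpace ℝ (Fin h ⊕ Fin k) → ℝ)
    (G : Fin h ⊕ Fin k → EuclideanSpace ℝ (Fin h ⊕ Fin k) → ℝ) : Prop :=
  MemL2 Ω u ∧ (∀ i, MemL2 Ω (G i)) ∧
    ∀ i, ∀ φ, IsTestFunction Ω φ →
      ∫ z in Ω, u z * (weight s i z * partialDeriv i φ z) = -∫ z in Ω, G i z * φ z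

/-- The space `W_{G,0}^{1,2}(Ω)`: the closure of `C_c^∞(Ω)` in the weighted Sobolev space
`W_G^{1,2}(Ω)` of the functions in `L²(Ω)` with Grushin gradient in `L²(Ω)`. -/
def MemWG0 (s : ℕ) (Ω : Set (EuclideanSpace ℝ (Fin h ⊕ Fin k)))
    (u : EuclideanSpace ℝ (Fin h ⊕ Fin k) → ℝ) : Prop :=
  ∃ G, IsWeakGrushinGrad s Ω u G ∧ ∃ φ : ℕ → EuclideanSpace ℝ (Fin h ⊕ Fin k) → ℝ,
    (∀ n, IsTestFunction Ω (φ n)) ∧ TendstoL2 Ω φ u ∧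
      ∀ i, TendstoL2 Ω (fun n z => weight s i z * partialDeriv i (φ n) z) (G i)

/-- `u` is an eigenfunction of the Dirichlet Grushin Laplacian on `Ω` with eigenvalue `ev`:
`u ∈ W_{G,0}^{1,2}(Ω)` is not zero and
`∫_Ω ∇_G u · ∇_G φ = ev ∫_Ω u φ` for all `φ ∈ W_{G,0}^{1,2}(Ω)`. -/
def IsEigenfunction (s : ℕ) (Ω : Set (EuclideanSpace ℝ (Fin h ⊕ Fin k))) (ev : ℝ)
    (u : EuclideanSpace ℝ (Fin h ⊕ Fin k) → ℝ) : Prop :=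
  MemWG0 s Ω u ∧ ¬ u =ᵐ[volume.restrict Ω] 0 ∧
    ∀ φ, MemWG0 s Ω φ → ∀ G H, IsWeakGrushinGrad s Ω u G → IsWeakGrushinGrad s Ω φ H →
      ∫ z in Ω, ∑ i, G i z * H i z = ev * ∫ z in Ω, u z * φ z

/-- The vector `n_G = (n_x, |x|^s n_y)` at the point `z`, for `n` the outer unit normal. -/
def grushinNormal (s : ℕ) (Ω : Set (EuclideanSpace ℝ (Fin h ⊕ Fin k)))
    (z : EuclideanSpace ℝ (Fin h ⊕ Fin k)) : EuclideanSpace ℝ (Fin h ⊕ Fin k) :=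
  WithLp.toLp 2 fun i => weight s i z * outerNormal Ω z i

/-- The generator `(x, (1 + s) y)` of the Grushin dilations `(x, y) ↦ (t x, t^(1+s) y)`. -/
def dilationField (s : ℕ) (z : EuclideanSpace ℝ (Fin h ⊕ Fin k)) :
    EuclideanSpace ℝ (Fin h ⊕ Fin k) :=
  WithLp.toLp 2 (Sum.elim (fun i => z (Sum.inl i)) (fun j => (1 + (s : ℝ)) * z (Sum.inr j)))

end Operator

end Grushin

end

/-!
The proof integrates the divergence of the Rellich–Pohozaev vector field. With
`a i = (weight s i)²`, `A = diag a` and the dilation field `X(z) = (x, (1 + s) y)`, put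
`F = (X · ∇u) A∇u - (1/2) (A∇u · ∇u) X`. The coefficient `a i` does not depend on `zᵢ`, and it
satisfies the Euler identity `X(a i) = 2 (c i - 1) a i`, where `c` lists the exponents of the
dilations. Hence `div F` equals `(1 - (1/2) ∑ c i) A∇u · ∇u + (X · ∇u) div(A∇u)`. Since
`div(A∇u) = -ev u` almost everywhere, `∫ A∇u · ∇u = ev` and
`∫ (X · ∇u) u = -(1/2) (∑ c i) ∫ u²`, the integral of `div F` over `Ω` is `ev`. On the boundary
`∇u` is normal, so that `F · n` is half of the integrand in the boundary term
(`sum_rellich_identity`, `rellich_pohozaev`).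

What makes this rigorous on a domain that is only of class `C¹`, for `u` in `W_0^{1,2} ∩ W^{2,2}`:

* The divergence theorem (`integral_fderiv_eq_boundary`). A partition of unity reduces it to the
  region below a graph, which a volume-preserving shear flattens (`integral_fderiv_subgraph`); the
  boundary integral becomes one over the Hausdorff measure by the area formula for graphs
  (`comap_graphMap`), obtained by comparing the graph locally with its tangent planes.
* The existence of traces (`exists_isTrace`). Smooth functions on the whole space are dense in
  `W^{1,2}(Ω)`, by mollification along the interior cones of the domain (`exists_smooth_approx`),
  and the trace inequality follows from the divergence theorem for `ψ² V`, with `V` a smooth field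
  transversal to the boundary (`exists_trace_inequality`).
* Green's formula for products of Sobolev functions (`IsTrace.green`), by approximation. It is
  applied to the products `∂ᵢu ∂ⱼu`, which is where `u ∈ W^{2,2}` enters.
* The trace `T` of `∇u` is normal (`trace_gradient_normal`): for smooth `θ` the boundary integral
  of `θ (T i n j - T j n i)` is that of `∂ⱼθ ∂ᵢu - ∂ᵢθ ∂ⱼu` over `Ω`, which vanishes for test
  functions and hence for `u ∈ W_0^{1,2}`.
* For the Grushin operator, `|x|^s` need not be smooth, but `|x|^(2s)` is a polynomial, and `|x|^s`
  is constant along the directions in which it is differentiated. So the Grushin gradient of `u` is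
  `weight s i * ∂ᵢu` (`MemW120.isWeakGrushinGrad`), and testing the weak equation gives the
  equation almost everywhere (`IsEigenfunction.ae_eq`).
-/

namespace Grushin

/-! ### The area formula for graphs -/

section AreaFormula

open Module Measure

/-- Two measures compare globally if they compare on all small sets. -/
theorem measure_le_of_locally_le {X : Type*} [TopologicalSpace X] [SecondCountableTopology X]
    [MeasurableSpace X] [BorelSpace X] {μ ν : Measure X}
    (h : ∀ x, ∃ U ∈ 𝓝 x, ∀ S ⊆ U, MeasurableSet S → μ S ≤ ν S) : μ ≤ ν := by
  choose U hU hle using h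
  obtain ⟨c, hc, hcov⟩ :=
    TopologicalSpace.countable_cover_nhds fun x => interior_mem_nhds.2 (hU x)
  rcases c.eq_empty_or_nonempty with rfl | hne
  · have : IsEmpty X := by simpa [Set.eq_empty_iff_forall_notMem, isEmpty_iff] using hcov.symm
    exact Measure.le_iff.2 fun s _ => by simp [Set.eq_empty_of_isEmpty s]
  obtain ⟨a, rfl⟩ := hc.exists_eq_range hne
  let V : ℕ → Set X := fun n => interior (U (a n))
  have hV : ⋃ n, disjointed V n = Set.univ := by
    rw [iUnion_disjointed, ← hcov]; simp [V]
  have hVm : ∀ n, MeasurableSet (disjointed V n) := fun n =>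
    MeasurableSet.disjointed (fun n => isOpen_interior.measurableSet) n
  refine Measure.le_iff.2 fun s hs => ?_
  have hdec : ∀ m : Measure X, m s = ∑' n, m (s ∩ disjointed V n) := fun m => by
    rw [← measure_iUnion, ← Set.inter_iUnion, hV, Set.inter_univ]
    · exact fun i j hij => ((disjoint_disjointed V hij).mono Set.inter_subset_right
        Set.inter_subset_right)
    · exact fun n => hs.inter (hVm n)
  rw [hdec μ, hdec ν]
  refine ENNReal.tsum_le_tsum fun n => hle (a n) _ ?_ (hs.inter (hVm n))
  exact Set.inter_subset_right.trans ((disjointed_subset V n).trans interior_subset)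

/-- If `f` expands distances on `S` by at most the factor `C` compared with `g`, then `f ∘ g⁻¹` is
`C`-Lipschitz from `g '' S` onto `f '' S`. -/
theorem euclideanHausdorffMeasure_image_le_of_dist_le {X Y Z : Type*} [MetricSpace Y]
    [MeasurableSpace Y] [BorelSpace Y] [MetricSpace Z] [MeasurableSpace Z] [BorelSpace Z]
    {f : X → Y} {g : X → Z} {S : Set X} {C : NNReal} (d : ℕ)
    (h : ∀ x ∈ S, ∀ y ∈ S, dist (f x) (f y) ≤ C * dist (g x) (g y)) :
    (euclideanHausdorffMeasure d : Measure Y) (f '' S) ≤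
      (C : ℝ≥0∞) ^ d * (euclideanHausdorffMeasure d : Measure Z) (g '' S) := by
  rcases S.eq_empty_or_nonempty with rfl | ⟨x0, hx0⟩
  · simp
  have : Nonempty X := ⟨x0⟩
  have hinv : ∀ x ∈ S, Function.invFunOn g S (g x) ∈ S ∧ g (Function.invFunOn g S (g x)) = g x :=
    fun x hx => ⟨Function.invFunOn_mem ⟨x, hx, rfl⟩, Function.invFunOn_eq ⟨x, hx, rfl⟩⟩
  have hlip : LipschitzOnWith C (f ∘ Function.invFunOn g S) (g '' S) := by
    refine LipschitzOnWith.of_dist_le_mul ?_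
    rintro _ ⟨x, hx, rfl⟩ _ ⟨y, hy, rfl⟩
    have := h _ (hinv x hx).1 _ (hinv y hy).1
    rwa [(hinv x hx).2, (hinv y hy).2] at this
  have himg : (f ∘ Function.invFunOn g S) '' (g '' S) = f '' S := by
    rw [Set.image_image]
    refine Set.image_congr fun x hx => ?_
    have := h _ (hinv x hx).1 x hx
    rw [(hinv x hx).2, dist_self, mul_zero] at this
    exact dist_le_zero.1 this
  have := hlip.hausdorffMeasure_image_le (d := d) (Nat.cast_nonneg d)
  rw [himg, ENNReal.rpow_natCast] at this
  simp only [euclideanHausdorffMeasure_def, Measure.smul_apply, ENNReal.smul_def, smul_eq_mul]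
  calc _ ≤ _ := mul_le_mul_right this _
    _ = _ := by ring

theorem continuous_gradient {F : Type*} [NormedAddCommGroup F] [InnerProductSpace ℝ F]
    [CompleteSpace F] {γ : F → ℝ} (hγ : ContDiff ℝ 1 γ) : Continuous (gradient γ) := by
  unfold gradient
  exact (LinearIsometryEquiv.continuous _).comp (hγ.continuous_fderiv one_ne_zero)

variable {E : Type*} [NormedAddCommGroup E] [InnerProductSpace ℝ E]

/-- The parametrization `k ↦ k + γ(k) e` of the graph of `γ` over the hyperplane orthogonal
to `e`. -/
noncomputable def graphMap (e : E) (γ : (ℝ ∙ e)ᗮ → ℝ) (k : (ℝ ∙ e)ᗮ) : E := (k : E) + γ k • e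

theorem norm_le_norm_coe_add_smul {e : E} (k : (ℝ ∙ e)ᗮ) (t : ℝ) : ‖k‖ ≤ ‖(k : E) + t • e‖ := by
  have h1 : inner ℝ (k : E) (t • e) = 0 := by
    rw [real_inner_smul_right, Submodule.inner_left_of_mem_orthogonal
      (Submodule.mem_span_singleton_self e) k.2, mul_zero]
  have h2 := norm_add_sq_eq_norm_sq_add_norm_sq_of_inner_eq_zero _ _ h1
  have h3 : ‖(k : E)‖ = ‖k‖ := rfl
  nlinarith [norm_nonneg (k : E), norm_nonneg ((k : E) + t • e), norm_nonneg (t • e)]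

theorem orthogonalProjectionOnto_coe_add_smul {e : E} (k : (ℝ ∙ e)ᗮ) (t : ℝ) :
    (ℝ ∙ e)ᗮ.orthogonalProjectionOnto ((k : E) + t • e) = k := by
  rw [map_add, map_smul, Submodule.orthogonalProjectionOnto_mem_subspace_eq_self,
    Submodule.orthogonalProjectionOnto_orthogonal_apply_eq_zero
      (Submodule.mem_span_singleton_self e)]
  simp

theorem inner_coe_add_smul {e : E} (he : ‖e‖ = 1) (k : (ℝ ∙ e)ᗮ) (t : ℝ) :
    inner ℝ e ((k : E) + t • e) = t := by
  rw [inner_add_right, Submodule.inner_right_of_mem_orthogonal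
    (Submodule.mem_span_singleton_self e) k.2, real_inner_smul_right,
    real_inner_self_eq_norm_sq, he]
  simp

theorem coe_orthogonalProjectionOnto_add_smul {e : E} (he : ‖e‖ = 1) (z : E) :
    ((ℝ ∙ e)ᗮ.orthogonalProjectionOnto z : E) + (inner ℝ e z : ℝ) • e = z := by
  have h := (ℝ ∙ e).starProjection_add_starProjection_orthogonal z
  rw [Submodule.starProjection_unit_singleton ℝ he z, Submodule.starProjection_apply, add_comm] at h
  exact h

/-- The linearization `k ↦ k + ℓ(k) e` of `graphMap e γ` at a point where `γ` has derivative
`ℓ`. -/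
noncomputable def graphLinear (e : E) (l : (ℝ ∙ e)ᗮ →ₗ[ℝ] ℝ) : (ℝ ∙ e)ᗮ →ₗ[ℝ] E :=
  (ℝ ∙ e)ᗮ.subtype + l.smulRight e

variable [FiniteDimensional ℝ E]

/-- The Gram matrix of the linearized graph map is the identity plus a matrix of rank one. -/
theorem normDet_graphLinear {e : E} (he : ‖e‖ = 1) (w : (ℝ ∙ e)ᗮ) :
    (graphLinear e (innerSL ℝ w : (ℝ ∙ e)ᗮ →ₗ[ℝ] ℝ)).normDet = √(1 + ‖w‖ ^ 2) := by
  symm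
  rw [Real.sqrt_eq_iff_mul_self_eq (by positivity) (LinearMap.normDet_nonneg _), ← sq]
  have h := (graphLinear e (innerSL ℝ w : (ℝ ∙ e)ᗮ →ₗ[ℝ] ℝ)).normDet_sq_eq_det_gram
    (stdOrthonormalBasis ℝ (ℝ ∙ e)ᗮ)
  simp only [RCLike.ofReal_real_eq_id, id] at h
  rw [h]
  set b := stdOrthonormalBasis ℝ (ℝ ∙ e)ᗮ with hb
  have hg : (Matrix.gram ℝ fun i => graphLinear e (innerSL ℝ w : (ℝ ∙ e)ᗮ →ₗ[ℝ] ℝ) (b i)) =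
      1 + Matrix.replicateCol Unit (fun i => inner ℝ w (b i)) *
        Matrix.replicateRow Unit (fun i => (inner ℝ w (b i) : ℝ)) := by
    ext i j
    have h1 : inner ℝ ((b i : E)) (b j : E) = (if i = j then 1 else 0 : ℝ) := by
      have := orthonormal_iff_ite.1 b.orthonormal i j
      exact this
    have h2 : ∀ k : (ℝ ∙ e)ᗮ, inner ℝ (k : E) e = 0 := fun k =>
      Submodule.inner_left_of_mem_orthogonal (Submodule.mem_span_singleton_self e) k.2
    have h3 : ∀ k : (ℝ ∙ e)ᗮ, inner ℝ e (k : E) = 0 := fun k =>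
      Submodule.inner_right_of_mem_orthogonal (Submodule.mem_span_singleton_self e) k.2
    simp [Matrix.gram_apply, graphLinear, inner_add_left, inner_add_right, real_inner_smul_left,
      real_inner_smul_right, h1, h2, h3, Matrix.one_apply, Matrix.mul_apply, he,
      mul_comm]
  rw [hg, Matrix.det_one_add_replicateCol_mul_replicateRow]
  congr 1
  simp only [dotProduct]
  rw [← b.sum_sq_inner_left w]
  exact Finset.sum_congr rfl fun i _ => by rw [sq, real_inner_comm]

variable [MeasurableSpace E] [BorelSpace E]

omit [FiniteDimensional ℝ E] in
theorem measurableEmbedding_graphMap {e : E} {γ : (ℝ ∙ e)ᗮ → ℝ} (hγ : Continuous γ) :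
    MeasurableEmbedding (graphMap e γ) := by
  have hc : Continuous (graphMap e γ) := by unfold graphMap; fun_prop
  refine IsClosedEmbedding.measurableEmbedding
    (.of_continuous_injective_isClosedMap hc ?_ ?_)
  · exact Function.LeftInverse.injective (g := (ℝ ∙ e)ᗮ.orthogonalProjectionOnto)
      fun k => orthogonalProjectionOnto_coe_add_smul k _
  · intro S hS
    have : graphMap e γ '' S = {z | (ℝ ∙ e)ᗮ.orthogonalProjectionOnto z ∈ S ∧
        graphMap e γ ((ℝ ∙ e)ᗮ.orthogonalProjectionOnto z) = z} := by
      ext z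
      constructor
      · rintro ⟨k, hk, rfl⟩
        simp only [graphMap, Set.mem_ofPred_eq, orthogonalProjectionOnto_coe_add_smul]
        exact ⟨hk, trivial⟩
      · rintro ⟨h1, h2⟩
        exact ⟨_, h1, h2⟩
    rw [this]
    exact (hS.preimage ((ℝ ∙ e)ᗮ.orthogonalProjectionOnto).continuous).inter
      (isClosed_eq (hc.comp ((ℝ ∙ e)ᗮ.orthogonalProjectionOnto).continuous) continuous_id)

/-- The area formula for the graph of a `C¹` function. Near each point the graph map is
bi-Lipschitz to its linearization with constants close to one, and for the linearization the
formula is a determinant computation. -/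
theorem comap_graphMap {e : E} (he : ‖e‖ = 1) {γ : (ℝ ∙ e)ᗮ → ℝ} (hγ : ContDiff ℝ 1 γ) :
    (euclideanHausdorffMeasure (finrank ℝ (ℝ ∙ e)ᗮ)).comap (graphMap e γ) =
      volume.withDensity fun k => ENNReal.ofReal √(1 + ‖gradient γ k‖ ^ 2) := by
  set d := finrank ℝ (ℝ ∙ e)ᗮ with hd
  have hemb := measurableEmbedding_graphMap (e := e) hγ.continuous
  set J : (ℝ ∙ e)ᗮ → ℝ := fun k => √(1 + ‖gradient γ k‖ ^ 2) with hJ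
  have hgc := continuous_gradient hγ
  have hJc : Continuous J := by
    simp only [hJ]; fun_prop
  have hJpos : ∀ k, 0 < J k := fun k => Real.sqrt_pos.2 (by positivity)
  -- comparison up to a factor `(1 + ε) ^ (d + 1)` on small sets
  have key : ∀ ε : NNReal, 0 < ε → ∀ x, ∃ U ∈ 𝓝 x, ∀ S ⊆ U, MeasurableSet S →
      (euclideanHausdorffMeasure d).comap (graphMap e γ) S ≤
        ((1 + ε : NNReal) ^ (d + 1) •
          volume.withDensity fun k => ENNReal.ofReal (J k)) S ∧
      volume.withDensity (fun k => ENNReal.ofReal (J k)) S ≤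
        ((1 + ε : NNReal) ^ (d + 1) •
          (euclideanHausdorffMeasure d).comap (graphMap e γ)) S := by
    intro ε hε x
    set w := gradient γ x with hw
    let L := graphLinear e (innerSL ℝ w : (ℝ ∙ e)ᗮ →ₗ[ℝ] ℝ)
    have hLJ : L.normDet = J x := normDet_graphLinear he w
    have hstrict : HasStrictFDerivAt γ (innerSL ℝ w) x := by
      have h1 := (hγ.contDiffAt (x := x)).hasStrictFDerivAt one_ne_zero
      have h2 : HasGradientAt γ w x := (hγ.differentiable one_ne_zero x).hasGradientAt
      rwa [h2.hasFDerivAt.fderiv] at h1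
    obtain ⟨U1, hU1, hU1'⟩ := hstrict.approximates_deriv_on_nhds (c := ε) (Or.inr hε)
    have hε1 : (1 : ℝ) < 1 + ε := by
      have : (0 : ℝ) < ε := hε
      linarith
    have hU2 : ∀ᶠ y in 𝓝 x, J y < (1 + ε) * J x ∧ J x < (1 + ε) * J y := by
      have h1 : J x < (1 + ε) * J x := by nlinarith [hJpos x]
      exact (hJc.continuousAt.eventually (gt_mem_nhds h1)).and
        ((hJc.const_mul _).continuousAt.eventually (lt_mem_nhds h1))
    refine ⟨U1 ∩ {y | J y < (1 + ε) * J x ∧ J x < (1 + ε) * J y}, inter_mem hU1 hU2, ?_⟩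
    intro S hS hSm
    have hdiff : ∀ a ∈ S, ∀ b ∈ S,
        ‖(graphMap e γ a - graphMap e γ b) - (L a - L b)‖ ≤ ε * ‖a - b‖ := by
      intro a ha b hb
      have h1 := hU1' a (hS ha).1 b (hS hb).1
      have h2 : (graphMap e γ a - graphMap e γ b) - (L a - L b) =
          (γ a - γ b - innerSL ℝ w (a - b)) • e := by
        simp only [graphMap, L, graphLinear, LinearMap.add_apply, Submodule.subtype_apply,
          LinearMap.smulRight_apply, ContinuousLinearMap.coe_coe, map_sub, sub_smul]
        abel
      rw [h2, norm_smul, he, mul_one]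
      exact h1
    have hnL : ∀ a b, ‖a - b‖ ≤ ‖L a - L b‖ := fun a b => by
      rw [← map_sub]
      exact norm_le_norm_coe_add_smul (a - b) _
    have hnG : ∀ a b, ‖a - b‖ ≤ ‖graphMap e γ a - graphMap e γ b‖ := fun a b => by
      have := norm_le_norm_coe_add_smul (a - b) (γ a - γ b)
      convert! this using 2
      simp only [graphMap, Submodule.coe_sub, sub_smul]
      abel
    have hεnn : (0 : ℝ) ≤ ε := ε.2
    have c1 := euclideanHausdorffMeasure_image_le_of_dist_le (f := graphMap e γ) (g := L) (S := S)
      (C := 1 + ε) d (by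
        intro a ha b hb
        rw [dist_eq_norm, dist_eq_norm]
        have h1 := hdiff a ha b hb
        have h2 := norm_le_insert (L a - L b) (graphMap e γ a - graphMap e γ b)
        have h3 := norm_sub_rev (graphMap e γ a - graphMap e γ b) (L a - L b)
        have h4 := mul_le_mul_of_nonneg_left (hnL a b) hεnn
        have h5 := norm_sub_norm_le (graphMap e γ a - graphMap e γ b) (L a - L b)
        push_cast
        linarith)
    have c2 := euclideanHausdorffMeasure_image_le_of_dist_le (f := L) (g := graphMap e γ) (S := S)
      (C := 1 + ε) d (by
        intro a ha b hb
        rw [dist_eq_norm, dist_eq_norm]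
        have h1 := hdiff a ha b hb
        have h3 := norm_sub_rev (graphMap e γ a - graphMap e γ b) (L a - L b)
        have h4 := mul_le_mul_of_nonneg_left (hnG a b) hεnn
        have h5 := norm_sub_norm_le (L a - L b) (graphMap e γ a - graphMap e γ b)
        push_cast
        linarith)
    rw [LinearMap.euclideanHausdorffMeasure_image_eq_normDet_mul_volume, hLJ] at c1 c2
    have i1 : volume.withDensity (fun k => ENNReal.ofReal (J k)) S ≤
        (1 + ε : NNReal) * (ENNReal.ofReal (J x) * volume S) := by
      rw [withDensity_apply _ hSm, ← mul_assoc, ← setLIntegral_const]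
      refine setLIntegral_mono measurable_const fun y hy => ?_
      rw [← ENNReal.ofReal_coe_nnreal, ← ENNReal.ofReal_mul (by positivity)]
      exact ENNReal.ofReal_le_ofReal (by push_cast; exact (hS hy).2.1.le)
    have i2 : ENNReal.ofReal (J x) * volume S ≤
        (1 + ε : NNReal) * volume.withDensity (fun k => ENNReal.ofReal (J k)) S := by
      rw [withDensity_apply _ hSm, ← setLIntegral_const, ← lintegral_const_mul _ (by fun_prop)]
      refine setLIntegral_mono (by fun_prop) fun y hy => ?_
      rw [← ENNReal.ofReal_coe_nnreal, ← ENNReal.ofReal_mul (by positivity)]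
      exact ENNReal.ofReal_le_ofReal (by push_cast; exact (hS hy).2.2.le)
    simp only [Measure.smul_apply, ENNReal.smul_def, smul_eq_mul, hemb.comap_apply,
      ENNReal.coe_pow]
    constructor
    · calc _ ≤ _ := c1
        _ ≤ _ := mul_le_mul_right i2 _
        _ = _ := by ring
    · calc _ ≤ _ := i1
        _ ≤ _ := mul_le_mul_right c2 _
        _ = _ := by ring
  -- letting `ε → 0`
  have lim : ∀ a b : ℝ≥0∞, (∀ ε : NNReal, 0 < ε → a ≤ ((1 + ε : NNReal) ^ (d + 1) : NNReal) * b) →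
      a ≤ b := by
    intro a b h
    have ht : Tendsto (fun ε : NNReal => (((1 + ε : NNReal) ^ (d + 1) : NNReal) : ℝ≥0∞) * b)
        (𝓝[>] 0) (𝓝 (1 * b)) := by
      refine ENNReal.Tendsto.mul_const ?_ (Or.inl one_ne_zero)
      have : Continuous fun ε : NNReal => (((1 + ε : NNReal) ^ (d + 1) : NNReal) : ℝ≥0∞) := by
        fun_prop
      have h2 := (this.tendsto 0).mono_left (nhdsWithin_le_nhds (s := Set.Ioi 0))
      simpa using h2
    rw [one_mul] at ht
    exact ge_of_tendsto ht (eventually_nhdsWithin_of_forall h)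
  refine le_antisymm ?_ ?_
  · refine Measure.le_iff.2 fun s hs => lim _ _ fun ε hε => ?_
    have := measure_le_of_locally_le (fun x => ?_) s
      (μ := (euclideanHausdorffMeasure d).comap (graphMap e γ))
      (ν := (1 + ε : NNReal) ^ (d + 1) • volume.withDensity fun k => ENNReal.ofReal (J k))
    · simpa [Measure.smul_apply, ENNReal.smul_def, hJ] using this
    · obtain ⟨U, hU, h⟩ := key ε hε x
      exact ⟨U, hU, fun S hS hm => (h S hS hm).1⟩
  · refine Measure.le_iff.2 fun s hs => lim _ _ fun ε hε => ?_
    have := measure_le_of_locally_le (fun x => ?_) s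
      (ν := (1 + ε : NNReal) ^ (d + 1) • (euclideanHausdorffMeasure d).comap (graphMap e γ))
      (μ := volume.withDensity fun k => ENNReal.ofReal (J k))
    · simpa [Measure.smul_apply, ENNReal.smul_def, hJ] using this
    · obtain ⟨U, hU, h⟩ := key ε hε x
      exact ⟨U, hU, fun S hS hm => (h S hS hm).2⟩

end AreaFormula

/-! ### The divergence theorem below a graph -/

section Subgraph

open Module Measure

theorem integral_fderiv_eq_zero {F : Type*} [NormedAddCommGroup F] [NormedSpace ℝ F]
    [FiniteDimensional ℝ F] [MeasurableSpace F] [BorelSpace F] (μ : Measure F) [μ.IsAddHaarMeasure]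
    {f : F → ℝ} (hf : ContDiff ℝ 1 f) (hfc : HasCompactSupport f) (v : F) :
    ∫ z, fderiv ℝ f z v ∂μ = 0 := by
  have h1 : Integrable (fun z => fderiv ℝ f z v) μ :=
    ((hf.continuous_fderiv one_ne_zero).clm_apply continuous_const).integrable_of_hasCompactSupport
      (hfc.fderiv_apply (𝕜 := ℝ) v)
  have h2 : Integrable f μ := hf.continuous.integrable_of_hasCompactSupport hfc
  have := integral_mul_fderiv_eq_neg_fderiv_mul_of_integrable (𝕜 := ℝ) (μ := μ)
    (f := fun _ : F => (1 : ℝ)) (g := f) (v := v) (by simp) (by simpa using h1)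
    (by simpa using h2) (by simp) (fun x _ => hf.differentiable one_ne_zero x)
  simpa using this

variable {E : Type*} [NormedAddCommGroup E] [InnerProductSpace ℝ E]

/-- The orthogonal decomposition of a vector into its component orthogonal to the unit vector `e`
and its coordinate along `e`. -/
noncomputable def hyperplaneEquiv {e : E} (he : ‖e‖ = 1) : WithLp 2 ((ℝ ∙ e)ᗮ × ℝ) ≃ₗᵢ[ℝ] E where
  toFun p := (p.fst : E) + p.snd • e
  invFun z := WithLp.toLp 2 ((ℝ ∙ e)ᗮ.orthogonalProjectionOnto z, inner ℝ e z)
  map_add' p q := by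
    simp only [WithLp.add_fst, WithLp.add_snd, Submodule.coe_add, add_smul]
    abel
  map_smul' c p := by
    simp [smul_add, mul_smul]
  left_inv p := by
    simp only [orthogonalProjectionOnto_coe_add_smul, inner_coe_add_smul he]
    rfl
  right_inv z := coe_orthogonalProjectionOnto_add_smul he z
  norm_map' p := by
    have h1 : inner ℝ (p.fst : E) (p.snd • e) = 0 := by
      rw [real_inner_smul_right, Submodule.inner_left_of_mem_orthogonal
        (Submodule.mem_span_singleton_self e) p.fst.2, mul_zero]
    have h2 := norm_add_sq_eq_norm_sq_add_norm_sq_of_inner_eq_zero _ _ h1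
    have h3 := WithLp.prod_norm_sq_eq_of_L2 p
    rw [norm_smul, he, mul_one, ← sq, ← sq, ← sq] at h2
    have h4 : ‖(p.fst : E)‖ = ‖p.fst‖ := rfl
    rw [h4, ← h3] at h2
    exact (sq_eq_sq₀ (norm_nonneg _) (norm_nonneg _)).1 h2

/-- The normal vector `e - ∇γ(k)` to the graph of `γ` at the point above `k`. -/
noncomputable def upwardNormal (e : E) [CompleteSpace E] (γ : (ℝ ∙ e)ᗮ → ℝ) (k : (ℝ ∙ e)ᗮ) : E :=
  e - ((gradient γ k : (ℝ ∙ e)ᗮ) : E)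

/-- The shear `(k, t) ↦ k + (γ(k) + t) e`, which flattens the graph of `γ`. -/
noncomputable def graphShear {e : E} (he : ‖e‖ = 1) {γ : (ℝ ∙ e)ᗮ → ℝ} (hγ : Continuous γ) :
    (ℝ ∙ e)ᗮ × ℝ ≃ₜ E where
  toFun p := (p.1 : E) + (γ p.1 + p.2) • e
  invFun z := ((ℝ ∙ e)ᗮ.orthogonalProjectionOnto z,
    inner ℝ e z - γ ((ℝ ∙ e)ᗮ.orthogonalProjectionOnto z))
  left_inv p := by
    simp only [orthogonalProjectionOnto_coe_add_smul, inner_coe_add_smul he]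
    ext <;> simp
  right_inv z := by
    simp only [add_sub_cancel]
    exact coe_orthogonalProjectionOnto_add_smul he z
  continuous_toFun := by fun_prop
  continuous_invFun := by fun_prop

variable [FiniteDimensional ℝ E] [MeasurableSpace E] [BorelSpace E]

omit [MeasurableSpace E] [BorelSpace E] in
theorem continuous_upwardNormal {e : E} {γ : (ℝ ∙ e)ᗮ → ℝ} (hγ : ContDiff ℝ 1 γ) :
    Continuous (upwardNormal e γ) := by
  have := continuous_gradient hγ
  unfold upwardNormal
  fun_prop

theorem measurePreserving_graphShear {e : E} (he : ‖e‖ = 1) {γ : (ℝ ∙ e)ᗮ → ℝ}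
    (hγ : Continuous γ) : MeasurePreserving (graphShear he hγ) := by
  have h1 : MeasurePreserving (fun p : (ℝ ∙ e)ᗮ × ℝ => (p.1, γ p.1 + p.2)) :=
    (MeasurePreserving.id volume).skew_product (g := fun k t => γ k + t)
      (by fun_prop) (Eventually.of_forall fun k => map_add_left_eq_self volume (γ k))
  have h2 := (WithLp.volume_preserving_toLp (ℝ ∙ e)ᗮ ℝ)
  exact ((hyperplaneEquiv he).measurePreserving.comp h2).comp h1

omit [MeasurableSpace E] [BorelSpace E] in
theorem fderiv_apply_graphShear {e : E} (he : ‖e‖ = 1) {γ : (ℝ ∙ e)ᗮ → ℝ}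
    (hγ : ContDiff ℝ 1 γ) {f : E → ℝ} (hf : Differentiable ℝ f) (v : E) (p : (ℝ ∙ e)ᗮ × ℝ) :
    fderiv ℝ f (graphShear he hγ.continuous p) v =
      fderiv ℝ (f ∘ graphShear he hγ.continuous) p ((ℝ ∙ e)ᗮ.orthogonalProjectionOnto v, 0) +
      inner ℝ (upwardNormal e γ p.1) v *
        fderiv ℝ (f ∘ graphShear he hγ.continuous) p (0, 1) := by
  have hg : HasFDerivAt γ (innerSL ℝ (gradient γ p.1)) p.1 :=
    (hγ.differentiable one_ne_zero p.1).hasGradientAt.hasFDerivAt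
  have hΦ : HasFDerivAt (graphShear he hγ.continuous)
      ((ℝ ∙ e)ᗮ.subtypeL.comp (ContinuousLinearMap.fst ℝ _ ℝ) +
        ((innerSL ℝ (gradient γ p.1)).comp (ContinuousLinearMap.fst ℝ _ ℝ) +
          ContinuousLinearMap.snd ℝ _ ℝ).smulRight e) p := by
    have h1 : HasFDerivAt (fun p : (ℝ ∙ e)ᗮ × ℝ => γ p.1)
      ((innerSL ℝ (gradient γ p.1)).comp (ContinuousLinearMap.fst ℝ _ ℝ)) p :=
      hg.comp p hasFDerivAt_fst
    exact ((ℝ ∙ e)ᗮ.subtypeL.hasFDerivAt.comp p hasFDerivAt_fst).add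
      ((h1.add hasFDerivAt_snd).smul_const e)
  rw [((hf _).hasFDerivAt.comp p hΦ).fderiv]
  set A := (ℝ ∙ e)ᗮ.subtypeL.comp (ContinuousLinearMap.fst ℝ _ ℝ) +
        ((innerSL ℝ (gradient γ p.1)).comp (ContinuousLinearMap.fst ℝ _ ℝ) +
          ContinuousLinearMap.snd ℝ _ ℝ).smulRight e with hA
  have hAv : ∀ q, A q = (q.1 : E) + (inner ℝ (gradient γ p.1) q.1 + q.2) • e := fun q => rfl
  simp only [ContinuousLinearMap.comp_apply]
  rw [← smul_eq_mul, ← map_smul, ← map_add]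
  congr 1
  have h2 : inner ℝ (gradient γ p.1) ((ℝ ∙ e)ᗮ.orthogonalProjectionOnto v) =
      inner ℝ ((gradient γ p.1 : (ℝ ∙ e)ᗮ) : E) v := by
    rw [Submodule.inner_orthogonalProjectionOnto_eq_of_mem_left]
  have h3 := coe_orthogonalProjectionOnto_add_smul he v
  rw [hAv, hAv, h2, upwardNormal, inner_sub_left]
  conv_lhs => rw [← h3]
  simp only [ZeroMemClass.coe_zero, inner_zero_right, zero_add, add_zero, sub_smul, one_smul]
  abel

/-- The divergence theorem for a compactly supported function on the region below the graph of a
`C¹` function: after the shear that flattens the graph it is the fundamental theorem of calculus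
in the vertical direction. -/
theorem integral_fderiv_subgraph {e : E} (he : ‖e‖ = 1) {γ : (ℝ ∙ e)ᗮ → ℝ} (hγ : ContDiff ℝ 1 γ)
    {f : E → ℝ} (hf : ContDiff ℝ 1 f) (hfc : HasCompactSupport f) (v : E) :
    ∫ z in {z | inner ℝ e z < γ ((ℝ ∙ e)ᗮ.orthogonalProjectionOnto z)}, fderiv ℝ f z v =
      ∫ k, f (graphMap e γ k) * inner ℝ (upwardNormal e γ k) v := by
  set Φ := graphShear he hγ.continuous with hΦ
  have hΦd : ContDiff ℝ 1 Φ := by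
    have : ContDiff ℝ 1 fun p : (ℝ ∙ e)ᗮ × ℝ => (p.1 : E) + (γ p.1 + p.2) • e :=
      ((ℝ ∙ e)ᗮ.subtypeL.contDiff.comp contDiff_fst).add
        (((hγ.comp contDiff_fst).add contDiff_snd).smul contDiff_const)
    exact this
  set g : (ℝ ∙ e)ᗮ × ℝ → ℝ := f ∘ Φ with hgdef
  have hg : ContDiff ℝ 1 g := hf.comp hΦd
  have hgc : HasCompactSupport g := hfc.comp_homeomorph Φ
  have hgrad : Continuous fun k => inner ℝ (upwardNormal e γ k) v := by
    have := continuous_upwardNormal hγ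
    fun_prop
  have hpre : Φ ⁻¹' {z | inner ℝ e z < γ ((ℝ ∙ e)ᗮ.orthogonalProjectionOnto z)} =
      Set.univ ×ˢ Set.Iio (0 : ℝ) := by
    ext p
    have h1 : Φ p = (p.1 : E) + (γ p.1 + p.2) • e := rfl
    simp [h1, orthogonalProjectionOnto_coe_add_smul, inner_coe_add_smul he]
  have hmp : MeasurePreserving Φ := measurePreserving_graphShear he hγ.continuous
  rw [← hmp.setIntegral_preimage_emb Φ.measurableEmbedding, hpre]
  have hvol : (volume : Measure ((ℝ ∙ e)ᗮ × ℝ)).restrict (Set.univ ×ˢ Set.Iio (0 : ℝ)) =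
      (volume : Measure (ℝ ∙ e)ᗮ).prod (volume.restrict (Set.Iio (0 : ℝ))) := by
    rw [volume_eq_prod, ← Measure.prod_restrict, Measure.restrict_univ]
  have hsplit : ∀ p, fderiv ℝ f (Φ p) v =
      fderiv ℝ g p ((ℝ ∙ e)ᗮ.orthogonalProjectionOnto v, 0) +
        inner ℝ (upwardNormal e γ p.1) v * fderiv ℝ g p (0, 1) :=
    fderiv_apply_graphShear he hγ (hf.differentiable one_ne_zero) v
  simp only [hsplit]
  have hint : ∀ w, Integrable (fun p => fderiv ℝ g p w) := fun w =>
    ((hg.continuous_fderiv one_ne_zero).clm_apply continuous_const).integrable_of_hasCompactSupport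
      (hgc.fderiv_apply (𝕜 := ℝ) w)
  have hint2 : Integrable (fun p : (ℝ ∙ e)ᗮ × ℝ => inner ℝ (upwardNormal e γ p.1) v *
      fderiv ℝ g p (0, 1)) :=
    ((hgrad.comp continuous_fst).mul ((hg.continuous_fderiv one_ne_zero).clm_apply
      continuous_const)).integrable_of_hasCompactSupport
      ((hgc.fderiv_apply (𝕜 := ℝ) (0, 1)).mul_left)
  rw [integral_add (hint _).restrict hint2.restrict, hvol]
  have hi1 := (hint ((ℝ ∙ e)ᗮ.orthogonalProjectionOnto v, 0)).restrict
    (s := Set.univ ×ˢ Set.Iio (0 : ℝ))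
  have hi2 := hint2.restrict (s := Set.univ ×ˢ Set.Iio (0 : ℝ))
  rw [hvol] at hi1 hi2
  rw [integral_prod_symm _ hi1, integral_prod _ hi2]
  -- derivatives along the hyperplane integrate to zero on each slice
  have z1 : ∀ t : ℝ, ∫ k, fderiv ℝ g (k, t) ((ℝ ∙ e)ᗮ.orthogonalProjectionOnto v, 0) = 0 := by
    intro t
    have hemb : IsClosedEmbedding fun k : (ℝ ∙ e)ᗮ => (k, t) :=
      .of_continuous_injective_isClosedMap (by fun_prop) (Prod.mk_left_injective t)
        (isClosedMap_prodMk_right t)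
    have h1 : ContDiff ℝ 1 fun k => g (k, t) := hg.comp (contDiff_id.prodMk contDiff_const)
    have h2 : HasCompactSupport fun k => g (k, t) := hgc.comp_isClosedEmbedding hemb
    refine Eq.trans ?_ (integral_fderiv_eq_zero volume h1 h2 ((ℝ ∙ e)ᗮ.orthogonalProjectionOnto v))
    refine integral_congr_ae (Eventually.of_forall fun k => ?_)
    have h3 : HasFDerivAt (fun k : (ℝ ∙ e)ᗮ => (k, t)) (ContinuousLinearMap.inl ℝ _ ℝ) k :=
      hasFDerivAt_prodMk_left k t
    have h4 := ((hg.differentiable one_ne_zero (k, t)).hasFDerivAt.comp k h3).fderiv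
    have h5 : g ∘ (fun k : (ℝ ∙ e)ᗮ => (k, t)) = fun k => g (k, t) := rfl
    rw [h5] at h4
    simp only [h4, ContinuousLinearMap.comp_apply, ContinuousLinearMap.inl_apply]
  simp only [z1, integral_zero, zero_add]
  refine integral_congr_ae (Eventually.of_forall fun k => ?_)
  have hemb : IsClosedEmbedding fun t : ℝ => (k, t) :=
    .of_continuous_injective_isClosedMap (by fun_prop) (Prod.mk_right_injective k)
      (isClosedMap_prodMk_left k)
  have h1 : ContDiff ℝ 1 fun t => g (k, t) := hg.comp (contDiff_const.prodMk contDiff_id)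
  have h2 : HasCompactSupport fun t => g (k, t) := hgc.comp_isClosedEmbedding hemb
  have h3 : ∀ t, fderiv ℝ g (k, t) (0, 1) = deriv (fun t => g (k, t)) t := by
    intro t
    have h3 : HasFDerivAt (fun t : ℝ => (k, t)) (ContinuousLinearMap.inr ℝ _ ℝ) t :=
      hasFDerivAt_prodMk_right k t
    have h4 := ((hg.differentiable one_ne_zero (k, t)).hasFDerivAt.comp t h3).hasDerivAt.deriv
    have h5 : g ∘ (fun t : ℝ => (k, t)) = fun t => g (k, t) := rfl
    rw [h5] at h4
    simp [h4]
  have h6 : g (k, 0) = f (graphMap e γ k) := by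
    simp only [hgdef, Function.comp]
    congr 1
    change (k : E) + (γ k + 0) • e = _
    rw [add_zero, graphMap]
  simp only [h3]
  rw [integral_const_mul, ← integral_Iic_eq_integral_Iio, h2.integral_Iic_deriv_eq h1, h6, mul_comm]

end Subgraph

/-! ### Boundary charts, surface measure and the divergence theorem on a `C¹` domain -/

section Partition

open scoped Manifold

/-- A finite smooth partition of unity on a compact set, subordinate to prescribed balls. -/
theorem exists_smooth_partition {E : Type*} [NormedAddCommGroup E] [NormedSpace ℝ E]
    [FiniteDimensional ℝ E] {K : Set E} (hK : IsCompact K) {r : E → ℝ} (hr : ∀ p ∈ K, 0 < r p) :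
    ∃ (t : Finset E) (χ : E → E → ℝ), (∀ p ∈ t, p ∈ K) ∧ (∀ p ∈ t, ContDiff ℝ ∞ (χ p) ∧
      HasCompactSupport (χ p) ∧ tsupport (χ p) ⊆ Metric.ball p (r p) ∧ ∀ z, 0 ≤ χ p z) ∧
      ∀ z ∈ K, ∑ p ∈ t, χ p z = 1 := by
  classical
  obtain ⟨t, htK, hcov⟩ := hK.elim_nhds_subcover (fun p => Metric.ball p (r p))
    fun p hp => Metric.ball_mem_nhds p (hr p hp)
  obtain ⟨f, hf⟩ := SmoothPartitionOfUnity.exists_isSubordinate 𝓘(ℝ, E) hK.isClosed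
    (fun p : t => Metric.ball (p : E) (r p)) (fun _ => Metric.isOpen_ball) (by
      intro z hz
      obtain ⟨p, hp, hzp⟩ := Set.mem_iUnion₂.1 (hcov hz)
      exact Set.mem_iUnion.2 ⟨⟨p, hp⟩, hzp⟩)
  refine ⟨t, fun p z => if hp : p ∈ t then f ⟨p, hp⟩ z else 0, htK, fun p hp => ?_, fun z hz => ?_⟩
  · simp only [hp, dif_pos]
    refine ⟨(f ⟨p, hp⟩).contMDiff.contDiff, ?_, hf ⟨p, hp⟩, fun z => f.nonneg _ _⟩
    exact HasCompactSupport.of_support_subset_isCompact (isCompact_closedBall p (r p))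
      ((subset_tsupport _).trans ((hf ⟨p, hp⟩).trans Metric.ball_subset_closedBall))
  · rw [← f.sum_eq_one hz, finsum_eq_sum_of_fintype, ← Finset.sum_coe_sort]
    exact Finset.sum_congr rfl fun p _ => by simp

end Partition

section Charts

variable {ι : Type*} [Fintype ι] {Ω : Set (EuclideanSpace ℝ ι)} {p e : EuclideanSpace ℝ ι}
  {γ : (ℝ ∙ e)ᗮ → ℝ} {r : ℝ}

theorem IsC1Chart.of_mem_ball (hc : IsC1Chart Ω p e γ r) {q : EuclideanSpace ℝ ι}
    (hq : q ∈ Metric.ball p r) : IsC1Chart Ω q e γ (r - dist q p) :=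
  ⟨hc.1, hc.2.1, sub_pos.2 hq, fun z hz => hc.2.2.2 z (by
    have h1 := dist_triangle z q p
    have h2 : dist z q < r - dist q p := hz
    exact Metric.mem_ball.2 (by linarith))⟩

theorem IsC1Chart.inner_eq (hc : IsC1Chart Ω p e γ r) (hΩ : IsOpen Ω) (hp : p ∈ frontier Ω) :
    inner ℝ e p = γ ((ℝ ∙ e)ᗮ.orthogonalProjectionOnto p) := by
  obtain ⟨he, hγ, hr, hb⟩ := hc
  have hcont : Continuous fun z => inner ℝ e z - γ ((ℝ ∙ e)ᗮ.orthogonalProjectionOnto z) := by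
    have := hγ.continuous
    fun_prop
  have hpb := Metric.mem_ball_self (x := p) hr
  apply le_antisymm
  · by_contra! hlt
    have h1 : ∀ᶠ z in 𝓝 p, z ∉ Ω := by
      filter_upwards [hcont.continuousAt.eventually (lt_mem_nhds (sub_pos.2 hlt)),
        Metric.ball_mem_nhds p hr] with z hz hz' hzΩ
      have := (hb z hz').1 hzΩ
      linarith
    exact mem_closure_iff_frequently.1 (frontier_subset_closure hp) h1
  · by_contra! hlt
    rw [hΩ.frontier_eq] at hp
    exact hp.2 ((hb p hpb).2 hlt)

theorem norm_upwardNormal (he : ‖e‖ = 1) (k : (ℝ ∙ e)ᗮ) :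
    ‖upwardNormal e γ k‖ = √(1 + ‖gradient γ k‖ ^ 2) := by
  symm
  rw [Real.sqrt_eq_iff_mul_self_eq (by positivity) (norm_nonneg _), upwardNormal, ← sq,
    norm_sub_sq_real, he, Submodule.inner_right_of_mem_orthogonal
      (Submodule.mem_span_singleton_self e) (Subtype.property _)]
  simp

theorem inner_upwardNormal_left (he : ‖e‖ = 1) (k : (ℝ ∙ e)ᗮ) :
    inner ℝ (upwardNormal e γ k) e = 1 := by
  rw [upwardNormal, inner_sub_left, real_inner_self_eq_norm_sq, he,
    Submodule.inner_left_of_mem_orthogonal (Submodule.mem_span_singleton_self e)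
      (Subtype.property _)]
  norm_num

theorem norm_upwardNormal_pos (he : ‖e‖ = 1) (k : (ℝ ∙ e)ᗮ) : 0 < ‖upwardNormal e γ k‖ := by
  rw [norm_upwardNormal he]
  positivity

/-- Inside a chart ball the boundary is the graph. -/
theorem IsC1Chart.mem_frontier_iff (hc : IsC1Chart Ω p e γ r) (hΩ : IsOpen Ω)
    {z : EuclideanSpace ℝ ι} (hz : z ∈ Metric.ball p r) :
    z ∈ frontier Ω ↔ inner ℝ e z = γ ((ℝ ∙ e)ᗮ.orthogonalProjectionOnto z) := by
  refine ⟨fun h => (hc.of_mem_ball hz).inner_eq hΩ h, fun h => ?_⟩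
  rw [hΩ.frontier_eq]
  refine ⟨?_, fun h' => ((hc.2.2.2 z hz).1 h').ne h⟩
  -- the points `z - t e` with small `t > 0` lie in `Ω`
  have hline : Tendsto (fun t : ℝ => z + (-t) • e) (𝓝[>] 0) (𝓝 z) := by
    have : Continuous fun t : ℝ => z + (-t) • e := by fun_prop
    have h2 := (this.tendsto 0).mono_left (nhdsWithin_le_nhds (s := Set.Ioi 0))
    simpa using h2
  refine mem_closure_of_tendsto hline ?_
  filter_upwards [hline.eventually (Metric.isOpen_ball.mem_nhds hz), self_mem_nhdsWithin]
    with t ht ht0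
  rw [hc.2.2.2 _ ht, map_add, map_smul,
    Submodule.orthogonalProjectionOnto_orthogonal_apply_eq_zero
      (Submodule.mem_span_singleton_self e), smul_zero, add_zero, ← h, inner_add_right,
    real_inner_smul_right, real_inner_self_eq_norm_sq, hc.1]
  have : (0 : ℝ) < t := ht0
  linarith

theorem IsC1Chart.outerNormal_eq (hc : IsC1Chart Ω p e γ r) (hΩ : IsOpen Ω)
    {z : EuclideanSpace ℝ ι} (hz : z ∈ Metric.ball p r) (hzf : z ∈ frontier Ω) :
    outerNormal Ω z = ‖upwardNormal e γ ((ℝ ∙ e)ᗮ.orthogonalProjectionOnto z)‖⁻¹ •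
      upwardNormal e γ ((ℝ ∙ e)ᗮ.orthogonalProjectionOnto z) := by
  have h : IsOuterUnitNormal Ω z (‖graphNormal z e γ‖⁻¹ • graphNormal z e γ) :=
    ⟨e, γ, _, hc.of_mem_ball hz, rfl⟩
  have h2 : ∃ ν, IsOuterUnitNormal Ω z ν := ⟨_, h⟩
  rw [outerNormal, dif_pos h2]
  exact h2.choose_spec.unique hΩ hzf h

theorem norm_outerNormal (hΩ : IsOpen Ω) (hC : IsOfClassC1 Ω) {z : EuclideanSpace ℝ ι}
    (hz : z ∈ frontier Ω) : ‖outerNormal Ω z‖ = 1 := by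
  obtain ⟨e, γ, r, hc⟩ := hC z hz
  rw [hc.outerNormal_eq hΩ (Metric.mem_ball_self hc.2.2.1) hz, norm_smul, norm_inv, norm_norm,
    inv_mul_cancel₀ (norm_upwardNormal_pos hc.1 _).ne']

theorem continuousOn_outerNormal (hΩ : IsOpen Ω) (hC : IsOfClassC1 Ω) :
    ContinuousOn (outerNormal Ω) (frontier Ω) := by
  intro p hp
  obtain ⟨e, γ, r, hc⟩ := hC p hp
  have h1 : Continuous fun z => ‖upwardNormal e γ ((ℝ ∙ e)ᗮ.orthogonalProjectionOnto z)‖⁻¹ •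
      upwardNormal e γ ((ℝ ∙ e)ᗮ.orthogonalProjectionOnto z) := by
    have h2 := (continuous_upwardNormal hc.2.1).comp
      ((ℝ ∙ e)ᗮ.orthogonalProjectionOnto).continuous
    exact (h2.norm.inv₀ fun z => (norm_upwardNormal_pos hc.1 _).ne').smul h2
  refine h1.continuousWithinAt.congr_of_eventuallyEq ?_
    (hc.outerNormal_eq hΩ (Metric.mem_ball_self hc.2.2.1) hp)
  filter_upwards [self_mem_nhdsWithin,
    mem_nhdsWithin_of_mem_nhds (Metric.ball_mem_nhds p hc.2.2.1)] with z hz hzb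
  exact hc.outerNormal_eq hΩ hzb hz

theorem finrank_orthogonal_span_singleton_of_norm_eq_one (he : ‖e‖ = 1) :
    Module.finrank ℝ (ℝ ∙ e)ᗮ = Fintype.card ι - 1 := by
  have h1 := (ℝ ∙ e).finrank_add_finrank_orthogonal
  rw [finrank_span_singleton (norm_pos_iff.1 (by rw [he]; exact one_pos)),
    finrank_euclideanSpace] at h1
  omega

/-- The surface measure near a boundary point, in terms of the parametrization by the tangent
hyperplane. -/
theorem IsC1Chart.restrict_range_graphMap (hc : IsC1Chart Ω p e γ r) :
    (Measure.euclideanHausdorffMeasure (Fintype.card ι - 1)).restrict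
      (Set.range (graphMap e γ)) =
      (volume.withDensity fun k => ENNReal.ofReal ‖upwardNormal e γ k‖).map (graphMap e γ) := by
  simp_rw [norm_upwardNormal hc.1]
  rw [← comap_graphMap hc.1 hc.2.1, finrank_orthogonal_span_singleton_of_norm_eq_one hc.1,
    (measurableEmbedding_graphMap hc.2.1.continuous).map_comap]

theorem IsC1Chart.ball_inter_frontier (hc : IsC1Chart Ω p e γ r) (hΩ : IsOpen Ω) :
    Metric.ball p r ∩ frontier Ω = Metric.ball p r ∩ Set.range (graphMap e γ) := by
  ext z
  refine and_congr_right fun hz => ?_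
  rw [hc.mem_frontier_iff hΩ hz]
  constructor
  · intro h
    refine ⟨(ℝ ∙ e)ᗮ.orthogonalProjectionOnto z, ?_⟩
    rw [graphMap, ← h, coe_orthogonalProjectionOnto_add_smul hc.1]
  · rintro ⟨k, rfl⟩
    rw [graphMap, inner_coe_add_smul hc.1, orthogonalProjectionOnto_coe_add_smul]

theorem surfaceMeasure_lt_top (hΩ : IsOpen Ω) (hΩb : Bornology.IsBounded Ω)
    (hC : IsOfClassC1 Ω) : IsFiniteMeasure (surfaceMeasure Ω) := by
  have hK : IsCompact (frontier Ω) :=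
    hΩb.isCompact_closure.of_isClosed_subset isClosed_frontier frontier_subset_closure
  refine ⟨?_⟩
  have h1 : surfaceMeasure Ω Set.univ = surfaceMeasure Ω (frontier Ω) := by
    simp [surfaceMeasure]
  rw [h1]
  refine hK.measure_lt_top_of_nhdsWithin fun p hp => ?_
  obtain ⟨e, γ, r, hc⟩ := hC p hp
  refine ⟨Metric.ball p r, mem_nhdsWithin_of_mem_nhds (Metric.ball_mem_nhds p hc.2.2.1), ?_⟩
  rw [surfaceMeasure, Measure.restrict_apply Metric.isOpen_ball.measurableSet,
    hc.ball_inter_frontier hΩ, ← Measure.restrict_apply Metric.isOpen_ball.measurableSet,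
    hc.restrict_range_graphMap, (measurableEmbedding_graphMap hc.2.1.continuous).map_apply]
  set P := (ℝ ∙ e)ᗮ.orthogonalProjectionOnto
  have hsub : graphMap e γ ⁻¹' Metric.ball p r ⊆ Metric.closedBall (P p) r := by
    intro k hk
    have h2 : P (graphMap e γ k) = k := orthogonalProjectionOnto_coe_add_smul k _
    have h3 : ‖P (graphMap e γ k - p)‖ ≤ ‖graphMap e γ k - p‖ :=
      (ℝ ∙ e)ᗮ.norm_orthogonalProjectionOnto_apply_le _
    have h4 : ‖graphMap e γ k - p‖ < r := mem_ball_iff_norm.1 hk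
    rw [map_sub, h2] at h3
    exact mem_closedBall_iff_norm.2 (h3.trans h4.le)
  refine (measure_mono hsub).trans_lt ?_
  rw [withDensity_apply _ Metric.isClosed_closedBall.measurableSet]
  have hcont : ContinuousOn (fun k => ‖upwardNormal e γ k‖) (Metric.closedBall (P p) r) :=
    (continuous_upwardNormal hc.2.1).norm.continuousOn
  have := (hcont.integrableOn_compact (μ := volume) (isCompact_closedBall _ _)).lintegral_lt_top
  exact this

theorem aestronglyMeasurable_outerNormal (hΩ : IsOpen Ω) (hC : IsOfClassC1 Ω) :
    AEStronglyMeasurable (outerNormal Ω) (surfaceMeasure Ω) :=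
  (continuousOn_outerNormal hΩ hC).aestronglyMeasurable isClosed_frontier.measurableSet

theorem IsC1Chart.integral_fderiv (hc : IsC1Chart Ω p e γ r) (hΩ : IsOpen Ω)
    {f : EuclideanSpace ℝ ι → ℝ} (hf : ContDiff ℝ 1 f) (hfc : HasCompactSupport f)
    (hfs : tsupport f ⊆ Metric.ball p r) (v : EuclideanSpace ℝ ι) :
    ∫ z in Ω, fderiv ℝ f z v = ∫ z, f z * inner ℝ (outerNormal Ω z) v ∂(surfaceMeasure Ω) := by
  set S := {z | inner ℝ e z < γ ((ℝ ∙ e)ᗮ.orthogonalProjectionOnto z)} with hS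
  have hSm : MeasurableSet S := by
    have := hc.2.1.continuous
    exact (isOpen_lt (by fun_prop) (by fun_prop)).measurableSet
  have hΓ := measurableEmbedding_graphMap (e := e) hc.2.1.continuous
  have h1 : ∫ z in Ω, fderiv ℝ f z v = ∫ z in S, fderiv ℝ f z v := by
    rw [← integral_indicator hΩ.measurableSet, ← integral_indicator hSm]
    congr 1
    ext z
    by_cases hz : z ∈ Metric.ball p r
    · have : z ∈ Ω ↔ z ∈ S := hc.2.2.2 z hz
      by_cases h : z ∈ S <;> simp [Set.indicator, this, h]
    · have h0 : fderiv ℝ f z = 0 := by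
        refine image_eq_zero_of_notMem_tsupport fun h => hz (hfs ?_)
        exact tsupport_fderiv_subset ℝ h
      simp [Set.indicator, h0]
  rw [h1, integral_fderiv_subgraph hc.1 hc.2.1 hf hfc v]
  let F : EuclideanSpace ℝ ι → ℝ := fun z => f z *
    inner ℝ (‖upwardNormal e γ ((ℝ ∙ e)ᗮ.orthogonalProjectionOnto z)‖⁻¹ •
      upwardNormal e γ ((ℝ ∙ e)ᗮ.orthogonalProjectionOnto z)) v
  have h2 : ∫ z, f z * inner ℝ (outerNormal Ω z) v ∂(surfaceMeasure Ω) =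
      ∫ z in Set.range (graphMap e γ), F z
        ∂(Measure.euclideanHausdorffMeasure (Fintype.card ι - 1)) := by
    rw [surfaceMeasure, ← integral_indicator isClosed_frontier.measurableSet,
      ← integral_indicator hΓ.measurableSet_range]
    congr 1
    ext z
    by_cases hz : z ∈ Metric.ball p r
    · have hiff : z ∈ frontier Ω ↔ z ∈ Set.range (graphMap e γ) := by
        have := Set.ext_iff.1 (hc.ball_inter_frontier hΩ) z
        simpa only [Set.mem_inter_iff, hz, true_and] using this
      by_cases h : z ∈ frontier Ω
      · rw [Set.indicator_of_mem h, Set.indicator_of_mem (hiff.1 h), hc.outerNormal_eq hΩ hz h]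
      · rw [Set.indicator_of_notMem h, Set.indicator_of_notMem (fun h' => h (hiff.2 h'))]
    · have h0 : f z = 0 := image_eq_zero_of_notMem_tsupport fun h => hz (hfs h)
      simp [Set.indicator, h0, F]
  rw [h2, hc.restrict_range_graphMap, hΓ.integral_map,
    integral_withDensity_eq_integral_toReal_smul
      (continuous_upwardNormal hc.2.1).norm.measurable.ennreal_ofReal (by simp)]
  refine integral_congr_ae (Eventually.of_forall fun k => ?_)
  have h3 : (ℝ ∙ e)ᗮ.orthogonalProjectionOnto (graphMap e γ k) = k :=
    orthogonalProjectionOnto_coe_add_smul k _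
  have h4 := norm_upwardNormal_pos (γ := γ) hc.1 k
  simp only [F, h3, real_inner_smul_left, smul_eq_mul, ENNReal.toReal_ofReal (norm_nonneg _)]
  field_simp

/-- The divergence theorem on a bounded open set of class `C¹`. -/
theorem integral_fderiv_eq_boundary (hΩ : IsOpen Ω) (hΩb : Bornology.IsBounded Ω)
    (hC : IsOfClassC1 Ω) {f : EuclideanSpace ℝ ι → ℝ} (hf : ContDiff ℝ 1 f)
    (v : EuclideanSpace ℝ ι) :
    ∫ z in Ω, fderiv ℝ f z v = ∫ z, f z * inner ℝ (outerNormal Ω z) v ∂(surfaceMeasure Ω) := by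
  have hfin := surfaceMeasure_lt_top hΩ hΩb hC
  -- localization: the identity holds for functions supported in a small ball about any point
  have hloc : ∀ p ∈ closure Ω, ∃ r > 0, ∀ f : EuclideanSpace ℝ ι → ℝ, ContDiff ℝ 1 f →
      HasCompactSupport f → tsupport f ⊆ Metric.ball p r →
      ∫ z in Ω, fderiv ℝ f z v =
        ∫ z, f z * inner ℝ (outerNormal Ω z) v ∂(surfaceMeasure Ω) := by
    intro p hp
    by_cases hpΩ : p ∈ Ω
    · obtain ⟨r, hr, hball⟩ := Metric.isOpen_iff.1 hΩ p hpΩ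
      refine ⟨r, hr, fun f hf hfc hfs => ?_⟩
      have h1 : ∫ z in Ω, fderiv ℝ f z v = 0 := by
        rw [setIntegral_eq_integral_of_forall_compl_eq_zero,
          integral_fderiv_eq_zero volume hf hfc v]
        intro z hz
        have : fderiv ℝ f z = 0 := image_eq_zero_of_notMem_tsupport fun h =>
          hz (hball (hfs (tsupport_fderiv_subset ℝ h)))
        simp [this]
      rw [h1, surfaceMeasure]
      refine (setIntegral_eq_zero_of_forall_eq_zero fun z hz => ?_).symm
      have : f z = 0 := image_eq_zero_of_notMem_tsupport fun h => by
        rw [hΩ.frontier_eq] at hz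
        exact hz.2 (hball (hfs h))
      simp [this]
    · obtain ⟨e, γ, r, hc⟩ := hC p (by rw [hΩ.frontier_eq]; exact ⟨hp, hpΩ⟩)
      exact ⟨r, hc.2.2.1, fun f hf hfc hfs => hc.integral_fderiv hΩ hf hfc hfs v⟩
  choose! r hr hloc using hloc
  obtain ⟨t, χ, htK, hχ, hsum⟩ := exists_smooth_partition hΩb.isCompact_closure hr
  have hcf : ∀ p ∈ t, ContDiff ℝ 1 fun z => χ p z * f z := fun p hp =>
    ((hχ p hp).1.of_le (by exact_mod_cast le_top)).mul hf
  have hcs : ∀ p ∈ t, HasCompactSupport fun z => χ p z * f z := fun p hp =>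
    (hχ p hp).2.1.mul_right
  have hL : ∫ z in Ω, fderiv ℝ f z v =
      ∑ p ∈ t, ∫ z in Ω, fderiv ℝ (fun z => χ p z * f z) z v := by
    rw [← integral_finsetSum]
    · refine setIntegral_congr_fun hΩ.measurableSet fun z hz => ?_
      have h1 : f =ᶠ[𝓝 z] fun z => ∑ p ∈ t, χ p z * f z := by
        filter_upwards [hΩ.mem_nhds hz] with y hy
        rw [← Finset.sum_mul, hsum y (subset_closure hy), one_mul]
      simp only [h1.fderiv_eq]
      rw [fderiv_fun_sum fun p hp => (hcf p hp).differentiable one_ne_zero z]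
      simp
    · intro p hp
      exact ((((hcf p hp).continuous_fderiv one_ne_zero).clm_apply
        continuous_const).integrable_of_hasCompactSupport
        ((hcs p hp).fderiv_apply (𝕜 := ℝ) v)).integrableOn
  have hn : AEStronglyMeasurable (fun z => inner ℝ (outerNormal Ω z) v) (surfaceMeasure Ω) :=
    (aestronglyMeasurable_outerNormal hΩ hC).inner aestronglyMeasurable_const
  have hR : ∫ z, f z * inner ℝ (outerNormal Ω z) v ∂(surfaceMeasure Ω) =
      ∑ p ∈ t, ∫ z, (χ p z * f z) * inner ℝ (outerNormal Ω z) v ∂(surfaceMeasure Ω) := by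
    rw [← integral_finsetSum]
    · refine setIntegral_congr_fun isClosed_frontier.measurableSet fun z hz => ?_
      rw [← Finset.sum_mul, ← Finset.sum_mul, hsum z (frontier_subset_closure hz), one_mul]
    · intro p hp
      have hint : Integrable (fun z => χ p z * f z) (surfaceMeasure Ω) :=
        (hcf p hp).continuous.integrable_of_hasCompactSupport (hcs p hp)
      refine hint.mul_bdd (c := ‖v‖) hn ?_
      refine (ae_restrict_iff' isClosed_frontier.measurableSet).2
        (Eventually.of_forall fun z hz => ?_)
      refine (norm_inner_le_norm _ _).trans ?_
      rw [norm_outerNormal hΩ hC hz, one_mul]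
  rw [hL, hR]
  refine Finset.sum_congr rfl fun p hp => hloc p (htK p hp) _ (hcf p hp) (hcs p hp) ?_
  exact (tsupport_mul_subset_left).trans (hχ p hp).2.2.1

end Charts

/-! ### Convergence in `L²` and mollification -/

section L2

variable {α : Type*} [MeasurableSpace α] {μ : Measure α}

theorem tendsto_eLpNorm_of_sub_tendsto_zero {f : ℕ → α → ℝ} {F : α → ℝ}
    (hf : ∀ n, MemLp (f n) 2 μ) (hF : MemLp F 2 μ) :
    Tendsto (fun n => eLpNorm (f n - F) 2 μ) atTop (𝓝 0) ↔
      Tendsto (fun n => (hf n).toLp (f n)) atTop (𝓝 (hF.toLp F)) := by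
  have : Fact ((1 : ℝ≥0∞) ≤ 2) := ⟨by norm_num⟩
  exact (Lp.tendsto_Lp_iff_tendsto_eLpNorm'' f hf F hF).symm

theorem inner_toLp {a b : α → ℝ} (ha : MemLp a 2 μ) (hb : MemLp b 2 μ) :
    inner ℝ (ha.toLp a) (hb.toLp b) = ∫ z, a z * b z ∂μ := by
  rw [L2.inner_def]
  refine integral_congr_ae ?_
  filter_upwards [ha.coeFn_toLp, hb.coeFn_toLp] with z h1 h2
  rw [h1, h2]
  simp [mul_comm]

theorem dist_toLp_sq {a b : α → ℝ} (ha : MemLp a 2 μ) (hb : MemLp b 2 μ) :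
    dist (ha.toLp a) (hb.toLp b) ^ 2 = ∫ z, (a z - b z) ^ 2 ∂μ := by
  rw [dist_eq_norm, ← MemLp.toLp_sub, ← real_inner_self_eq_norm_sq, inner_toLp]
  simp [sq]

theorem tendsto_integral_mul_of_tendsto_eLpNorm {f g : ℕ → α → ℝ} {F G : α → ℝ}
    (hf : ∀ n, MemLp (f n) 2 μ) (hF : MemLp F 2 μ) (hg : ∀ n, MemLp (g n) 2 μ) (hG : MemLp G 2 μ)
    (hfF : Tendsto (fun n => eLpNorm (f n - F) 2 μ) atTop (𝓝 0))
    (hgG : Tendsto (fun n => eLpNorm (g n - G) 2 μ) atTop (𝓝 0)) :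
    Tendsto (fun n => ∫ z, f n z * g n z ∂μ) atTop (𝓝 (∫ z, F z * G z ∂μ)) := by
  rw [tendsto_eLpNorm_of_sub_tendsto_zero hf hF] at hfF
  rw [tendsto_eLpNorm_of_sub_tendsto_zero hg hG] at hgG
  simpa only [inner_toLp] using hfF.inner (𝕜 := ℝ) hgG

theorem memLp_bdd_mul {a f : α → ℝ} {C : ℝ} (ha : AEStronglyMeasurable a μ)
    (hC : ∀ᵐ z ∂μ, ‖a z‖ ≤ C) (hf : MemLp f 2 μ) : MemLp (fun z => a z * f z) 2 μ :=
  MemLp.of_le_mul (c := C) hf (ha.mul hf.1) (by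
    filter_upwards [hC] with z hz
    rw [norm_mul]
    gcongr)

theorem tendsto_eLpNorm_bdd_mul {a : α → ℝ} {f : ℕ → α → ℝ} {F : α → ℝ} {C : ℝ}
    (hC : ∀ᵐ z ∂μ, ‖a z‖ ≤ C)
    (hfF : Tendsto (fun n => eLpNorm (f n - F) 2 μ) atTop (𝓝 0)) :
    Tendsto (fun n => eLpNorm ((fun z => a z * f n z) - fun z => a z * F z) 2 μ) atTop (𝓝 0) := by
  have h1 : Tendsto (fun n => ENNReal.ofReal C * eLpNorm (f n - F) 2 μ) atTop (𝓝 0) := by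
    simpa using ENNReal.Tendsto.const_mul hfF (Or.inr ENNReal.ofReal_ne_top)
  refine tendsto_of_tendsto_of_tendsto_of_le_of_le tendsto_const_nhds h1 (fun _ => zero_le) ?_
  intro n
  refine eLpNorm_le_mul_eLpNorm_of_ae_le_mul ?_ 2
  filter_upwards [hC] with z hz
  simp only [Pi.sub_apply]
  rw [← mul_sub, norm_mul]
  gcongr

theorem tendsto_eLpNorm_sum {κ : Type*} (t : Finset κ) {f : κ → ℕ → α → ℝ} {F : κ → α → ℝ}
    (hf : ∀ p ∈ t, ∀ n, AEStronglyMeasurable (f p n - F p) μ)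
    (hfF : ∀ p ∈ t, Tendsto (fun n => eLpNorm (f p n - F p) 2 μ) atTop (𝓝 0)) :
    Tendsto (fun n => eLpNorm ((∑ p ∈ t, f p n) - ∑ p ∈ t, F p) 2 μ) atTop (𝓝 0) := by
  have h0 := tendsto_finsetSum t hfF
  rw [Finset.sum_const_zero] at h0
  refine tendsto_of_tendsto_of_tendsto_of_le_of_le tendsto_const_nhds h0
    (fun _ => zero_le) fun n => ?_
  rw [← Finset.sum_sub_distrib]
  exact eLpNorm_sum_le (fun p hp => hf p hp n) (by norm_num)

end L2

section Mollification

variable {E : Type*} [NormedAddCommGroup E] [NormedSpace ℝ E] [FiniteDimensional ℝ E]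
  [MeasurableSpace E] [BorelSpace E] {μ : Measure E} [μ.IsAddHaarMeasure]

/-- Translations are continuous in `L²`. -/
theorem tendsto_eLpNorm_translate_sub {F : E → ℝ} (hF : MemLp F 2 μ) :
    Tendsto (fun w => eLpNorm (fun z => F (z - w) - F z) 2 μ) (𝓝 0) (𝓝 0) := by
  have : Fact ((1 : ℝ≥0∞) ≤ 2) := ⟨by norm_num⟩
  let g : C(E, C(E, E)) := (ContinuousMap.mk fun q : E × E => q.2 - q.1).curry
  have hg : ∀ w, MeasurePreserving (g w) μ μ := fun w => measurePreserving_sub_right μ w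
  have h1 : Tendsto (fun w => Lp.compMeasurePreserving (g w) (hg w) (hF.toLp F)) (𝓝 0)
      (𝓝 (Lp.compMeasurePreserving (g 0) (hg 0) (hF.toLp F))) :=
    tendsto_const_nhds.compMeasurePreservingLp (g.continuous.tendsto 0) hg (hg 0) (by norm_num)
  rw [tendsto_iff_edist_tendsto_0] at h1
  refine h1.congr fun w => ?_
  rw [Lp.toLp_compMeasurePreserving, Lp.toLp_compMeasurePreserving, Lp.edist_toLp_toLp]
  refine eLpNorm_congr_ae (Eventually.of_forall fun z => ?_)
  simp [g]

/-- Averaging over translations moves a function in `L²` by no more than the largest translation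
does: by Jensen's inequality for the probability density `η`, and Tonelli's theorem. -/
theorem eLpNorm_mollify_sub_le {F η : E → ℝ} (hFm : Measurable F) (hF : MemLp F 2 μ)
    (hη : Continuous η) (hηc : HasCompactSupport η) (h0 : ∀ w, 0 ≤ η w) (h1 : ∫ w, η w ∂μ = 1)
    {δ : ℝ≥0∞} (hδ : ∀ w ∈ Function.support η, eLpNorm (fun z => F (z - w) - F z) 2 μ ≤ δ) :
    eLpNorm (fun z => (∫ w, F w * η (z - w) ∂μ) - F z) 2 μ ≤ δ := by
  have hηi : Integrable η μ := hη.integrable_of_hasCompactSupport hηc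
  set ν := μ.withDensity fun w => ENNReal.ofReal (η w) with hν
  have hprob : IsProbabilityMeasure ν := by
    refine ⟨?_⟩
    rw [hν, withDensity_apply _ MeasurableSet.univ, Measure.restrict_univ,
      ← ofReal_integral_eq_lintegral_ofReal hηi (Eventually.of_forall h0), h1, ENNReal.ofReal_one]
  have hloc : LocallyIntegrable F μ := hF.locallyIntegrable (by norm_num)
  have hdens : ∀ φ : E → ℝ≥0∞, Measurable φ →
      ∫⁻ w, φ w ∂ν = ∫⁻ w, ENNReal.ofReal (η w) * φ w ∂μ := fun φ hφ => by
    rw [hν, lintegral_withDensity_eq_lintegral_mul _ (by fun_prop) hφ]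
    rfl
  have hpt : ∀ z, ‖(∫ w, F w * η (z - w) ∂μ) - F z‖ₑ ^ 2 ≤ ∫⁻ w, ‖F (z - w) - F z‖ₑ ^ 2 ∂ν := by
    intro z
    have i1 : Integrable (fun w => F w * η (z - w)) μ := by
      have := hloc.integrable_smul_left_of_hasCompactSupport (g := fun w => η (z - w))
        (by fun_prop) (hηc.comp_homeomorph (Homeomorph.subLeft z))
      refine this.congr (Eventually.of_forall fun w => ?_)
      simp [mul_comm]
    have i2 : Integrable (fun w => F (z - w) * η w) μ := by
      have := i1.comp_sub_left z
      simpa using this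
    have e1 : (∫ w, F w * η (z - w) ∂μ) - F z = ∫ w, η w * (F (z - w) - F z) ∂μ := by
      have e2 : ∫ w, F w * η (z - w) ∂μ = ∫ w, F (z - w) * η w ∂μ := by
        rw [← integral_sub_left_eq_self _ μ z]
        simp
      have e3 : F z = ∫ w, F z * η w ∂μ := by rw [integral_const_mul, h1, mul_one]
      rw [e2]
      conv_lhs => rw [e3]
      rw [← integral_sub i2 (hηi.const_mul _)]
      exact integral_congr_ae (Eventually.of_forall fun w => by ring)
    have e4 : ‖(∫ w, F w * η (z - w) ∂μ) - F z‖ₑ ≤ eLpNorm (fun w => F (z - w) - F z) 1 ν := by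
      rw [e1, eLpNorm_one_eq_lintegral_enorm, hdens _ (by fun_prop)]
      refine (enorm_integral_le_lintegral_enorm _).trans_eq ?_
      refine lintegral_congr fun w => ?_
      rw [enorm_mul, Real.enorm_of_nonneg (h0 w)]
    have e5 : eLpNorm (fun w => F (z - w) - F z) 1 ν ≤ eLpNorm (fun w => F (z - w) - F z) 2 ν :=
      eLpNorm_le_eLpNorm_of_exponent_le (by norm_num)
        (Measurable.aestronglyMeasurable (by fun_prop))
    have e6 : eLpNorm (fun w => F (z - w) - F z) 2 ν ^ 2 = ∫⁻ w, ‖F (z - w) - F z‖ₑ ^ 2 ∂ν := by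
      have := eLpNorm_nnreal_pow_eq_lintegral (μ := ν) (f := fun w => F (z - w) - F z)
        (p := 2) two_ne_zero
      simpa using this
    rw [← e6]
    gcongr
    exact e4.trans e5
  have hsq : ∀ φ : E → ℝ, eLpNorm φ 2 μ ^ 2 = ∫⁻ z, ‖φ z‖ₑ ^ 2 ∂μ := fun φ => by
    have := eLpNorm_nnreal_pow_eq_lintegral (μ := μ) (f := φ) (p := 2) two_ne_zero
    simpa using this
  have hfin : eLpNorm (fun z => (∫ w, F w * η (z - w) ∂μ) - F z) 2 μ ^ 2 ≤ δ ^ 2 := by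
    rw [hsq]
    calc _ ≤ ∫⁻ z, ∫⁻ w, ‖F (z - w) - F z‖ₑ ^ 2 ∂ν ∂μ := lintegral_mono hpt
      _ = ∫⁻ w, ∫⁻ z, ‖F (z - w) - F z‖ₑ ^ 2 ∂μ ∂ν :=
        lintegral_lintegral_swap (Measurable.aemeasurable (by fun_prop))
      _ = ∫⁻ w, ENNReal.ofReal (η w) * ∫⁻ z, ‖F (z - w) - F z‖ₑ ^ 2 ∂μ ∂μ := by
        refine hdens _ ?_
        exact Measurable.lintegral_prod_left' (f := fun q : E × E => ‖F (q.1 - q.2) - F q.1‖ₑ ^ 2)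
          (by fun_prop)
      _ ≤ ∫⁻ w, ENNReal.ofReal (η w) * δ ^ 2 ∂μ := by
        refine lintegral_mono fun w => ?_
        by_cases hw : η w = 0
        · simp [hw]
        · have := hδ w hw
          rw [← hsq fun z => F (z - w) - F z]
          gcongr
      _ = δ ^ 2 := by
        rw [← hdens _ measurable_const, lintegral_const, measure_univ, mul_one]
  exact le_of_not_gt fun h => (ENNReal.pow_right_strictMono two_ne_zero h).not_ge hfin

/-- Mollifiers whose supports shrink to the origin, not necessarily centred there, approximate the
identity in `L²`. -/
theorem tendsto_eLpNorm_mollify_sub {F : E → ℝ} (hF : MemLp F 2 μ) {c : ℕ → E}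
    (η : ∀ n, ContDiffBump (c n))
    (hη : Tendsto (fun n => ‖c n‖ + (η n).rOut) atTop (𝓝 0)) :
    Tendsto (fun n => eLpNorm ((fun z => ∫ w, F w * (η n).normed μ (z - w) ∂μ) - F) 2 μ) atTop
      (𝓝 0) := by
  obtain ⟨F', hF'm, hae⟩ := hF.1.aemeasurable
  have hF' : MemLp F' 2 μ := hF.ae_eq hae
  have hcongr : ∀ n, eLpNorm ((fun z => ∫ w, F w * (η n).normed μ (z - w) ∂μ) - F) 2 μ =
      eLpNorm (fun z => (∫ w, F' w * (η n).normed μ (z - w) ∂μ) - F' z) 2 μ := fun n => by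
    refine eLpNorm_congr_ae ?_
    filter_upwards [hae] with z hz
    simp only [Pi.sub_apply, hz]
    congr 1
    refine integral_congr_ae ?_
    filter_upwards [hae] with w hw
    rw [hw]
  simp_rw [hcongr]
  rw [ENNReal.tendsto_nhds_zero]
  intro δ hδ
  have h1 := ENNReal.tendsto_nhds_zero.1 (tendsto_eLpNorm_translate_sub hF') δ hδ
  obtain ⟨ρ, hρ, hball⟩ := Metric.eventually_nhds_iff.1 h1
  filter_upwards [hη.eventually (gt_mem_nhds hρ)] with n hn
  refine eLpNorm_mollify_sub_le hF'm hF' (η n).continuous_normed (η n).hasCompactSupport_normed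
    (fun w => (η n).nonneg_normed w) (η n).integral_normed fun w hw => hball ?_
  rw [(η n).support_normed_eq, mem_ball_iff_norm] at hw
  rw [dist_zero_right]
  calc ‖w‖ = ‖(w - c n) + c n‖ := by rw [sub_add_cancel]
    _ ≤ ‖w - c n‖ + ‖c n‖ := norm_add_le _ _
    _ < ρ := by linarith

end Mollification

/-! ### Density of smooth functions in `W^{1,2}` -/

section Density

open scoped Convolution

variable {ι : Type*} [Fintype ι] {Ω : Set (EuclideanSpace ℝ ι)}

/-- A `C¹` domain has the uniform cone property: near a point of the closure there is a cone of
directions that lead from points of `Ω` to points of `Ω`. -/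
theorem exists_cone (hΩ : IsOpen Ω) (hC : IsOfClassC1 Ω) {p : EuclideanSpace ℝ ι}
    (hp : p ∈ closure Ω) : ∃ (e : EuclideanSpace ℝ ι) (c δ r : ℝ), 0 < c ∧ 0 < δ ∧ 0 < r ∧
      ∀ τ ∈ Set.Ioo 0 δ, ∀ w ∈ Metric.closedBall (τ • e) (c * τ), ∀ z ∈ Ω,
        z - w ∈ Metric.ball p r → z - w ∈ Ω := by
  by_cases hpΩ : p ∈ Ω
  · obtain ⟨r, hr, hball⟩ := Metric.isOpen_iff.1 hΩ p hpΩ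
    exact ⟨0, 1, 1, r, one_pos, one_pos, hr, fun τ _ w _ z _ h => hball h⟩
  obtain ⟨e, γ, R, he, hγ, hR, hb⟩ := hC p (by rw [hΩ.frontier_eq]; exact ⟨hp, hpΩ⟩)
  set P := (ℝ ∙ e)ᗮ.orthogonalProjectionOnto with hP
  have hPn : ∀ z, ‖P z‖ ≤ ‖z‖ := fun z => (ℝ ∙ e)ᗮ.norm_orthogonalProjectionOnto_apply_le z
  obtain ⟨L, s, hs, hL⟩ := hγ.locallyLipschitz (P p)
  obtain ⟨R', hR', hR's⟩ := Metric.mem_nhds_iff.1 hs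
  set ρ := min R R' with hρ
  have hρ0 : 0 < ρ := lt_min hR hR'
  -- the opening `c` of the cone is chosen so that `L c < 1 - c`
  set c : ℝ := 1 / (2 * (1 + L)) with hc
  have hL0 : (0 : ℝ) ≤ L := L.2
  have hc0 : 0 < c := by positivity
  have hcL : c * (1 + L) = 1 / 2 := by rw [hc]; field_simp
  have hc1 : c ≤ 1 := by nlinarith
  refine ⟨e, c, ρ / 4, ρ / 2, hc0, by positivity, by positivity, ?_⟩
  rintro τ ⟨hτ0, hτ⟩ w hw z hz hzw
  rw [mem_closedBall_iff_norm] at hw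
  have hw1 : ‖w‖ ≤ 2 * τ := by
    calc ‖w‖ = ‖(w - τ • e) + τ • e‖ := by rw [sub_add_cancel]
      _ ≤ ‖w - τ • e‖ + ‖τ • e‖ := norm_add_le _ _
      _ ≤ c * τ + τ := by rw [norm_smul, he, mul_one, Real.norm_of_nonneg hτ0.le]; gcongr
      _ ≤ 2 * τ := by nlinarith
  have hzw' : ‖z - w - p‖ < ρ / 2 := mem_ball_iff_norm.1 hzw
  have hzp : ‖z - p‖ < ρ := by
    calc ‖z - p‖ = ‖(z - w - p) + w‖ := by congr 1; abel
      _ ≤ ‖z - w - p‖ + ‖w‖ := norm_add_le _ _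
      _ < ρ := by linarith
  have hzR : z ∈ Metric.ball p R := mem_ball_iff_norm.2 (hzp.trans_le (min_le_left _ _))
  have hzwR : z - w ∈ Metric.ball p R :=
    mem_ball_iff_norm.2 (hzw'.trans (by have := min_le_left R R'; linarith))
  have h1 := (hb z hzR).1 hz
  rw [hb _ hzwR]
  have hs1 : P z ∈ s := hR's (by
    rw [mem_ball_iff_norm, ← map_sub]
    exact (hPn _).trans_lt (hzp.trans_le (min_le_right _ _)))
  have hs2 : P (z - w) ∈ s := hR's (by
    rw [mem_ball_iff_norm, ← map_sub]
    refine (hPn _).trans_lt (hzw'.trans ?_)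
    have := min_le_right R R'
    linarith)
  have hPe : P e = 0 := Submodule.orthogonalProjectionOnto_orthogonal_apply_eq_zero
    (Submodule.mem_span_singleton_self e)
  have hPw : ‖P w‖ ≤ c * τ := by
    have : P w = P (w - τ • e) := by rw [map_sub, map_smul, hPe, smul_zero, sub_zero]
    rw [this]
    exact (hPn _).trans hw
  have h2 : γ (P z) - γ (P (z - w)) ≤ L * (c * τ) := by
    have := hL.dist_le_mul _ hs1 _ hs2
    rw [Real.dist_eq, dist_eq_norm, ← map_sub, sub_sub_cancel] at this
    refine (le_abs_self _).trans (this.trans ?_)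
    gcongr
  have h3 : τ - c * τ ≤ inner ℝ e w := by
    have h4 : inner ℝ e w = τ + inner ℝ e (w - τ • e) := by
      rw [inner_sub_right, real_inner_smul_right, real_inner_self_eq_norm_sq, he]
      ring
    have h5 : |inner ℝ e (w - τ • e)| ≤ c * τ := by
      refine (abs_real_inner_le_norm e (w - τ • e)).trans ?_
      rwa [he, one_mul]
    have h5 := abs_le.1 h5
    linarith [h5.1]
  rw [inner_sub_right]
  have h6 : c * τ * (1 + L) = τ / 2 := by rw [mul_right_comm, hcL]; ring
  change inner ℝ e z < γ (P z) at h1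
  change inner ℝ e z - inner ℝ e w < γ (P (z - w))
  nlinarith

variable [DecidableEq ι]

theorem partialDeriv_mul {i : ι} {a b : EuclideanSpace ℝ ι → ℝ} {z : EuclideanSpace ℝ ι}
    (ha : DifferentiableAt ℝ a z) (hb : DifferentiableAt ℝ b z) :
    partialDeriv i (fun z => a z * b z) z =
      partialDeriv i a z * b z + a z * partialDeriv i b z := by
  simp only [partialDeriv, fderiv_fun_mul ha hb, add_apply,
    smul_apply, smul_eq_mul]
  ring

theorem contDiff_partialDeriv {φ : EuclideanSpace ℝ ι → ℝ} (hφ : ContDiff ℝ ∞ φ) (i : ι) :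
    ContDiff ℝ ∞ (partialDeriv i φ) :=
  ((contDiff_infty_iff_fderiv.1 hφ).2).clm_apply contDiff_const

omit [Fintype ι] in
theorem hasCompactSupport_partialDeriv {φ : EuclideanSpace ℝ ι → ℝ} (hφ : HasCompactSupport φ)
    (i : ι) : HasCompactSupport (partialDeriv i φ) := hφ.fderiv_apply (𝕜 := ℝ) _

omit [DecidableEq ι] in
theorem integrableOn_mul_of_memL2 {f φ : EuclideanSpace ℝ ι → ℝ} (hf : MemL2 Ω f)
    (hφ : Continuous φ) (hφc : HasCompactSupport φ) :
    IntegrableOn (fun z => f z * φ z) Ω :=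
  MemLp.integrable_mul (p := 2) (q := 2) hf ((hφ.memLp_of_hasCompactSupport hφc).restrict Ω)

omit [DecidableEq ι] in
theorem isTestFunction_mul_comp_sub {χ κ : EuclideanSpace ℝ ι → ℝ} (hχ : ContDiff ℝ ∞ χ)
    (hχc : HasCompactSupport χ) (hκ : ContDiff ℝ ∞ κ) (z : EuclideanSpace ℝ ι)
    (hadm : ∀ w, w ∈ tsupport χ → z - w ∈ tsupport κ → w ∈ Ω) :
    IsTestFunction Ω fun w => χ w * κ (z - w) := by
  refine ⟨hχ.mul (hκ.comp (contDiff_const.sub contDiff_id)), hχc.mul_right, fun w hw' => ?_⟩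
  refine hadm w (tsupport_mul_subset_left hw') ?_
  have h3 : w ∈ tsupport fun w => κ (z - w) := tsupport_mul_subset_right hw'
  have h4 : (tsupport fun w => κ (z - w)) ⊆ (fun w => z - w) ⁻¹' tsupport κ :=
    closure_minimal (fun y hy => subset_tsupport κ hy)
      ((isClosed_tsupport κ).preimage (by fun_prop))
  exact h4 h3

theorem partialDeriv_comp_sub {κ : EuclideanSpace ℝ ι → ℝ} (hκ : Differentiable ℝ κ)
    (z w : EuclideanSpace ℝ ι) (i : ι) :
    partialDeriv i (fun w => κ (z - w)) w = -partialDeriv i κ (z - w) := by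
  have h2 : HasFDerivAt (fun w => κ (z - w)) _ w :=
    (hκ (z - w)).hasFDerivAt.comp w ((hasFDerivAt_const z w).sub (hasFDerivAt_id w))
  rw [partialDeriv, h2.fderiv]
  simp [partialDeriv]

/-- Where the mollifier only sees points of `Ω`, the derivative of the mollified function is the
mollified weak derivative. -/
theorem partialDeriv_mollify (hΩ : IsOpen Ω)
    {f : EuclideanSpace ℝ ι → ℝ} {D : ι → EuclideanSpace ℝ ι → ℝ} (hw : IsWeakGrad Ω f D)
    {χ κ : EuclideanSpace ℝ ι → ℝ} (hχ : ContDiff ℝ ∞ χ) (hχc : HasCompactSupport χ)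
    (hκ : ContDiff ℝ ∞ κ) (hκc : HasCompactSupport κ) (z : EuclideanSpace ℝ ι)
    (hadm : ∀ w, w ∈ tsupport χ → z - w ∈ tsupport κ → w ∈ Ω)
    (hloc : LocallyIntegrable (Ω.indicator fun z => χ z * f z) volume) (i : ι) :
    partialDeriv i ((Ω.indicator fun z => χ z * f z) ⋆[ContinuousLinearMap.mul ℝ ℝ, volume] κ) z =
      ∫ w, Ω.indicator (fun z => χ z * D i z + partialDeriv i χ z * f z) w * κ (z - w) := by
  have h1 : partialDeriv i
      ((Ω.indicator fun z => χ z * f z) ⋆[ContinuousLinearMap.mul ℝ ℝ, volume] κ) z =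
      ∫ w, (Ω.indicator fun z => χ z * f z) w * partialDeriv i κ (z - w) := by
    rw [partialDeriv, (hκc.hasFDerivAt_convolution_right _ hloc
      (hκ.of_le (by exact_mod_cast le_top)) z).fderiv,
      convolution_precompR_apply _ hloc (hκc.fderiv ℝ) (hκ.continuous_fderiv (by simp))]
    rfl
  have hθd : ContDiff ℝ ∞ fun w => κ (z - w) := hκ.comp (contDiff_const.sub contDiff_id)
  have h6 := hw.2.2 i _ (isTestFunction_mul_comp_sub hχ hχc hκ z hadm)
  have h7 : ∀ w, f w * partialDeriv i (fun w => χ w * κ (z - w)) w =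
      f w * (partialDeriv i χ w * κ (z - w)) - f w * (χ w * partialDeriv i κ (z - w)) := by
    intro w
    rw [partialDeriv_mul (hχ.differentiable (by simp) w) (hθd.differentiable (by simp) w),
      partialDeriv_comp_sub (hκ.differentiable (by simp))]
    ring
  have hcont : Continuous (partialDeriv i κ) := (contDiff_partialDeriv hκ i).continuous
  have hχ' : Continuous (partialDeriv i χ) := (contDiff_partialDeriv hχ i).continuous
  have i1 : IntegrableOn (fun w => f w * (partialDeriv i χ w * κ (z - w))) Ω :=
    integrableOn_mul_of_memL2 hw.1 (hχ'.mul hθd.continuous)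
      ((hasCompactSupport_partialDeriv hχc i).mul_right)
  have i2 : IntegrableOn (fun w => f w * (χ w * partialDeriv i κ (z - w))) Ω :=
    integrableOn_mul_of_memL2 hw.1
      (hχ.continuous.mul (hcont.comp (continuous_const.sub continuous_id))) hχc.mul_right
  have i3 : IntegrableOn (fun w => D i w * (χ w * κ (z - w))) Ω :=
    integrableOn_mul_of_memL2 (hw.2.1 i) (hχ.continuous.mul hθd.continuous) hχc.mul_right
  simp only [h7] at h6
  rw [integral_sub i1 i2] at h6
  have h8 : ∫ w, (Ω.indicator fun z => χ z * f z) w * partialDeriv i κ (z - w) =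
      ∫ w in Ω, f w * (χ w * partialDeriv i κ (z - w)) := by
    rw [← integral_indicator hΩ.measurableSet]
    congr 1
    ext w
    by_cases h : w ∈ Ω
    · simp only [Set.indicator_of_mem h]
      ring
    · simp only [Set.indicator_of_notMem h, zero_mul]
  have h9 : ∫ w, Ω.indicator (fun z => χ z * D i z + partialDeriv i χ z * f z) w * κ (z - w) =
      ∫ w in Ω, (D i w * (χ w * κ (z - w)) + f w * (partialDeriv i χ w * κ (z - w))) := by
    rw [← integral_indicator hΩ.measurableSet]
    congr 1
    ext w
    by_cases h : w ∈ Ω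
    · simp only [Set.indicator_of_mem h]
      ring
    · simp only [Set.indicator_of_notMem h, zero_mul]
  rw [h1, h8, h9, integral_add i3 i1]
  linarith

/-- Approximation of a Sobolev function near one point of the closure of a domain with the cone
property. The mollifiers are supported in the cone of admissible directions, so that for `z ∈ Ω`
the mollified function at `z` only involves test functions supported in `Ω`. -/
theorem exists_smooth_approx_local {p e : EuclideanSpace ℝ ι} {c δ r : ℝ}
    (hΩ : IsOpen Ω) (hc : 0 < c) (hδ : 0 < δ)
    (hcone : ∀ τ ∈ Set.Ioo 0 δ, ∀ w ∈ Metric.closedBall (τ • e) (c * τ), ∀ z ∈ Ω,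
        z - w ∈ Metric.ball p r → z - w ∈ Ω)
    {f : EuclideanSpace ℝ ι → ℝ} {D : ι → EuclideanSpace ℝ ι → ℝ} (hw : IsWeakGrad Ω f D)
    {χ : EuclideanSpace ℝ ι → ℝ} (hχ : ContDiff ℝ ∞ χ) (hχc : HasCompactSupport χ)
    (hχs : tsupport χ ⊆ Metric.ball p r) :
    ∃ ψ : ℕ → EuclideanSpace ℝ ι → ℝ, (∀ n, ContDiff ℝ ∞ (ψ n)) ∧
      TendstoL2 Ω ψ (fun z => χ z * f z) ∧ ∀ i, TendstoL2 Ω (fun n => partialDeriv i (ψ n))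
        (fun z => χ z * D i z + partialDeriv i χ z * f z) := by
  have hbdd : ∀ {a g : EuclideanSpace ℝ ι → ℝ}, Continuous a → HasCompactSupport a → MemL2 Ω g →
      MemL2 Ω fun z => a z * g z := by
    intro a g ha hac hg
    obtain ⟨C, hC⟩ := ha.bounded_above_of_compact_support hac
    exact memLp_bdd_mul ha.aestronglyMeasurable (Eventually.of_forall hC) hg
  set F : EuclideanSpace ℝ ι → ℝ := Ω.indicator fun z => χ z * f z with hF
  set G : ι → EuclideanSpace ℝ ι → ℝ :=
    fun i => Ω.indicator fun z => χ z * D i z + partialDeriv i χ z * f z with hG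
  have hFm : MemLp F 2 volume :=
    (memLp_indicator_iff_restrict hΩ.measurableSet).2 (hbdd hχ.continuous hχc hw.1)
  have hGm : ∀ i, MemLp (G i) 2 volume := fun i =>
    (memLp_indicator_iff_restrict hΩ.measurableSet).2 ((hbdd hχ.continuous hχc (hw.2.1 i)).add
      (hbdd (contDiff_partialDeriv hχ i).continuous (hasCompactSupport_partialDeriv hχc i) hw.1))
  have hFloc : LocallyIntegrable F volume := hFm.locallyIntegrable (by norm_num)
  set τ : ℕ → ℝ := fun n => δ / (n + 2) with hτ
  have hτ0 : ∀ n, 0 < τ n := fun n => by positivity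
  have hτδ : ∀ n, τ n < δ := fun n => div_lt_self hδ (by
    have : (0 : ℝ) ≤ n := n.cast_nonneg
    linarith)
  have hτlim : Tendsto τ atTop (𝓝 0) :=
    tendsto_const_nhds.div_atTop (tendsto_atTop_add_const_right _ _ tendsto_natCast_atTop_atTop)
  let η : ∀ n, ContDiffBump (τ n • e) := fun n =>
    ⟨c * τ n / 2, c * τ n, by have := hτ0 n; positivity, half_lt_self (mul_pos hc (hτ0 n))⟩
  have hηlim : Tendsto (fun n => ‖τ n • e‖ + (η n).rOut) atTop (𝓝 0) := by
    have h1 : Tendsto (fun n => ‖τ n • e‖ + c * τ n) atTop (𝓝 (‖(0 : ℝ) • e‖ + c * 0)) :=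
      (hτlim.smul_const e).norm.add (hτlim.const_mul c)
    simpa using h1
  set κ : ℕ → EuclideanSpace ℝ ι → ℝ := fun n => (η n).normed volume with hκ
  have hκd : ∀ n, ContDiff ℝ ∞ (κ n) := fun n => (η n).contDiff_normed
  have hκc : ∀ n, HasCompactSupport (κ n) := fun n => (η n).hasCompactSupport_normed
  set ψ : ℕ → EuclideanSpace ℝ ι → ℝ :=
    fun n => F ⋆[ContinuousLinearMap.mul ℝ ℝ, volume] κ n with hψ
  have hψv : ∀ n z, ψ n z = ∫ w, F w * κ n (z - w) := fun n z => rfl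
  have hderiv : ∀ n i, ∀ z ∈ Ω, partialDeriv i (ψ n) z = ∫ w, G i w * κ n (z - w) := by
    intro n i z hz
    refine partialDeriv_mollify hΩ hw hχ hχc (hκd n) (hκc n) z (fun w hw1 hw2 => ?_) hFloc i
    rw [hκ, (η n).tsupport_normed_eq] at hw2
    have := hcone (τ n) ⟨hτ0 n, hτδ n⟩ (z - w) hw2 z hz (by
      rw [sub_sub_cancel]; exact hχs hw1)
    rwa [sub_sub_cancel] at this
  have hrestr : ∀ {Φ : ℕ → EuclideanSpace ℝ ι → ℝ} {g : EuclideanSpace ℝ ι → ℝ},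
      Tendsto (fun n => eLpNorm (Φ n - g) 2 volume) atTop (𝓝 0) → TendstoL2 Ω Φ g := by
    intro Φ g h
    exact tendsto_of_tendsto_of_tendsto_of_le_of_le tendsto_const_nhds h (fun _ => zero_le)
      fun n => eLpNorm_mono_measure _ Measure.restrict_le_self
  refine ⟨ψ, fun n => (hκc n).contDiff_convolution_right _ hFloc (hκd n), ?_, fun i => ?_⟩
  · refine (hrestr (tendsto_eLpNorm_mollify_sub hFm η hηlim)).congr fun n => ?_
    refine eLpNorm_congr_ae ((ae_restrict_iff' hΩ.measurableSet).2 (Eventually.of_forall ?_))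
    intro z hz
    simp only [Pi.sub_apply, hψv, hF, Set.indicator_of_mem hz]
    rfl
  · refine (hrestr (tendsto_eLpNorm_mollify_sub (hGm i) η hηlim)).congr fun n => ?_
    refine eLpNorm_congr_ae ((ae_restrict_iff' hΩ.measurableSet).2 (Eventually.of_forall ?_))
    intro z hz
    simp only [Pi.sub_apply, hderiv n i z hz]
    simp only [hG, Set.indicator_of_mem hz]
    rfl

/-- Functions smooth on the whole space are dense in `W^{1,2}(Ω)` for a bounded domain of
class `C¹`. -/
theorem exists_smooth_approx (hΩ : IsOpen Ω) (hΩb : Bornology.IsBounded Ω) (hC : IsOfClassC1 Ω)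
    {f : EuclideanSpace ℝ ι → ℝ} {D : ι → EuclideanSpace ℝ ι → ℝ} (hw : IsWeakGrad Ω f D) :
    ∃ ψ : ℕ → EuclideanSpace ℝ ι → ℝ, (∀ n, ContDiff ℝ ∞ (ψ n)) ∧
      TendstoL2 Ω ψ f ∧ ∀ i, TendstoL2 Ω (fun n => partialDeriv i (ψ n)) (D i) := by
  have hloc : ∀ p ∈ closure Ω, ∃ r > 0, ∀ χ : EuclideanSpace ℝ ι → ℝ, ContDiff ℝ ∞ χ →
      HasCompactSupport χ → tsupport χ ⊆ Metric.ball p r →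
      ∃ ψ : ℕ → EuclideanSpace ℝ ι → ℝ, (∀ n, ContDiff ℝ ∞ (ψ n)) ∧
      TendstoL2 Ω ψ (fun z => χ z * f z) ∧ ∀ i, TendstoL2 Ω (fun n => partialDeriv i (ψ n))
        (fun z => χ z * D i z + partialDeriv i χ z * f z) := by
    intro p hp
    obtain ⟨e, c, δ, r, hc, hδ, hr, hcone⟩ := exists_cone hΩ hC hp
    exact ⟨r, hr, fun χ h1 h2 h3 => exists_smooth_approx_local hΩ hc hδ hcone hw h1 h2 h3⟩
  choose! r hr hloc using hloc
  obtain ⟨t, χ, htK, hχ, hsum⟩ := exists_smooth_partition hΩb.isCompact_closure hr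
  have hex : ∀ p ∈ t, ∃ ψ : ℕ → EuclideanSpace ℝ ι → ℝ, (∀ n, ContDiff ℝ ∞ (ψ n)) ∧
      TendstoL2 Ω ψ (fun z => χ p z * f z) ∧ ∀ i, TendstoL2 Ω (fun n => partialDeriv i (ψ n))
        (fun z => χ p z * D i z + partialDeriv i (χ p) z * f z) := fun p hp =>
    hloc p (htK p hp) _ (hχ p hp).1 (hχ p hp).2.1 (hχ p hp).2.2.1
  choose! ψ hψd hψ1 hψ2 using hex
  have hm1 : ∀ p ∈ t, AEStronglyMeasurable (fun z => χ p z * f z) (volume.restrict Ω) :=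
    fun p hp => (hχ p hp).1.continuous.aestronglyMeasurable.mul hw.1.1
  have hm2 : ∀ p ∈ t, ∀ i, AEStronglyMeasurable
      (fun z => χ p z * D i z + partialDeriv i (χ p) z * f z) (volume.restrict Ω) :=
    fun p hp i => ((hχ p hp).1.continuous.aestronglyMeasurable.mul (hw.2.1 i).1).add
      ((contDiff_partialDeriv (hχ p hp).1 i).continuous.aestronglyMeasurable.mul hw.1.1)
  refine ⟨fun n => ∑ p ∈ t, ψ p n, fun n => ?_, ?_, fun i => ?_⟩
  · have : (∑ p ∈ t, ψ p n) = fun z => ∑ p ∈ t, ψ p n z := by ext z; simp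
    simp only [this]
    exact ContDiff.sum fun p hp => hψd p hp n
  · refine (tendsto_eLpNorm_sum t (fun p hp n =>
      (hψd p hp n).continuous.aestronglyMeasurable.sub (hm1 p hp)) hψ1).congr fun n => ?_
    refine eLpNorm_congr_ae ((ae_restrict_iff' hΩ.measurableSet).2 (Eventually.of_forall ?_))
    intro z hz
    simp only [Pi.sub_apply, Finset.sum_apply]
    rw [← Finset.sum_mul, hsum z (subset_closure hz), one_mul]
  · refine (tendsto_eLpNorm_sum t (fun p hp n =>
      (contDiff_partialDeriv (hψd p hp n) i).continuous.aestronglyMeasurable.sub (hm2 p hp i))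
      (fun p hp => hψ2 p hp i)).congr fun n => ?_
    refine eLpNorm_congr_ae ((ae_restrict_iff' hΩ.measurableSet).2 (Eventually.of_forall ?_))
    intro z hz
    have h1 : ∀ {g : EuclideanSpace ℝ ι → EuclideanSpace ℝ ι → ℝ}, (∀ p ∈ t, ContDiff ℝ ∞ (g p)) →
        partialDeriv i (fun y => ∑ p ∈ t, g p y) z = ∑ p ∈ t, partialDeriv i (g p) z := by
      intro g hg
      simp only [partialDeriv]
      rw [fderiv_fun_sum fun p hp => (hg p hp).differentiable (by simp) z]
      simp
    have h2 : ∑ p ∈ t, partialDeriv i (χ p) z = 0 := by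
      rw [← h1 fun p hp => (hχ p hp).1, partialDeriv]
      have h3 : (fun y => ∑ p ∈ t, χ p y) =ᶠ[𝓝 z] fun _ => (1 : ℝ) := by
        filter_upwards [hΩ.mem_nhds hz] with y hy
        exact hsum y (subset_closure hy)
      rw [h3.fderiv_eq]
      simp
    have h4 : (∑ p ∈ t, ψ p n) = fun y => ∑ p ∈ t, ψ p n y := by ext y; simp
    simp only [Pi.sub_apply, Finset.sum_apply]
    rw [h4, h1 fun p hp => hψd p hp n, Finset.sum_add_distrib, ← Finset.sum_mul, ← Finset.sum_mul,
      hsum z (subset_closure hz), h2]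
    ring

end Density

/-! ### Existence of traces -/

section Traces

variable {ι : Type*} [Fintype ι] {Ω : Set (EuclideanSpace ℝ ι)}

theorem exists_bound_of_continuous {a : EuclideanSpace ℝ ι → ℝ} (hΩb : Bornology.IsBounded Ω)
    (ha : Continuous a) : ∃ C, ∀ z ∈ closure Ω, ‖a z‖ ≤ C :=
  hΩb.isCompact_closure.exists_bound_of_continuousOn ha.continuousOn

theorem exists_ae_bound_of_continuous {a : EuclideanSpace ℝ ι → ℝ} (hΩ : IsOpen Ω)
    (hΩb : Bornology.IsBounded Ω) (ha : Continuous a) :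
    ∃ C, (∀ᵐ z ∂(volume.restrict Ω), ‖a z‖ ≤ C) ∧ ∀ᵐ z ∂(surfaceMeasure Ω), ‖a z‖ ≤ C := by
  obtain ⟨C, hC⟩ := exists_bound_of_continuous hΩb ha
  exact ⟨C, (ae_restrict_iff' hΩ.measurableSet).2
      (Eventually.of_forall fun z hz => hC z (subset_closure hz)),
    (ae_restrict_iff' isClosed_frontier.measurableSet).2
      (Eventually.of_forall fun z hz => hC z (frontier_subset_closure hz))⟩

theorem memL2_of_continuous {a : EuclideanSpace ℝ ι → ℝ} (hΩ : IsOpen Ω)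
    (hΩb : Bornology.IsBounded Ω) (ha : Continuous a) : MemL2 Ω a := by
  have : IsFiniteMeasure (volume.restrict Ω) := ⟨by
    rw [Measure.restrict_apply_univ]; exact hΩb.measure_lt_top⟩
  obtain ⟨C, hC, _⟩ := exists_ae_bound_of_continuous hΩ hΩb ha
  exact MemLp.of_bound ha.aestronglyMeasurable C hC

theorem memLp_surfaceMeasure_of_continuous {a : EuclideanSpace ℝ ι → ℝ} (hΩ : IsOpen Ω)
    (hΩb : Bornology.IsBounded Ω) (hC : IsOfClassC1 Ω) (ha : Continuous a) :
    MemLp a 2 (surfaceMeasure Ω) := by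
  have := surfaceMeasure_lt_top hΩ hΩb hC
  obtain ⟨C, _, hC⟩ := exists_ae_bound_of_continuous hΩ hΩb ha
  exact MemLp.of_bound ha.aestronglyMeasurable C hC

theorem ae_norm_outerNormal (hΩ : IsOpen Ω) (hC : IsOfClassC1 Ω) :
    ∀ᵐ z ∂(surfaceMeasure Ω), ‖outerNormal Ω z‖ = 1 :=
  (ae_restrict_iff' isClosed_frontier.measurableSet).2
    (Eventually.of_forall fun _ hz => norm_outerNormal hΩ hC hz)

theorem fderiv_apply_eq_sum [DecidableEq ι] (ψ : EuclideanSpace ℝ ι → ℝ)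
    (z e : EuclideanSpace ℝ ι) : fderiv ℝ ψ z e = ∑ i, e i * partialDeriv i ψ z := by
  have h2 : e = ∑ i, e i • EuclideanSpace.single i (1 : ℝ) := by
    ext j
    simp [Pi.single_apply]
  conv_lhs => rw [h2]
  simp [partialDeriv]

theorem fderiv_sq_le [DecidableEq ι] (ψ : EuclideanSpace ℝ ι → ℝ) (z e : EuclideanSpace ℝ ι)
    (he : ‖e‖ = 1) : (fderiv ℝ ψ z e) ^ 2 ≤ ∑ i, partialDeriv i ψ z ^ 2 := by
  rw [fderiv_apply_eq_sum]
  refine (Finset.sum_mul_sq_le_sq_mul_sq _ _ _).trans_eq ?_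
  rw [← EuclideanSpace.real_norm_sq_eq, he]
  simp

/-- The trace inequality for smooth functions. It follows from the divergence theorem for
`ψ² V`, where `V = ∑ χ_p e_p` is a vector field that is strictly transversal to the boundary. -/
theorem exists_trace_inequality [DecidableEq ι] (hΩ : IsOpen Ω) (hΩb : Bornology.IsBounded Ω)
    (hC : IsOfClassC1 Ω) : ∃ C : ℝ, ∀ ψ : EuclideanSpace ℝ ι → ℝ, ContDiff ℝ ∞ ψ →
      ∫ z, ψ z ^ 2 ∂(surfaceMeasure Ω) ≤
        C * ((∫ z in Ω, ψ z ^ 2) + ∑ i, ∫ z in Ω, partialDeriv i ψ z ^ 2) := by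
  have hK : IsCompact (frontier Ω) :=
    hΩb.isCompact_closure.of_isClosed_subset isClosed_frontier frontier_subset_closure
  have hloc : ∀ p ∈ frontier Ω, ∃ r > 0, ∃ e : EuclideanSpace ℝ ι, ‖e‖ = 1 ∧
      ∀ z ∈ frontier Ω, z ∈ Metric.ball p r → 0 < inner ℝ (outerNormal Ω z) e := by
    intro p hp
    obtain ⟨e, γ, r, hc⟩ := hC p hp
    refine ⟨r, hc.2.2.1, e, hc.1, fun z hz hzb => ?_⟩
    rw [hc.outerNormal_eq hΩ hzb hz, real_inner_smul_left, inner_upwardNormal_left hc.1, mul_one]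
    exact inv_pos.2 (norm_upwardNormal_pos hc.1 _)
  choose! r hr e he hpos using hloc
  obtain ⟨t, χ, htK, hχ, hsum⟩ := exists_smooth_partition hK hr
  have htrans : ∀ z ∈ frontier Ω, 0 < ∑ p ∈ t, χ p z * inner ℝ (outerNormal Ω z) (e p) := by
    intro z hz
    have hnn : ∀ p ∈ t, 0 ≤ χ p z * inner ℝ (outerNormal Ω z) (e p) := by
      intro p hp
      by_cases h : χ p z = 0
      · simp [h]
      · exact mul_nonneg ((hχ p hp).2.2.2 z)
          (hpos p (htK p hp) z hz ((hχ p hp).2.2.1 (subset_tsupport _ h))).le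
    obtain ⟨p, hp, hne⟩ : ∃ p ∈ t, χ p z ≠ 0 := by
      by_contra! h
      have := hsum z hz
      rw [Finset.sum_eq_zero h] at this
      exact zero_ne_one this
    refine Finset.sum_pos' hnn ⟨p, hp, mul_pos ?_
      (hpos p (htK p hp) z hz ((hχ p hp).2.2.1 (subset_tsupport _ hne)))⟩
    exact lt_of_le_of_ne ((hχ p hp).2.2.2 z) (Ne.symm hne)
  -- by compactness `V · n` is bounded below on the boundary by some `c > 0`
  have hcontn := continuousOn_outerNormal hΩ hC
  have hcont : ContinuousOn (fun z => ∑ p ∈ t, χ p z * inner ℝ (outerNormal Ω z) (e p))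
      (frontier Ω) :=
    continuousOn_finsetSum _ fun p hp =>
      (hχ p hp).1.continuous.continuousOn.mul (hcontn.inner continuousOn_const)
  obtain ⟨c, hc0, hc⟩ := hK.exists_forall_le' hcont htrans
  have hB : ∀ p ∈ t, ∃ B, ∀ z, |χ p z| ≤ B ∧ |fderiv ℝ (χ p) z (e p)| ≤ B := by
    intro p hp
    obtain ⟨B1, h1⟩ := (hχ p hp).1.continuous.bounded_above_of_compact_support (hχ p hp).2.1
    obtain ⟨B2, h2⟩ := (((hχ p hp).1.continuous_fderiv (by simp)).clm_apply
      continuous_const).bounded_above_of_compact_support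
      ((hχ p hp).2.1.fderiv_apply (𝕜 := ℝ) (e p))
    exact ⟨max B1 B2, fun z => ⟨(h1 z).trans (le_max_left _ _), (h2 z).trans (le_max_right _ _)⟩⟩
  choose! B hB using hB
  refine ⟨(∑ p ∈ t, 2 * B p) / c, fun ψ hψ => ?_⟩
  have hi0 : ∀ {a : EuclideanSpace ℝ ι → ℝ}, Continuous a → IntegrableOn a Ω := fun ha =>
    (ha.continuousOn.integrableOn_compact hΩb.isCompact_closure).mono_set subset_closure
  have hfin := surfaceMeasure_lt_top hΩ hΩb hC
  have hσ : ∀ {a : EuclideanSpace ℝ ι → ℝ}, Continuous a → Integrable a (surfaceMeasure Ω) :=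
    fun ha => (memLp_surfaceMeasure_of_continuous hΩ hΩb hC ha).integrable (by norm_num)
  have hnb : ∀ p ∈ t, ∀ᵐ z ∂(surfaceMeasure Ω), ‖inner ℝ (outerNormal Ω z) (e p)‖ ≤ 1 := by
    intro p hp
    filter_upwards [ae_norm_outerNormal hΩ hC] with z hz
    refine (norm_inner_le_norm _ _).trans ?_
    rw [hz, he p (htK p hp), one_mul]
  have hterm : ∀ p ∈ t, Integrable (fun z => (ψ z ^ 2 * χ p z) * inner ℝ (outerNormal Ω z) (e p))
      (surfaceMeasure Ω) := fun p hp =>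
    (hσ ((hψ.continuous.pow 2).mul (hχ p hp).1.continuous)).mul_bdd (c := 1)
      ((aestronglyMeasurable_outerNormal hΩ hC).inner aestronglyMeasurable_const) (hnb p hp)
  have hSi : IntegrableOn (fun z => ψ z ^ 2 + ∑ i, partialDeriv i ψ z ^ 2) Ω :=
    hi0 ((hψ.continuous.pow 2).add (continuous_finsetSum _ fun i _ =>
      (contDiff_partialDeriv hψ i).continuous.pow 2))
  have hdiv : ∀ p ∈ t, ∫ z, (ψ z ^ 2 * χ p z) * inner ℝ (outerNormal Ω z) (e p)
      ∂(surfaceMeasure Ω) ≤ 2 * B p * ∫ z in Ω, (ψ z ^ 2 + ∑ i, partialDeriv i ψ z ^ 2) := by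
    intro p hp
    have hd : ContDiff ℝ 1 fun z => ψ z ^ 2 * χ p z :=
      ((hψ.pow 2).mul (hχ p hp).1).of_le (by exact_mod_cast le_top)
    rw [← integral_fderiv_eq_boundary hΩ hΩb hC hd (e p), ← integral_const_mul]
    refine integral_mono (hi0 ((hd.continuous_fderiv one_ne_zero).clm_apply continuous_const))
      (hSi.const_mul _) fun z => ?_
    have hψz := hψ.differentiable (by simp) z
    have h1 : fderiv ℝ (fun z => ψ z ^ 2 * χ p z) z (e p) =
        2 * ψ z * fderiv ℝ ψ z (e p) * χ p z + ψ z ^ 2 * fderiv ℝ (χ p) z (e p) := by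
      have := ((hψz.hasFDerivAt.pow 2).mul
        ((hχ p hp).1.differentiable (by simp) z).hasFDerivAt).fderiv
      have h2 : ((fun z => ψ z ^ 2) * χ p) = fun z => ψ z ^ 2 * χ p z := rfl
      rw [h2] at this
      rw [this]
      simp
      ring
    simp only [h1]
    have h2 := fderiv_sq_le ψ z (e p) (he p (htK p hp))
    set d := fderiv ℝ ψ z (e p)
    set S := ∑ i, partialDeriv i ψ z ^ 2
    have h3 := hB p hp z
    have hB0 : 0 ≤ B p := (abs_nonneg _).trans h3.1
    have h4 : 2 * ψ z * d * χ p z ≤ (ψ z ^ 2 + d ^ 2) * B p := by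
      calc 2 * ψ z * d * χ p z ≤ |2 * ψ z * d * χ p z| := le_abs_self _
        _ = |2 * ψ z * d| * |χ p z| := abs_mul _ _
        _ ≤ (ψ z ^ 2 + d ^ 2) * B p := by
          refine mul_le_mul (abs_le.2 ⟨?_, ?_⟩) h3.1 (abs_nonneg _) (by positivity)
          · nlinarith [sq_nonneg (ψ z + d)]
          · nlinarith [sq_nonneg (ψ z - d)]
    have h5 : ψ z ^ 2 * fderiv ℝ (χ p) z (e p) ≤ ψ z ^ 2 * B p :=
      mul_le_mul_of_nonneg_left ((le_abs_self _).trans h3.2) (sq_nonneg _)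
    have h6 : d ^ 2 * B p ≤ S * B p := mul_le_mul_of_nonneg_right h2 hB0
    have h7 : 0 ≤ S * B p := mul_nonneg (Finset.sum_nonneg fun i _ => sq_nonneg _) hB0
    nlinarith
  have hmain : c * ∫ z, ψ z ^ 2 ∂(surfaceMeasure Ω) ≤
      (∑ p ∈ t, 2 * B p) * ∫ z in Ω, (ψ z ^ 2 + ∑ i, partialDeriv i ψ z ^ 2) := by
    rw [Finset.sum_mul, ← integral_const_mul]
    refine le_trans ?_ (Finset.sum_le_sum hdiv)
    rw [← integral_finsetSum _ hterm]
    refine integral_mono_ae ((hσ (hψ.continuous.pow 2)).const_mul c)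
      (integrable_finsetSum _ hterm) ?_
    refine (ae_restrict_iff' isClosed_frontier.measurableSet).2
      (Eventually.of_forall fun z hz => ?_)
    have h1 := mul_le_mul_of_nonneg_right (hc z hz) (sq_nonneg (ψ z))
    refine h1.trans_eq ?_
    rw [Finset.sum_mul]
    exact Finset.sum_congr rfl fun p _ => by ring
  have hsplit : ∫ z in Ω, (ψ z ^ 2 + ∑ i, partialDeriv i ψ z ^ 2) =
      (∫ z in Ω, ψ z ^ 2) + ∑ i, ∫ z in Ω, partialDeriv i ψ z ^ 2 := by
    have hψ2 : IntegrableOn (fun z => ψ z ^ 2) Ω := hi0 (hψ.continuous.pow 2)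
    rw [integral_add hψ2, integral_finsetSum]
    · exact fun i _ => hi0 ((contDiff_partialDeriv hψ i).continuous.pow 2)
    · exact hi0 (continuous_finsetSum _ fun i _ => (contDiff_partialDeriv hψ i).continuous.pow 2)
  rw [hsplit] at hmain
  rw [div_mul_eq_mul_div, le_div_iff₀ hc0]
  linarith

/-- Every function in `W^{1,2}(Ω)` has a trace in `L²(∂Ω)`. -/
theorem exists_isTrace [DecidableEq ι] (hΩ : IsOpen Ω) (hΩb : Bornology.IsBounded Ω)
    (hC : IsOfClassC1 Ω) {f : EuclideanSpace ℝ ι → ℝ} (hf : MemW12 Ω f) :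
    ∃ g, IsTrace Ω f g := by
  obtain ⟨D, hw⟩ := hf
  obtain ⟨ψ, hψ, hψf, hψD⟩ := exists_smooth_approx hΩ hΩb hC hw
  obtain ⟨C, hCψ⟩ := exists_trace_inequality hΩ hΩb hC
  have hσ : ∀ n, MemLp (ψ n) 2 (surfaceMeasure Ω) := fun n =>
    memLp_surfaceMeasure_of_continuous hΩ hΩb hC (hψ n).continuous
  have h0 : ∀ n, MemLp (ψ n) 2 (volume.restrict Ω) := fun n =>
    memL2_of_continuous hΩ hΩb (hψ n).continuous
  have h1 : ∀ i n, MemLp (partialDeriv i (ψ n)) 2 (volume.restrict Ω) := fun i n =>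
    memL2_of_continuous hΩ hΩb (contDiff_partialDeriv (hψ n) i).continuous
  have hc0 := ((tendsto_eLpNorm_of_sub_tendsto_zero h0 hw.1).1 hψf).cauchySeq
  have hc1 := fun i =>
    ((tendsto_eLpNorm_of_sub_tendsto_zero (h1 i) (hw.2.1 i)).1 (hψD i)).cauchySeq
  have hcauchy : CauchySeq fun n => (hσ n).toLp (ψ n) := by
    rw [cauchySeq_iff_tendsto_dist_atTop_0]
    have hle : ∀ q : ℕ × ℕ, dist ((hσ q.1).toLp (ψ q.1)) ((hσ q.2).toLp (ψ q.2)) ^ 2 ≤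
        C * (dist ((h0 q.1).toLp (ψ q.1)) ((h0 q.2).toLp (ψ q.2)) ^ 2 +
          ∑ i, dist ((h1 i q.1).toLp (partialDeriv i (ψ q.1)))
            ((h1 i q.2).toLp (partialDeriv i (ψ q.2))) ^ 2) := by
      intro q
      simp only [dist_toLp_sq]
      refine (hCψ (fun z => ψ q.1 z - ψ q.2 z) ((hψ q.1).sub (hψ q.2))).trans_eq ?_
      congr 2
      refine Finset.sum_congr rfl fun i _ => integral_congr_ae (Eventually.of_forall fun z => ?_)
      simp only [partialDeriv]
      rw [fderiv_fun_sub ((hψ q.1).differentiable (by simp) z)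
        ((hψ q.2).differentiable (by simp) z)]
      rfl
    have hlim : Tendsto (fun q : ℕ × ℕ =>
        C * (dist ((h0 q.1).toLp (ψ q.1)) ((h0 q.2).toLp (ψ q.2)) ^ 2 +
          ∑ i, dist ((h1 i q.1).toLp (partialDeriv i (ψ q.1)))
            ((h1 i q.2).toLp (partialDeriv i (ψ q.2))) ^ 2)) atTop (𝓝 0) := by
      have t0 := (cauchySeq_iff_tendsto_dist_atTop_0.1 hc0).pow 2
      have t1 := tendsto_finsetSum Finset.univ fun i _ =>
        (cauchySeq_iff_tendsto_dist_atTop_0.1 (hc1 i)).pow 2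
      simpa using (t0.add t1).const_mul C
    have hsq := squeeze_zero (fun _ => sq_nonneg _) hle hlim
    simpa using hsq.sqrt
  obtain ⟨T, hT⟩ := cauchySeq_tendsto_of_complete hcauchy
  refine ⟨T, Lp.memLp T, D, hw, ψ, hψ, hψf, hψD, ?_⟩
  rw [tendsto_eLpNorm_of_sub_tendsto_zero hσ (Lp.memLp T), Lp.toLp_coeFn]
  exact hT

end Traces

/-! ### Green's formula and weak derivatives -/

section Green

variable {α : Type*} [MeasurableSpace α] {μ : Measure α}

theorem integrable_bdd_mul_mul {a F G : α → ℝ} {C : ℝ} (ha : AEStronglyMeasurable a μ)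
    (hC : ∀ᵐ z ∂μ, ‖a z‖ ≤ C) (hF : MemLp F 2 μ) (hG : MemLp G 2 μ) :
    Integrable (fun z => a z * (F z * G z)) μ :=
  (hF.integrable_mul hG).bdd_mul ha hC

theorem tendsto_integral_bdd_mul_mul {a : α → ℝ} {f g : ℕ → α → ℝ} {F G : α → ℝ} {C : ℝ}
    (ha : AEStronglyMeasurable a μ) (hC : ∀ᵐ z ∂μ, ‖a z‖ ≤ C)
    (hf : ∀ n, MemLp (f n) 2 μ) (hF : MemLp F 2 μ) (hg : ∀ n, MemLp (g n) 2 μ) (hG : MemLp G 2 μ)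
    (hfF : Tendsto (fun n => eLpNorm (f n - F) 2 μ) atTop (𝓝 0))
    (hgG : Tendsto (fun n => eLpNorm (g n - G) 2 μ) atTop (𝓝 0)) :
    Tendsto (fun n => ∫ z, a z * (f n z * g n z) ∂μ) atTop (𝓝 (∫ z, a z * (F z * G z) ∂μ)) := by
  have := tendsto_integral_mul_of_tendsto_eLpNorm (fun n => memLp_bdd_mul ha hC (hf n))
    (memLp_bdd_mul ha hC hF) hg hG (tendsto_eLpNorm_bdd_mul hC hfF) hgG
  simpa only [mul_assoc] using this

variable {ι : Type*} [Fintype ι] [DecidableEq ι] {Ω : Set (EuclideanSpace ℝ ι)}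

omit [DecidableEq ι] in
theorem IsTestFunction.memL2 {φ : EuclideanSpace ℝ ι → ℝ} (hφ : IsTestFunction Ω φ) :
    MemL2 Ω φ := (hφ.1.continuous.memLp_of_hasCompactSupport hφ.2.1).restrict Ω

theorem IsTestFunction.partialDeriv {φ : EuclideanSpace ℝ ι → ℝ} (hφ : IsTestFunction Ω φ)
    (i : ι) : IsTestFunction Ω (partialDeriv i φ) :=
  ⟨contDiff_partialDeriv hφ.1 i, hasCompactSupport_partialDeriv hφ.2.1 i,
    (tsupport_fderiv_apply_subset ℝ _).trans hφ.2.2⟩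

omit [DecidableEq ι] in
theorem IsTestFunction.mul_left {a φ : EuclideanSpace ℝ ι → ℝ} (hφ : IsTestFunction Ω φ)
    (ha : ContDiff ℝ ∞ a) : IsTestFunction Ω fun z => a z * φ z :=
  ⟨ha.mul hφ.1, hφ.2.1.mul_left, tsupport_mul_subset_right.trans hφ.2.2⟩

omit [DecidableEq ι] in
theorem IsTestFunction.eq_zero {φ : EuclideanSpace ℝ ι → ℝ} (hφ : IsTestFunction Ω φ)
    {z : EuclideanSpace ℝ ι} (hz : z ∉ Ω) : φ z = 0 :=
  image_eq_zero_of_notMem_tsupport fun h => hz (hφ.2.2 h)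

theorem IsTestFunction.integral_partialDeriv {φ : EuclideanSpace ℝ ι → ℝ}
    (hφ : IsTestFunction Ω φ) (i : ι) : ∫ z in Ω, Grushin.partialDeriv i φ z = 0 := by
  rw [setIntegral_eq_integral_of_forall_compl_eq_zero fun z hz => (hφ.partialDeriv i).eq_zero hz]
  exact integral_fderiv_eq_zero volume (hφ.1.of_le (by exact_mod_cast le_top)) hφ.2.1 _

omit [DecidableEq ι] in
theorem ae_eq_of_forall_integral_testFunction (hΩ : IsOpen Ω) {f g : EuclideanSpace ℝ ι → ℝ}
    (hf : MemL2 Ω f) (hg : MemL2 Ω g)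
    (h : ∀ φ, IsTestFunction Ω φ → ∫ z in Ω, f z * φ z = ∫ z in Ω, g z * φ z) :
    f =ᵐ[volume.restrict Ω] g := by
  have hloc : LocallyIntegrableOn (f - g) Ω volume :=
    locallyIntegrableOn_of_locallyIntegrable_restrict
      ((hf.sub hg).locallyIntegrable (by norm_num))
  have := hΩ.ae_eq_zero_of_integral_contDiff_smul_eq_zero hloc fun φ h1 h2 h3 => by
    have hφ : IsTestFunction Ω φ := ⟨h1, h2, h3⟩
    rw [← setIntegral_eq_integral_of_forall_compl_eq_zero (s := Ω)
      fun z hz => by rw [hφ.eq_zero hz, zero_smul]]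
    have h4 := h φ hφ
    rw [← sub_eq_zero, ← integral_sub (integrableOn_mul_of_memL2 hf h1.continuous h2)
      (integrableOn_mul_of_memL2 hg h1.continuous h2)] at h4
    rw [← h4]
    refine integral_congr_ae (Eventually.of_forall fun z => ?_)
    simp only [Pi.sub_apply, smul_eq_mul]
    ring
  refine (ae_restrict_iff' hΩ.measurableSet).2 ?_
  filter_upwards [this] with z hz hzΩ
  exact sub_eq_zero.1 (hz hzΩ)

theorem IsWeakGrad.ae_eq (hΩ : IsOpen Ω) {u : EuclideanSpace ℝ ι → ℝ}
    {D D' : ι → EuclideanSpace ℝ ι → ℝ} (h : IsWeakGrad Ω u D) (h' : IsWeakGrad Ω u D') (i : ι) :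
    D i =ᵐ[volume.restrict Ω] D' i :=
  ae_eq_of_forall_integral_testFunction hΩ (h.2.1 i) (h'.2.1 i) fun φ hφ => by
    rw [← neg_inj, ← h.2.2 i φ hφ, h'.2.2 i φ hφ]

omit [DecidableEq ι] in
theorem TendstoL2.congr_right {f : ℕ → EuclideanSpace ℝ ι → ℝ} {u v : EuclideanSpace ℝ ι → ℝ}
    (h : TendstoL2 Ω f u) (huv : u =ᵐ[volume.restrict Ω] v) : TendstoL2 Ω f v := by
  refine Tendsto.congr (fun n => eLpNorm_congr_ae ?_) h
  filter_upwards [huv] with z hz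
  simp [hz]

/-- The trace of a function and its approximating sequence, for a prescribed representative of the
weak gradient. -/
theorem IsTrace.exists_approx (hΩ : IsOpen Ω) {f g : EuclideanSpace ℝ ι → ℝ}
    {D : ι → EuclideanSpace ℝ ι → ℝ} (h : IsTrace Ω f g) (hD : IsWeakGrad Ω f D) :
    ∃ ψ : ℕ → EuclideanSpace ℝ ι → ℝ, (∀ n, ContDiff ℝ ∞ (ψ n)) ∧ TendstoL2 Ω ψ f ∧
      (∀ i, TendstoL2 Ω (fun n => partialDeriv i (ψ n)) (D i)) ∧
        Tendsto (fun n => eLpNorm (ψ n - g) 2 (surfaceMeasure Ω)) atTop (𝓝 0) := by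
  obtain ⟨_, D', hD', ψ, h1, h2, h3, h4⟩ := h
  exact ⟨ψ, h1, h2, fun i => (h3 i).congr_right (hD'.ae_eq hΩ hD i), h4⟩

theorem MemW120.exists_approx (hΩ : IsOpen Ω) {u : EuclideanSpace ℝ ι → ℝ}
    {D : ι → EuclideanSpace ℝ ι → ℝ} (h : MemW120 Ω u) (hD : IsWeakGrad Ω u D) :
    ∃ φ : ℕ → EuclideanSpace ℝ ι → ℝ, (∀ n, IsTestFunction Ω (φ n)) ∧ TendstoL2 Ω φ u ∧
      ∀ i, TendstoL2 Ω (fun n => partialDeriv i (φ n)) (D i) := by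
  obtain ⟨D', hD', φ, h1, h2, h3⟩ := h
  exact ⟨φ, h1, h2, fun i => (h3 i).congr_right (hD'.ae_eq hΩ hD i)⟩

omit [DecidableEq ι] in
/-- A continuous coefficient times a component of the outer normal is bounded on the boundary. -/
theorem exists_bound_mul_outerNormal (hΩ : IsOpen Ω) (hΩb : Bornology.IsBounded Ω)
    (hC : IsOfClassC1 Ω) {a : EuclideanSpace ℝ ι → ℝ} (ha : Continuous a) (i : ι) :
    AEStronglyMeasurable (fun z => a z * outerNormal Ω z i) (surfaceMeasure Ω) ∧
      ∃ C, ∀ᵐ z ∂(surfaceMeasure Ω), ‖a z * outerNormal Ω z i‖ ≤ C := by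
  obtain ⟨C, _, hCb⟩ := exists_ae_bound_of_continuous hΩ hΩb ha
  refine ⟨ha.aestronglyMeasurable.mul
    ((EuclideanSpace.proj (𝕜 := ℝ) i).continuous.comp_aestronglyMeasurable
      (aestronglyMeasurable_outerNormal hΩ hC)), C, ?_⟩
  filter_upwards [hCb, ae_norm_outerNormal hΩ hC] with z h1 h2
  have h3 : ‖outerNormal Ω z i‖ ≤ 1 := h2 ▸ PiLp.norm_apply_le _ i
  rw [norm_mul]
  nlinarith [norm_nonneg (a z), norm_nonneg (outerNormal Ω z i)]

/-- Green's formula for a smooth coefficient times the product of two Sobolev functions. -/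
theorem IsTrace.green (hΩ : IsOpen Ω) (hΩb : Bornology.IsBounded Ω) (hC : IsOfClassC1 Ω)
    {f g Tf Tg a : EuclideanSpace ℝ ι → ℝ} {D D' : ι → EuclideanSpace ℝ ι → ℝ}
    (hf : IsTrace Ω f Tf) (hg : IsTrace Ω g Tg) (hD : IsWeakGrad Ω f D) (hD' : IsWeakGrad Ω g D')
    (ha : ContDiff ℝ ∞ a) (i : ι) :
    Integrable (fun z => partialDeriv i a z * (f z * g z) + a z * (D i z * g z) +
        a z * (f z * D' i z)) (volume.restrict Ω) ∧
    Integrable (fun z => (a z * outerNormal Ω z i) * (Tf z * Tg z)) (surfaceMeasure Ω) ∧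
    ∫ z in Ω, (partialDeriv i a z * (f z * g z) + a z * (D i z * g z) + a z * (f z * D' i z)) =
      ∫ z, (a z * outerNormal Ω z i) * (Tf z * Tg z) ∂(surfaceMeasure Ω) := by
  obtain ⟨ψ, hψ, hψf, hψD, hψT⟩ := hf.exists_approx hΩ hD
  obtain ⟨φ, hφ, hφg, hφD, hφT⟩ := hg.exists_approx hΩ hD'
  have ha' := contDiff_partialDeriv ha i
  obtain ⟨C1, hC1, _⟩ := exists_ae_bound_of_continuous hΩ hΩb ha.continuous
  obtain ⟨C2, hC2, _⟩ := exists_ae_bound_of_continuous hΩ hΩb ha'.continuous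
  obtain ⟨hm3, C3, hC3⟩ := exists_bound_mul_outerNormal hΩ hΩb hC ha.continuous i
  have hm1 : AEStronglyMeasurable a (volume.restrict Ω) := ha.continuous.aestronglyMeasurable
  have hm2 : AEStronglyMeasurable (partialDeriv i a) (volume.restrict Ω) :=
    ha'.continuous.aestronglyMeasurable
  have m1 : ∀ n, MemL2 Ω (ψ n) := fun n => memL2_of_continuous hΩ hΩb (hψ n).continuous
  have m2 : ∀ n, MemL2 Ω (φ n) := fun n => memL2_of_continuous hΩ hΩb (hφ n).continuous
  have m3 : ∀ n, MemL2 Ω (partialDeriv i (ψ n)) := fun n =>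
    memL2_of_continuous hΩ hΩb (contDiff_partialDeriv (hψ n) i).continuous
  have m4 : ∀ n, MemL2 Ω (partialDeriv i (φ n)) := fun n =>
    memL2_of_continuous hΩ hΩb (contDiff_partialDeriv (hφ n) i).continuous
  have i1 := fun {F G : EuclideanSpace ℝ ι → ℝ} (hF : MemL2 Ω F) (hG : MemL2 Ω G) =>
    integrable_bdd_mul_mul hm1 hC1 hF hG
  have i2 := fun {F G : EuclideanSpace ℝ ι → ℝ} (hF : MemL2 Ω F) (hG : MemL2 Ω G) =>
    integrable_bdd_mul_mul hm2 hC2 hF hG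
  refine ⟨((i2 hD.1 hD'.1).add (i1 (hD.2.1 i) hD'.1)).add (i1 hD.1 (hD'.2.1 i)),
    integrable_bdd_mul_mul hm3 hC3 hf.1 hg.1, ?_⟩
  have hsplit : ∀ {f g F G : EuclideanSpace ℝ ι → ℝ}, MemL2 Ω f → MemL2 Ω g → MemL2 Ω F →
      MemL2 Ω G → ∫ z in Ω, (partialDeriv i a z * (f z * g z) + a z * (F z * g z) +
        a z * (f z * G z)) = (∫ z in Ω, partialDeriv i a z * (f z * g z)) +
        (∫ z in Ω, a z * (F z * g z)) + ∫ z in Ω, a z * (f z * G z) := by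
    intro f g F G hf hg hF hG
    have i3 : Integrable (fun z => partialDeriv i a z * (f z * g z) + a z * (F z * g z))
      (volume.restrict Ω) := (i2 hf hg).add (i1 hF hg)
    rw [integral_add i3 (i1 hf hG), integral_add (i2 hf hg) (i1 hF hg)]
  have hn : ∀ n, (∫ z in Ω, partialDeriv i a z * (ψ n z * φ n z)) +
      (∫ z in Ω, a z * (partialDeriv i (ψ n) z * φ n z)) +
        (∫ z in Ω, a z * (ψ n z * partialDeriv i (φ n) z)) =
      ∫ z, (a z * outerNormal Ω z i) * (ψ n z * φ n z) ∂(surfaceMeasure Ω) := by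
    intro n
    have hd : ContDiff ℝ 1 fun z => a z * (ψ n z * φ n z) :=
      (ha.mul ((hψ n).mul (hφ n))).of_le (by exact_mod_cast le_top)
    have h1 := integral_fderiv_eq_boundary hΩ hΩb hC hd (EuclideanSpace.single i 1)
    rw [← hsplit (m1 n) (m2 n) (m3 n) (m4 n)]
    refine Eq.trans (integral_congr_ae (Eventually.of_forall fun z => ?_))
      (h1.trans (integral_congr_ae (Eventually.of_forall fun z => ?_)))
    · have h2 := partialDeriv_mul (i := i) (ha.differentiable (by simp) z)
        (((hψ n).mul (hφ n)).differentiable (by simp) z)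
      have h3 := partialDeriv_mul (i := i) ((hψ n).differentiable (by simp) z)
        ((hφ n).differentiable (by simp) z)
      rw [h3] at h2
      change _ = partialDeriv i (fun z => a z * (ψ n z * φ n z)) z
      rw [h2]
      ring
    · simp only [EuclideanSpace.inner_single_right]
      simp
      ring
  have t1 := tendsto_integral_bdd_mul_mul hm2 hC2 m1 hD.1 m2 hD'.1 hψf hφg
  have t2 := tendsto_integral_bdd_mul_mul hm1 hC1 m3 (hD.2.1 i) m2 hD'.1 (hψD i) hφg
  have t3 := tendsto_integral_bdd_mul_mul hm1 hC1 m1 hD.1 m4 (hD'.2.1 i) hψf (hφD i)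
  have t4 := tendsto_integral_bdd_mul_mul hm3 hC3
    (fun n => memLp_surfaceMeasure_of_continuous hΩ hΩb hC (hψ n).continuous) hf.1
    (fun n => memLp_surfaceMeasure_of_continuous hΩ hΩb hC (hφ n).continuous) hg.1 hψT hφT
  rw [hsplit hD.1 hD'.1 (hD.2.1 i) (hD'.2.1 i)]
  refine tendsto_nhds_unique ((t1.add t2).add t3) ?_
  simpa only [hn] using t4

theorem isWeakGrad_one (hΩ : IsOpen Ω) (hΩb : Bornology.IsBounded Ω) :
    IsWeakGrad Ω (fun _ => 1) fun _ _ => 0 := by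
  refine ⟨memL2_of_continuous hΩ hΩb continuous_const, fun i =>
    memL2_of_continuous hΩ hΩb continuous_const, fun i φ hφ => ?_⟩
  simpa using hφ.integral_partialDeriv i

theorem isTrace_one (hΩ : IsOpen Ω) (hΩb : Bornology.IsBounded Ω) (hC : IsOfClassC1 Ω) :
    IsTrace Ω (fun _ => 1) fun _ => 1 := by
  have h0 : ∀ i : ι, partialDeriv i (fun _ : EuclideanSpace ℝ ι => (1 : ℝ)) = fun _ => 0 := by
    intro i
    ext z
    simp [partialDeriv]
  refine ⟨memLp_surfaceMeasure_of_continuous hΩ hΩb hC continuous_const, _, isWeakGrad_one hΩ hΩb,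
    fun _ _ => 1, fun _ => contDiff_const, ?_, fun i => ?_, ?_⟩ <;> simp [TendstoL2, h0]

theorem partialDeriv_comm {θ : EuclideanSpace ℝ ι → ℝ} (hθ : ContDiff ℝ ∞ θ) (i j : ι)
    (z : EuclideanSpace ℝ ι) :
    partialDeriv i (partialDeriv j θ) z = partialDeriv j (partialDeriv i θ) z := by
  have hd : DifferentiableAt ℝ (fderiv ℝ θ) z :=
    (contDiff_infty_iff_fderiv.1 hθ).2.differentiable (by simp) z
  have key : ∀ v w, fderiv ℝ (fun y => fderiv ℝ θ y v) z w = fderiv ℝ (fderiv ℝ θ) z w v := by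
    intro v w
    rw [fderiv_clm_apply hd (differentiableAt_const v)]
    simp
  have hsymm : IsSymmSndFDerivAt ℝ θ z :=
    (contDiff_infty.1 hθ 2).contDiffAt.isSymmSndFDerivAt (by simp)
  unfold partialDeriv
  rw [key, key]
  exact hsymm _ _

/-- The trace of the gradient of a function that vanishes on the boundary is normal: its
tangential components integrate to zero against all smooth functions. -/
theorem trace_gradient_normal (hΩ : IsOpen Ω) (hΩb : Bornology.IsBounded Ω) (hC : IsOfClassC1 Ω)
    {u : EuclideanSpace ℝ ι → ℝ} {D T : ι → EuclideanSpace ℝ ι → ℝ} (hu : MemW120 Ω u)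
    (hD : IsWeakGrad Ω u D) (hT : ∀ i, IsTrace Ω (D i) (T i))
    {E : ι → ι → EuclideanSpace ℝ ι → ℝ} (hE : ∀ i, IsWeakGrad Ω (D i) (E i))
    (hsymm : ∀ i j, E i j =ᵐ[volume.restrict Ω] E j i) (i j : ι) :
    ∀ᵐ z ∂(surfaceMeasure Ω), T i z * outerNormal Ω z j = T j z * outerNormal Ω z i := by
  obtain ⟨φ, hφ, hφu, hφD⟩ := hu.exists_approx hΩ hD
  have hone := isTrace_one hΩ hΩb hC
  have honeD := isWeakGrad_one hΩ hΩb
  have hfin := surfaceMeasure_lt_top hΩ hΩb hC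
  have hint : ∀ i j, Integrable (fun z => T i z * outerNormal Ω z j) (surfaceMeasure Ω) := by
    intro i j
    have := ((hT i).green hΩ hΩb hC hone (hE i) honeD (a := fun _ => 1) contDiff_const j).2.1
    refine this.congr (Eventually.of_forall fun z => ?_)
    simp [mul_comm]
  have hgreen : ∀ i j, ∀ θ : EuclideanSpace ℝ ι → ℝ, ContDiff ℝ ∞ θ →
      ∫ z, θ z * (T i z * outerNormal Ω z j) ∂(surfaceMeasure Ω) =
        (∫ z in Ω, partialDeriv j θ z * (D i z * 1)) + ∫ z in Ω, θ z * (E i j z * 1) := by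
    intro i j θ hθ
    have h1 := ((hT i).green hΩ hΩb hC hone (hE i) honeD hθ j).2.2
    obtain ⟨C1, hC1, _⟩ := exists_ae_bound_of_continuous hΩ hΩb hθ.continuous
    obtain ⟨C2, hC2, _⟩ := exists_ae_bound_of_continuous hΩ hΩb
      (contDiff_partialDeriv hθ j).continuous
    rw [← integral_add]
    · refine Eq.trans (integral_congr_ae (Eventually.of_forall fun z => ?_))
        (h1.symm.trans (integral_congr_ae (Eventually.of_forall fun z => ?_)))
      · simp only; ring
      · simp
    · exact integrable_bdd_mul_mul (contDiff_partialDeriv hθ j).continuous.aestronglyMeasurable hC2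
        (hD.2.1 i) honeD.1
    · exact integrable_bdd_mul_mul hθ.continuous.aestronglyMeasurable hC1 ((hE i).2.1 j) honeD.1
  have hzero : ∀ θ : EuclideanSpace ℝ ι → ℝ, ContDiff ℝ ∞ θ →
      (∫ z in Ω, partialDeriv j θ z * (D i z * 1)) =
        ∫ z in Ω, partialDeriv i θ z * (D j z * 1) := by
    intro θ hθ
    have hlim : ∀ i j, Tendsto (fun n => ∫ z in Ω, partialDeriv j θ z *
        (partialDeriv i (φ n) z * 1)) atTop (𝓝 (∫ z in Ω, partialDeriv j θ z * (D i z * 1))) := by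
      intro i j
      obtain ⟨C2, hC2, _⟩ := exists_ae_bound_of_continuous hΩ hΩb
        (contDiff_partialDeriv hθ j).continuous
      exact tendsto_integral_bdd_mul_mul
        (contDiff_partialDeriv hθ j).continuous.aestronglyMeasurable hC2
        (fun n => ((hφ n).partialDeriv i).memL2) (hD.2.1 i) (g := fun _ _ => 1)
        (fun _ => honeD.1) honeD.1 (hφD i) (by simp)
    refine tendsto_nhds_unique (hlim i j) ((hlim j i).congr fun n => ?_)
    have hparts : ∀ i j, (∫ z in Ω, partialDeriv j θ z * (partialDeriv i (φ n) z * 1)) =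
        -∫ z in Ω, partialDeriv i (partialDeriv j θ) z * φ n z := by
      intro i j
      have h1 := ((hφ n).mul_left (contDiff_partialDeriv hθ j)).integral_partialDeriv i
      have h2 : ∀ z, partialDeriv i (fun z => partialDeriv j θ z * φ n z) z =
          partialDeriv i (partialDeriv j θ) z * φ n z +
            partialDeriv j θ z * (partialDeriv i (φ n) z * 1) := fun z => by
        rw [partialDeriv_mul ((contDiff_partialDeriv hθ j).differentiable (by simp) z)
          ((hφ n).1.differentiable (by simp) z), mul_one]
      simp only [h2] at h1
      rw [integral_add] at h1
      · linarith
      · have := (hφ n).mul_left (contDiff_partialDeriv (contDiff_partialDeriv hθ j) i)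
        exact (this.1.continuous.integrable_of_hasCompactSupport this.2.1).integrableOn
      · have := ((hφ n).partialDeriv i).mul_left (contDiff_partialDeriv hθ j)
        simp only [mul_one]
        exact (this.1.continuous.integrable_of_hasCompactSupport this.2.1).integrableOn
    rw [hparts i j, hparts j i]
    simp only [partialDeriv_comm hθ i j]
  have hae := ae_eq_zero_of_integral_contDiff_smul_eq_zero (μ := surfaceMeasure Ω)
    ((hint i j).sub (hint j i)).locallyIntegrable fun θ hθ hθc => by
      have hb : ∀ i j, Integrable (fun z => θ z * (T i z * outerNormal Ω z j))
          (surfaceMeasure Ω) := fun i j => by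
        obtain ⟨C1, _, hC1⟩ := exists_ae_bound_of_continuous hΩ hΩb hθ.continuous
        exact (hint i j).bdd_mul hθ.continuous.aestronglyMeasurable hC1
      simp only [smul_eq_mul, Pi.sub_apply, mul_sub]
      rw [integral_sub (hb i j) (hb j i), hgreen i j θ hθ, hgreen j i θ hθ, hzero θ hθ,
        add_sub_add_left_eq_sub, sub_eq_zero]
      refine integral_congr_ae ?_
      filter_upwards [hsymm i j] with z hz
      rw [hz]
  filter_upwards [hae] with z hz
  exact sub_eq_zero.1 hz

/-- Second weak derivatives commute. -/
theorem IsWeakGrad.symm_second (hΩ : IsOpen Ω) {u : EuclideanSpace ℝ ι → ℝ}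
    {D : ι → EuclideanSpace ℝ ι → ℝ} (hD : IsWeakGrad Ω u D)
    {E : ι → ι → EuclideanSpace ℝ ι → ℝ} (hE : ∀ i, IsWeakGrad Ω (D i) (E i)) (i j : ι) :
    E i j =ᵐ[volume.restrict Ω] E j i :=
  ae_eq_of_forall_integral_testFunction hΩ ((hE i).2.1 j) ((hE j).2.1 i) fun φ hφ => by
    have h1 := (hE i).2.2 j φ hφ
    have h2 := (hE j).2.2 i φ hφ
    have h3 := hD.2.2 i _ (hφ.partialDeriv j)
    have h4 := hD.2.2 j _ (hφ.partialDeriv i)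
    simp only [partialDeriv_comm hφ.1 i j] at h3
    linarith

end Green

/-! ### The Rellich–Pohozaev identity for diagonal operators -/

section Pohozaev

/-- The pointwise identity behind the Rellich–Pohozaev formula. Here `x`, `c`, `a`, `b i j`, `d` and
`e j i` stand for the components of the dilation field, its exponents, the coefficients of the
operator, the derivatives `∂ᵢ a j`, the gradient and the Hessian. -/
theorem sum_rellich_identity {ι : Type*} [Fintype ι] [DecidableEq ι] {x c a d : ι → ℝ}
    {b e : ι → ι → ℝ} {l : ℝ} (he : ∀ i j, e i j = e j i)
    (hb : ∀ j, ∑ i, x i * b i j = 2 * (c j - 1) * a j) (hl : ∑ i, a i * e i i = l) :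
    ∑ i, ∑ j, (((if i = j then c j else 0) * a i * (d j * d i) + x j * a i * (e j i * d i) +
      x j * a i * (d j * e i i)) - 1 / 2 * ((c i * a j + x i * b i j) * (d j * d j) +
      x i * a j * (e j i * d j) + x i * a j * (d j * e j i))) =
      (1 - 1 / 2 * ∑ i, c i) * ∑ i, a i * (d i * d i) + (∑ j, x j * d j) * l := by
  have h1 : ∑ i, ∑ j, (if i = j then c j else 0) * a i * (d j * d i) =
      ∑ i, c i * (a i * (d i * d i)) := by
    refine Finset.sum_congr rfl fun i _ => ?_
    rw [Finset.sum_eq_single i]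
    · simp only [if_true]; ring
    · intro j _ hj
      simp [Ne.symm hj]
    · simp
  have h2 : ∑ i, ∑ j, x j * a i * (e j i * d i) = ∑ i, ∑ j, x i * a j * (e j i * d j) := by
    rw [Finset.sum_comm]
    exact Finset.sum_congr rfl fun i _ => Finset.sum_congr rfl fun j _ => by rw [he i j]
  have h3 : ∑ i, ∑ j, x j * a i * (d j * e i i) = (∑ j, x j * d j) * l := by
    rw [← hl, Finset.sum_mul_sum, Finset.sum_comm]
    exact Finset.sum_congr rfl fun i _ => Finset.sum_congr rfl fun j _ => by ring
  have h4 : ∑ i, ∑ j, c i * a j * (d j * d j) = (∑ i, c i) * ∑ i, a i * (d i * d i) := by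
    rw [Finset.sum_mul_sum]
    exact Finset.sum_congr rfl fun i _ => Finset.sum_congr rfl fun j _ => by ring
  have h5 : ∑ i, ∑ j, x i * b i j * (d j * d j) =
      2 * ∑ j, c j * (a j * (d j * d j)) - 2 * ∑ j, a j * (d j * d j) := by
    rw [Finset.sum_comm, Finset.mul_sum, Finset.mul_sum, ← Finset.sum_sub_distrib]
    refine Finset.sum_congr rfl fun j _ => ?_
    rw [← Finset.sum_mul, hb]
    ring
  have h6 : ∑ i, ∑ j, x i * a j * (d j * e j i) = ∑ i, ∑ j, x i * a j * (e j i * d j) :=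
    Finset.sum_congr rfl fun i _ => Finset.sum_congr rfl fun j _ => by ring
  simp only [add_mul, mul_add, Finset.sum_add_distrib, Finset.sum_sub_distrib, ← Finset.mul_sum,
    h1, h2, h3, h4, h5, h6]
  ring

/-- If `F i j` and `G i j` have equal integrals, then so have linear combinations of them. -/
theorem integral_sum_sum_sub {α β ι : Type*} [Fintype ι] [MeasurableSpace α] [MeasurableSpace β]
    {μ : Measure α} {ν : Measure β} {F F' : ι → ι → α → ℝ} {G G' : ι → ι → β → ℝ}
    (h : ∀ i j, Integrable (F i j) μ ∧ Integrable (G i j) ν ∧ ∫ z, F i j z ∂μ = ∫ z, G i j z ∂ν)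
    (h' : ∀ i j, Integrable (F' i j) μ ∧ Integrable (G' i j) ν ∧
      ∫ z, F' i j z ∂μ = ∫ z, G' i j z ∂ν) (r : ℝ) :
    Integrable (fun z => ∑ i, ∑ j, (G i j z - r * G' i j z)) ν ∧
      ∫ z, ∑ i, ∑ j, (F i j z - r * F' i j z) ∂μ =
        ∫ z, ∑ i, ∑ j, (G i j z - r * G' i j z) ∂ν := by
  have hF : ∀ i j, Integrable (fun z => F i j z - r * F' i j z) μ := fun i j =>
    (h i j).1.sub ((h' i j).1.const_mul r)
  have hG : ∀ i j, Integrable (fun z => G i j z - r * G' i j z) ν := fun i j =>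
    (h i j).2.1.sub ((h' i j).2.1.const_mul r)
  refine ⟨integrable_finsetSum _ fun i _ => integrable_finsetSum _ fun j _ => hG i j, ?_⟩
  rw [integral_finsetSum _ fun i _ => integrable_finsetSum _ fun j _ => hF i j,
    integral_finsetSum _ fun i _ => integrable_finsetSum _ fun j _ => hG i j]
  refine Finset.sum_congr rfl fun i _ => ?_
  rw [integral_finsetSum _ fun j _ => hF i j, integral_finsetSum _ fun j _ => hG i j]
  refine Finset.sum_congr rfl fun j _ => ?_
  rw [integral_sub (h i j).1 ((h' i j).1.const_mul r),
    integral_sub (h i j).2.1 ((h' i j).2.1.const_mul r), integral_const_mul, integral_const_mul,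
    (h i j).2.2, (h' i j).2.2]

variable {ι : Type*} [Fintype ι] [DecidableEq ι] {Ω : Set (EuclideanSpace ℝ ι)}

omit [DecidableEq ι] in
theorem contDiff_coord (j : ι) : ContDiff ℝ ∞ fun z : EuclideanSpace ℝ ι => z j :=
  (EuclideanSpace.proj (𝕜 := ℝ) j).contDiff

theorem partialDeriv_coord (i j : ι) (z : EuclideanSpace ℝ ι) :
    partialDeriv i (fun z : EuclideanSpace ℝ ι => z j) z = if i = j then 1 else 0 := by
  have : HasFDerivAt (fun z : EuclideanSpace ℝ ι => z j) (EuclideanSpace.proj (𝕜 := ℝ) j) z :=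
    (EuclideanSpace.proj (𝕜 := ℝ) j).hasFDerivAt
  rw [partialDeriv, this.fderiv]
  simp [eq_comm]

/-- For functions vanishing on the boundary, `∫ z_j (∂_j u) u = -(1/2) ∫ u²`. -/
theorem MemW120.integral_coord_mul (hΩ : IsOpen Ω) (hΩb : Bornology.IsBounded Ω)
    {u : EuclideanSpace ℝ ι → ℝ} {D : ι → EuclideanSpace ℝ ι → ℝ} (hu : MemW120 Ω u)
    (hD : IsWeakGrad Ω u D) (j : ι) :
    ∫ z in Ω, z j * (D j z * u z) = -(1 / 2) * ∫ z in Ω, u z * u z := by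
  obtain ⟨φ, hφ, hφu, hφD⟩ := hu.exists_approx hΩ hD
  obtain ⟨C, hC, _⟩ := exists_ae_bound_of_continuous hΩ hΩb (contDiff_coord j).continuous
  have t1 := tendsto_integral_bdd_mul_mul (contDiff_coord j).continuous.aestronglyMeasurable hC
    (fun n => ((hφ n).partialDeriv j).memL2) (hD.2.1 j) (fun n => (hφ n).memL2) hD.1 (hφD j) hφu
  have t2 := (tendsto_integral_mul_of_tendsto_eLpNorm (fun n => (hφ n).memL2) hD.1
    (fun n => (hφ n).memL2) hD.1 hφu hφu).const_mul (-(1 / 2))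
  refine tendsto_nhds_unique t1 (t2.congr fun n => ?_)
  have h1 := ((hφ n).mul_left ((contDiff_coord j).mul (hφ n).1)).integral_partialDeriv j
  have h2 : ∀ z, partialDeriv j (fun z => z j * φ n z * φ n z) z =
      φ n z * φ n z + 2 * (z j * (partialDeriv j (φ n) z * φ n z)) := fun z => by
    have hd := (hφ n).1.differentiable (by simp) z
    have hc := (contDiff_coord j).differentiable (by simp) z
    rw [partialDeriv_mul (a := fun z => z j * φ n z) (hc.mul hd) hd, partialDeriv_mul hc hd,
      partialDeriv_coord]
    simp only [if_true]
    ring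
  simp only [h2] at h1
  have i1 : IntegrableOn (fun z => φ n z * φ n z) Ω :=
    integrableOn_mul_of_memL2 (hφ n).memL2 (hφ n).1.continuous (hφ n).2.1
  have i2 : IntegrableOn (fun z => 2 * (z j * (partialDeriv j (φ n) z * φ n z))) Ω :=
    (integrable_bdd_mul_mul (contDiff_coord j).continuous.aestronglyMeasurable hC
      ((hφ n).partialDeriv j).memL2 (hφ n).memL2).const_mul 2
  rw [integral_add i1 i2, integral_const_mul] at h1
  linarith

/-- The Rellich–Pohozaev identity for the operator `∑ ∂ᵢ(aᵢ ∂ᵢ)`, whose coefficients satisfy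
`∂ᵢ aᵢ = 0` and are homogeneous with respect to the dilations generated by `(cᵢ zᵢ)`. Here `D` is
the gradient of `u`, `T` the trace of `D`, and `E` the Hessian of `u`. -/
theorem rellich_pohozaev (hΩ : IsOpen Ω) (hΩb : Bornology.IsBounded Ω) (hC : IsOfClassC1 Ω)
    {c : ι → ℝ} {a : ι → EuclideanSpace ℝ ι → ℝ} (ha : ∀ i, ContDiff ℝ ∞ (a i))
    (ha0 : ∀ i z, partialDeriv i (a i) z = 0)
    (hhom : ∀ j z, ∑ i, c i * z i * partialDeriv i (a j) z = 2 * (c j - 1) * a j z)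
    {u : EuclideanSpace ℝ ι → ℝ} {D T : ι → EuclideanSpace ℝ ι → ℝ} {ev : ℝ}
    (hu : MemW120 Ω u) (hD : IsWeakGrad Ω u D) (hT : ∀ i, IsTrace Ω (D i) (T i))
    {E : ι → ι → EuclideanSpace ℝ ι → ℝ} (hE : ∀ i, IsWeakGrad Ω (D i) (E i))
    (hnorm : ∫ z in Ω, u z * u z = 1)
    (hpde : ∀ᵐ z ∂(volume.restrict Ω), ∑ i, a i z * E i i z = -ev * u z)
    (henergy : ∫ z in Ω, ∑ i, a i z * (D i z * D i z) = ev) :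
    Integrable (fun z => (∑ i, T i z * outerNormal Ω z i) ^ 2 *
      (∑ i, a i z * outerNormal Ω z i ^ 2) * ∑ i, c i * z i * outerNormal Ω z i)
      (surfaceMeasure Ω) ∧
    ev = 1 / 2 * ∫ z, (∑ i, T i z * outerNormal Ω z i) ^ 2 *
      (∑ i, a i z * outerNormal Ω z i ^ 2) * (∑ i, c i * z i * outerNormal Ω z i)
      ∂(surfaceMeasure Ω) := by
  have hsymm := hD.symm_second hΩ hE
  have hx : ∀ j, ContDiff ℝ ∞ fun z : EuclideanSpace ℝ ι => c j * z j := fun j =>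
    contDiff_const.mul (contDiff_coord j)
  have hα : ∀ i j, ContDiff ℝ ∞ fun z : EuclideanSpace ℝ ι => c j * z j * a i z := fun i j =>
    (hx j).mul (ha i)
  have hαd : ∀ l i j z, partialDeriv l (fun z : EuclideanSpace ℝ ι => c j * z j * a i z) z =
      (if l = j then c j else 0) * a i z + c j * z j * partialDeriv l (a i) z := by
    intro l i j z
    rw [partialDeriv_mul ((hx j).differentiable (by simp) z) ((ha i).differentiable (by simp) z),
      partialDeriv_mul (differentiableAt_const _) ((contDiff_coord j).differentiable (by simp) z),
      partialDeriv_coord]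
    simp [partialDeriv]
  have g1 := fun i j => (hT j).green hΩ hΩb hC (hT i) (hE j) (hE i) (hα i j) i
  have g2 := fun i j => (hT j).green hΩ hΩb hC (hT j) (hE j) (hE j) (hα j i) i
  simp only [hαd, ha0, mul_zero, add_zero, if_true] at g1 g2
  -- the identity `∫_Ω div F = ∫_∂Ω F · n` for `F = (X·∇u) A∇u - (1/2) X (A∇u·∇u)`
  obtain ⟨hbint, hflux⟩ := integral_sum_sum_sub g1 g2 (1 / 2)
  -- on the boundary the trace of the gradient is a multiple of the normal
  have hbae : (fun z => ∑ i, ∑ j, (c j * z j * a i z * outerNormal Ω z i * (T j z * T i z) -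
        1 / 2 * (c i * z i * a j z * outerNormal Ω z i * (T j z * T j z))))
      =ᵐ[surfaceMeasure Ω] fun z => 1 / 2 * ((∑ i, T i z * outerNormal Ω z i) ^ 2 *
      (∑ i, a i z * outerNormal Ω z i ^ 2) * ∑ i, c i * z i * outerNormal Ω z i) := by
    have htan := fun i j => trace_gradient_normal hΩ hΩb hC hu hD hT hE hsymm i j
    filter_upwards [ae_all_iff.2 fun i => ae_all_iff.2 (htan i), ae_norm_outerNormal hΩ hC]
      with z h1 h2
    set n := outerNormal Ω z
    have hn : ∑ j, n j ^ 2 = 1 := by rw [← EuclideanSpace.real_norm_sq_eq, h2, one_pow]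
    set g := ∑ i, T i z * n i with hg
    have hTg : ∀ i, T i z = g * n i := fun i => by
      calc T i z = T i z * ∑ j, n j ^ 2 := by rw [hn, mul_one]
        _ = ∑ j, T i z * n j * n j := by
          rw [Finset.mul_sum]; exact Finset.sum_congr rfl fun j _ => by ring
        _ = ∑ j, T j z * n j * n i := Finset.sum_congr rfl fun j _ => by rw [h1 i j]; ring
        _ = g * n i := by rw [hg, Finset.sum_mul]
    simp only [hTg]
    have e1 : ∑ i, ∑ j, c j * z j * a i z * n i * (g * n j * (g * n i)) =
        g ^ 2 * ((∑ i, a i z * n i ^ 2) * ∑ j, c j * z j * n j) := by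
      rw [Finset.sum_mul_sum, Finset.mul_sum]
      refine Finset.sum_congr rfl fun i _ => ?_
      rw [Finset.mul_sum]
      exact Finset.sum_congr rfl fun j _ => by ring
    have e2 : ∑ i, ∑ j, c i * z i * a j z * n i * (g * n j * (g * n j)) =
        g ^ 2 * ((∑ i, a i z * n i ^ 2) * ∑ j, c j * z j * n j) := by
      rw [← e1, Finset.sum_comm]
      exact Finset.sum_congr rfl fun i _ => Finset.sum_congr rfl fun j _ => by ring
    simp only [Finset.sum_sub_distrib, ← Finset.mul_sum]
    rw [e1, e2]
    ring
  have hiae : (fun z => ∑ i, ∑ j, (((((if i = j then c j else 0) * a i z) * (D j z * D i z) +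
      c j * z j * a i z * (E j i z * D i z) + c j * z j * a i z * (D j z * E i i z))) -
      1 / 2 * ((c i * a j z + c i * z i * partialDeriv i (a j) z) * (D j z * D j z) +
      c i * z i * a j z * (E j i z * D j z) + c i * z i * a j z * (D j z * E j i z))))
      =ᵐ[volume.restrict Ω] fun z => (1 - 1 / 2 * ∑ i, c i) * (∑ i, a i z * (D i z * D i z)) +
        -ev * ∑ j, c j * (z j * (D j z * u z)) := by
    filter_upwards [ae_all_iff.2 fun i => ae_all_iff.2 (hsymm i), hpde] with z h1 h2
    rw [sum_rellich_identity (x := fun j => c j * z j) (c := c) (a := fun i => a i z)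
      (d := fun i => D i z) (b := fun i j => partialDeriv i (a j) z) (e := fun i j => E i j z)
      h1 (fun j => hhom j z) h2]
    congr 1
    rw [Finset.sum_mul, Finset.mul_sum]
    exact Finset.sum_congr rfl fun j _ => by ring
  have hcoord : ∀ j, Integrable (fun z => z j * (D j z * u z)) (volume.restrict Ω) := fun j => by
    obtain ⟨C, hC, _⟩ := exists_ae_bound_of_continuous hΩ hΩb (contDiff_coord j).continuous
    exact integrable_bdd_mul_mul (contDiff_coord j).continuous.aestronglyMeasurable hC
      (hD.2.1 j) hD.1
  have hen : ∀ i, Integrable (fun z => a i z * (D i z * D i z)) (volume.restrict Ω) := fun i => by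
    obtain ⟨C, hC, _⟩ := exists_ae_bound_of_continuous hΩ hΩb (ha i).continuous
    exact integrable_bdd_mul_mul (ha i).continuous.aestronglyMeasurable hC (hD.2.1 i) (hD.2.1 i)
  have hinterior : ∫ z in Ω, ((1 - 1 / 2 * ∑ i, c i) * (∑ i, a i z * (D i z * D i z)) +
        -ev * ∑ j, c j * (z j * (D j z * u z))) = ev := by
    rw [integral_add ((integrable_finsetSum _ fun i _ => hen i).const_mul _)
      ((integrable_finsetSum _ fun j _ => (hcoord j).const_mul (c j)).const_mul _),
      integral_const_mul, integral_const_mul, henergy,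
      integral_finsetSum _ fun j _ => (hcoord j).const_mul (c j)]
    simp only [integral_const_mul, hu.integral_coord_mul hΩ hΩb hD, hnorm]
    rw [← Finset.sum_mul]
    ring
  have hbint' := hbint.congr hbae
  refine ⟨(hbint'.const_mul 2).congr (Eventually.of_forall fun z => by ring), ?_⟩
  rw [integral_congr_ae hiae, integral_congr_ae hbae, hinterior, integral_const_mul] at hflux
  exact hflux

end Pohozaev

/-! ### The Grushin operator -/

section GrushinOperator

variable {h k : ℕ} {Ω : Set (EuclideanSpace ℝ (Fin h ⊕ Fin k))}

/-- The exponents `(1, …, 1, 1 + s, …, 1 + s)` of the Grushin dilations. -/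
noncomputable def dilationExponent (s : ℕ) (i : Fin h ⊕ Fin k) : ℝ :=
  Sum.elim (fun _ => 1) (fun _ => 1 + (s : ℝ)) i

theorem dilationField_apply (s : ℕ) (z : EuclideanSpace ℝ (Fin h ⊕ Fin k)) (i : Fin h ⊕ Fin k) :
    dilationField s z i = dilationExponent s i * z i := by
  rcases i with i | j <;> simp [dilationField, dilationExponent]

theorem norm_xPart_sq (z : EuclideanSpace ℝ (Fin h ⊕ Fin k)) :
    ‖xPart z‖ ^ 2 = ∑ i, z (Sum.inl i) ^ 2 := by
  simp [EuclideanSpace.real_norm_sq_eq, xPart]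

theorem continuous_xPart : Continuous (xPart (h := h) (k := k)) :=
  (PiLp.continuous_toLp 2 _).comp (continuous_pi fun i => (contDiff_coord (Sum.inl i)).continuous)

theorem continuous_weight (s : ℕ) (i : Fin h ⊕ Fin k) :
    Continuous (weight (h := h) (k := k) s i) := by
  rcases i with i | j
  · exact continuous_const
  · exact (continuous_xPart.norm).pow s

/-- Although `|x|^s` need not be smooth, `|x|^(2s)` is a polynomial. -/
theorem contDiff_weight_sq (s : ℕ) (i : Fin h ⊕ Fin k) :
    ContDiff ℝ ∞ fun z : EuclideanSpace ℝ (Fin h ⊕ Fin k) => weight s i z ^ 2 := by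
  rcases i with i | j
  · exact contDiff_const (c := (1 : ℝ) ^ 2)
  · have : (fun z : EuclideanSpace ℝ (Fin h ⊕ Fin k) => weight s (Sum.inr j) z ^ 2) =
        fun z => (∑ i, z (Sum.inl i) ^ 2) ^ s := by
      ext z
      rw [← norm_xPart_sq, ← pow_mul, mul_comm, pow_mul]
      rfl
    rw [this]
    exact (ContDiff.sum fun i _ => (contDiff_coord (Sum.inl i)).pow 2).pow s

theorem weight_add_smul_single (s : ℕ) (i : Fin h ⊕ Fin k) (z : EuclideanSpace ℝ (Fin h ⊕ Fin k))
    (t : ℝ) : weight s i (z + t • EuclideanSpace.single i 1) = weight s i z := by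
  rcases i with i | j
  · rfl
  · have : xPart (z + t • EuclideanSpace.single (Sum.inr j) 1) = xPart z := by
      ext l
      simp [xPart]
    simp only [weight, this]

theorem partialDeriv_weight_sq (s : ℕ) (i : Fin h ⊕ Fin k)
    (z : EuclideanSpace ℝ (Fin h ⊕ Fin k)) :
    partialDeriv i (fun z => weight s i z ^ 2) z = 0 := by
  rw [partialDeriv,
    ← ((contDiff_weight_sq s i).differentiable (by simp) z).lineDeriv_eq_fderiv]
  simp [lineDeriv, weight_add_smul_single]

/-- Euler's identity for the coefficients of the Grushin operator and the Grushin dilations. -/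
theorem sum_dilation_partialDeriv_weight_sq (s : ℕ) (j : Fin h ⊕ Fin k)
    (z : EuclideanSpace ℝ (Fin h ⊕ Fin k)) :
    ∑ i, dilationExponent s i * z i * partialDeriv i (fun z => weight s j z ^ 2) z =
      2 * (dilationExponent s j - 1) * weight s j z ^ 2 := by
  simp only [← dilationField_apply, ← fderiv_apply_eq_sum]
  rw [← ((contDiff_weight_sq s j).differentiable (by simp) z).lineDeriv_eq_fderiv]
  rcases j with j | j
  · simp [lineDeriv, weight, dilationExponent]
  · have h1 : ∀ t : ℝ, weight s (Sum.inr j) (z + t • dilationField s z) ^ 2 =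
        (1 + t) ^ (2 * s) * weight s (Sum.inr j) z ^ 2 := fun t => by
      have h2 : xPart (z + t • dilationField s z) = (1 + t) • xPart z := by
        ext l
        simp [xPart, dilationField]
        ring
      simp only [weight, Sum.elim_inr, h2, norm_smul, mul_pow, Real.norm_eq_abs]
      rw [pow_mul, ← sq_abs (1 + t), ← pow_mul, ← pow_mul, ← pow_mul, mul_comm s 2]
    have h3 : HasDerivAt (fun t : ℝ => (1 + t) ^ (2 * s) * weight s (Sum.inr j) z ^ 2)
        (2 * s * weight s (Sum.inr j) z ^ 2) 0 := by
      simpa using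
        (((hasDerivAt_id (0 : ℝ)).const_add 1).pow (2 * s)).mul_const (weight s (Sum.inr j) z ^ 2)
    simp only [lineDeriv, h1, h3.deriv]
    simp [dilationExponent]

/-- The field `weight s i * ∂ᵢ` is divergence free. Only the derivative of the weight along the
`i`-th direction enters, which exists although the weight need not be differentiable. -/
theorem integral_weight_mul_partialDeriv (s : ℕ) (i : Fin h ⊕ Fin k)
    {g : EuclideanSpace ℝ (Fin h ⊕ Fin k) → ℝ} (hg : ContDiff ℝ ∞ g) (hgc : HasCompactSupport g) :
    ∫ z, weight s i z * partialDeriv i g z = 0 := by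
  have hw := continuous_weight (h := h) (k := k) s i
  have := integral_bilinear_hasLineDerivAt_right_eq_neg_left_of_integrable
    (μ := (volume : Measure (EuclideanSpace ℝ (Fin h ⊕ Fin k))))
    (B := ContinuousLinearMap.mul ℝ ℝ) (f := weight s i) (f' := fun _ => 0) (g := g)
    (g' := partialDeriv i g) (v := EuclideanSpace.single i 1) (by simp)
    ((hw.mul (contDiff_partialDeriv hg i).continuous).integrable_of_hasCompactSupport
      (hasCompactSupport_partialDeriv hgc i).mul_left)
    ((hw.mul hg.continuous).integrable_of_hasCompactSupport hgc.mul_left)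
    (fun z _ => by
      simp only [HasLineDerivAt, weight_add_smul_single]
      exact hasDerivAt_const _ _)
    (fun z _ => (hg.differentiable (by simp) z).hasFDerivAt.hasLineDerivAt _)
  simpa using this

theorem IsTestFunction.integral_mul_weight_partialDeriv
    {φ θ : EuclideanSpace ℝ (Fin h ⊕ Fin k) → ℝ}
    (hφ : IsTestFunction Ω φ) (hθ : IsTestFunction Ω θ) (s : ℕ) (i : Fin h ⊕ Fin k) :
    ∫ z in Ω, φ z * (weight s i z * Grushin.partialDeriv i θ z) =
      -∫ z in Ω, weight s i z * Grushin.partialDeriv i φ z * θ z := by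
  have hw := continuous_weight (h := h) (k := k) s i
  rw [setIntegral_eq_integral_of_forall_compl_eq_zero fun z hz => by rw [hφ.eq_zero hz, zero_mul],
    setIntegral_eq_integral_of_forall_compl_eq_zero fun z hz => by rw [hθ.eq_zero hz, mul_zero],
    eq_neg_iff_add_eq_zero, ← integral_add]
  · rw [← integral_weight_mul_partialDeriv s i (hφ.1.mul hθ.1) (hφ.2.1.mul_right)]
    refine integral_congr_ae (Eventually.of_forall fun z => ?_)
    have := partialDeriv_mul (i := i) (hφ.1.differentiable (by simp) z)
      (hθ.1.differentiable (by simp) z)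
    simp only [this]
    ring
  · have hc := hφ.1.continuous.mul (hw.mul (hθ.partialDeriv i).1.continuous)
    exact hc.integrable_of_hasCompactSupport hφ.2.1.mul_right
  · have hc := (hw.mul (hφ.partialDeriv i).1.continuous).mul hθ.1.continuous
    exact hc.integrable_of_hasCompactSupport hθ.2.1.mul_left

theorem MemL2.weight_mul (hΩ : IsOpen Ω) (hΩb : Bornology.IsBounded Ω)
    {F : EuclideanSpace ℝ (Fin h ⊕ Fin k) → ℝ} (hF : MemL2 Ω F) (s : ℕ) (i : Fin h ⊕ Fin k) :
    MemL2 Ω fun z => weight s i z * F z := by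
  obtain ⟨C, hC, _⟩ := exists_ae_bound_of_continuous hΩ hΩb (continuous_weight s i)
  exact memLp_bdd_mul (continuous_weight s i).aestronglyMeasurable hC hF

theorem IsTestFunction.isWeakGrushinGrad (hΩ : IsOpen Ω) (hΩb : Bornology.IsBounded Ω)
    {φ : EuclideanSpace ℝ (Fin h ⊕ Fin k) → ℝ} (hφ : IsTestFunction Ω φ) (s : ℕ) :
    IsWeakGrushinGrad s Ω φ fun i z => weight s i z * Grushin.partialDeriv i φ z :=
  ⟨hφ.memL2, fun i => (hφ.partialDeriv i).memL2.weight_mul hΩ hΩb s i,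
    fun i _ hθ => hφ.integral_mul_weight_partialDeriv hθ s i⟩

theorem IsTestFunction.memWG0 (hΩ : IsOpen Ω) (hΩb : Bornology.IsBounded Ω)
    {φ : EuclideanSpace ℝ (Fin h ⊕ Fin k) → ℝ} (hφ : IsTestFunction Ω φ) (s : ℕ) :
    MemWG0 s Ω φ :=
  ⟨_, hφ.isWeakGrushinGrad hΩ hΩb s, fun _ => φ, fun _ => hφ, by simp [TendstoL2],
    fun i => by simp [TendstoL2]⟩

/-- On `W_0^{1,2}` the Grushin gradient is the weighted ordinary gradient. -/
theorem MemW120.isWeakGrushinGrad (hΩ : IsOpen Ω) (hΩb : Bornology.IsBounded Ω)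
    {u : EuclideanSpace ℝ (Fin h ⊕ Fin k) → ℝ}
    {D : Fin h ⊕ Fin k → EuclideanSpace ℝ (Fin h ⊕ Fin k) → ℝ}
    (hu : MemW120 Ω u) (hD : IsWeakGrad Ω u D) (s : ℕ) :
    IsWeakGrushinGrad s Ω u fun i z => weight s i z * D i z := by
  refine ⟨hD.1, fun i => (hD.2.1 i).weight_mul hΩ hΩb s i, fun i θ hθ => ?_⟩
  obtain ⟨φ, hφ, hφu, hφD⟩ := hu.exists_approx hΩ hD
  obtain ⟨C, hC, _⟩ := exists_ae_bound_of_continuous hΩ hΩb (continuous_weight s i)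
  have hm := (continuous_weight (h := h) (k := k) s i).aestronglyMeasurable
    (μ := volume.restrict Ω)
  have hconst : ∀ F : EuclideanSpace ℝ (Fin h ⊕ Fin k) → ℝ,
      Tendsto (fun _ : ℕ => eLpNorm (F - F) 2 (volume.restrict Ω)) atTop (𝓝 0) := fun F => by simp
  have t1 := tendsto_integral_bdd_mul_mul hm hC (fun n => (hφ n).memL2) hD.1
    (fun _ => (hθ.partialDeriv i).memL2) (hθ.partialDeriv i).memL2 hφu (hconst _)
  have t2 := (tendsto_integral_bdd_mul_mul hm hC (fun n => ((hφ n).partialDeriv i).memL2)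
    (hD.2.1 i) (fun _ => hθ.memL2) hθ.memL2 (hφD i) (hconst _)).neg
  simp only [mul_left_comm (u _), mul_assoc]
  refine tendsto_nhds_unique t1 (t2.congr fun n => ?_)
  have := (hφ n).integral_mul_weight_partialDeriv hθ s i
  simp only [mul_left_comm (φ n _), mul_assoc] at this
  exact this.symm

/-- An eigenfunction in `W_0^{1,2} ∩ W^{2,2}` solves the equation almost everywhere. -/
theorem IsEigenfunction.ae_eq (hΩ : IsOpen Ω) (hΩb : Bornology.IsBounded Ω) {s : ℕ} {ev : ℝ}
    {u : EuclideanSpace ℝ (Fin h ⊕ Fin k) → ℝ}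
    {D : Fin h ⊕ Fin k → EuclideanSpace ℝ (Fin h ⊕ Fin k) → ℝ}
    {E : Fin h ⊕ Fin k → Fin h ⊕ Fin k → EuclideanSpace ℝ (Fin h ⊕ Fin k) → ℝ}
    (hu : IsEigenfunction s Ω ev u) (hu0 : MemW120 Ω u) (hD : IsWeakGrad Ω u D)
    (hE : ∀ i, IsWeakGrad Ω (D i) (E i)) :
    ∀ᵐ z ∂(volume.restrict Ω), ∑ i, weight s i z ^ 2 * E i i z = -ev * u z := by
  have hL : ∀ i, MemL2 Ω fun z => weight s i z ^ 2 * E i i z := fun i => by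
    obtain ⟨C, hC, _⟩ := exists_ae_bound_of_continuous hΩ hΩb (contDiff_weight_sq s i).continuous
    exact memLp_bdd_mul (contDiff_weight_sq s i).continuous.aestronglyMeasurable hC ((hE i).2.1 i)
  refine ae_eq_of_forall_integral_testFunction hΩ (memLp_finsetSum _ fun i _ => hL i)
    (hD.1.const_mul (-ev)) fun φ hφ => ?_
  have h1 := hu.2.2 φ (hφ.memWG0 hΩ hΩb s) _ _ (hu0.isWeakGrushinGrad hΩ hΩb hD s)
    (hφ.isWeakGrushinGrad hΩ hΩb s)
  have h2 : ∀ i, ∫ z in Ω, weight s i z * D i z * (weight s i z * partialDeriv i φ z) =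
      -∫ z in Ω, weight s i z ^ 2 * E i i z * φ z := fun i => by
    have h3 := (hE i).2.2 i _ (hφ.mul_left (contDiff_weight_sq s i))
    have h4 : ∀ z, partialDeriv i (fun z => weight s i z ^ 2 * φ z) z =
        weight s i z ^ 2 * partialDeriv i φ z := fun z => by
      rw [partialDeriv_mul ((contDiff_weight_sq s i).differentiable (by simp) z)
        (hφ.1.differentiable (by simp) z), partialDeriv_weight_sq, zero_mul]
      ring
    simp only [h4] at h3
    calc _ = ∫ z in Ω, D i z * (weight s i z ^ 2 * partialDeriv i φ z) :=
          integral_congr_ae (Eventually.of_forall fun z => by ring)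
      _ = _ := h3
      _ = _ := by
          rw [integral_congr_ae (Eventually.of_forall fun z => ?_)]
          ring
  have i1 : ∀ i, Integrable (fun z => weight s i z * D i z * (weight s i z * partialDeriv i φ z))
      (volume.restrict Ω) := fun i =>
    ((hD.2.1 i).weight_mul hΩ hΩb s i).integrable_mul
      ((hφ.partialDeriv i).memL2.weight_mul hΩ hΩb s i)
  have i2 : ∀ i, Integrable (fun z => weight s i z ^ 2 * E i i z * φ z) (volume.restrict Ω) :=
    fun i => (hL i).integrable_mul hφ.memL2
  rw [integral_finsetSum _ fun i _ => i1 i] at h1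
  simp only [h2, Finset.sum_neg_distrib, Finset.sum_mul, mul_assoc (-ev)] at h1 ⊢
  rw [integral_finsetSum _ fun i _ => i2 i, integral_const_mul]
  linarith

theorem inner_dilationField (s : ℕ) (z n : EuclideanSpace ℝ (Fin h ⊕ Fin k)) :
    inner ℝ (dilationField s z) n = ∑ i, dilationExponent s i * z i * n i := by
  rw [PiLp.inner_apply]
  exact Finset.sum_congr rfl fun i _ => by
    rw [dilationField_apply]; simp [mul_comm]

theorem norm_grushinNormal_sq (s : ℕ) (Ω : Set (EuclideanSpace ℝ (Fin h ⊕ Fin k)))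
    (z : EuclideanSpace ℝ (Fin h ⊕ Fin k)) :
    ‖grushinNormal s Ω z‖ ^ 2 = ∑ i, weight s i z ^ 2 * outerNormal Ω z i ^ 2 := by
  simp [EuclideanSpace.real_norm_sq_eq, grushinNormal, mul_pow]

end GrushinOperator

end Grushin

theorem mainTheorem7 (h k s : ℕ) (hh : 1 ≤ h) (hk : 1 ≤ k) (hs : 1 ≤ s)
    (Ω : Set (EuclideanSpace ℝ (Fin h ⊕ Fin k))) (hΩo : IsOpen Ω)
    (hΩb : Bornology.IsBounded Ω) (hΩ : Grushin.IsOfClassC1 Ω)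
    (ev : ℝ) (u : EuclideanSpace ℝ (Fin h ⊕ Fin k) → ℝ)
    (hu : Grushin.IsEigenfunction s Ω ev u)
    (hnorm : ∫ z in Ω, u z ^ 2 = 1)
    (hu0 : Grushin.MemW120 Ω u) (hu2 : Grushin.MemW22 Ω u) :
    (∃ g, Grushin.IsNormalDerivative Ω u g) ∧
      ∀ g, Grushin.IsNormalDerivative Ω u g →
        Integrable (fun z => g z ^ 2 * ‖Grushin.grushinNormal s Ω z‖ ^ 2 *
          inner ℝ (Grushin.dilationField s z) (Grushin.outerNormal Ω z))
          (Grushin.surfaceMeasure Ω) ∧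
        ev = 1 / 2 * ∫ z, g z ^ 2 * ‖Grushin.grushinNormal s Ω z‖ ^ 2 *
          inner ℝ (Grushin.dilationField s z) (Grushin.outerNormal Ω z)
          ∂(Grushin.surfaceMeasure Ω) := by
  refine ⟨?_, ?_⟩
  · obtain ⟨D, hD, hW⟩ := hu2
    choose T hT using fun i => Grushin.exists_isTrace hΩo hΩb hΩ (hW i)
    exact ⟨_, D, T, hD, hT, ae_eq_rfl⟩
  · rintro g ⟨D, T, hD, hT, hg⟩
    choose E hE using fun i => (hT i).2
    have hE' : ∀ i, Grushin.IsWeakGrad Ω (D i) (E i) := fun i => (hE i).1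
    have hgrad := hu0.isWeakGrushinGrad hΩo hΩb hD s
    have henergy : ∫ z in Ω, ∑ i, Grushin.weight s i z ^ 2 * (D i z * D i z) = ev := by
      have h1 := hu.2.2 u hu.1 _ _ hgrad hgrad
      simp only [← pow_two, hnorm, mul_one, mul_pow] at h1 ⊢
      exact h1
    obtain ⟨h1, h2⟩ := Grushin.rellich_pohozaev hΩo hΩb hΩ (Grushin.contDiff_weight_sq s)
      (Grushin.partialDeriv_weight_sq s) (Grushin.sum_dilation_partialDeriv_weight_sq s) hu0 hD hT
      hE' (by simpa only [pow_two] using hnorm) (hu.ae_eq hΩo hΩb hu0 hD hE') henergy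
    have heq : (fun z => (∑ i, T i z * Grushin.outerNormal Ω z i) ^ 2 *
        (∑ i, Grushin.weight s i z ^ 2 * Grushin.outerNormal Ω z i ^ 2) *
          ∑ i, Grushin.dilationExponent s i * z i * Grushin.outerNormal Ω z i)
        =ᵐ[Grushin.surfaceMeasure Ω] fun z => g z ^ 2 * ‖Grushin.grushinNormal s Ω z‖ ^ 2 *
          inner ℝ (Grushin.dilationField s z) (Grushin.outerNormal Ω z) := by
      filter_upwards [hg] with z hz
      rw [hz, Grushin.norm_grushinNormal_sq, Grushin.inner_dilationField]
    exact ⟨h1.congr heq, by rw [← integral_congr_ae heq]; exact h2⟩
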